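/- Consider a downlink cellular network with $T\ge 1$ tiers of base stations in the plane, seen from a terminal at the origin. The base stations of tier $q$ form a homogeneous Poisson point process of density $\lambda_q>0$; the $T$ processes are independent. Tier $q$ has transmit power $P_q>0$, biasing factor $B_q>0$ and path-loss exponent $\alpha_q>2$, and $\sigma_N^2>0$ is the noise power. All power channel gains are non-negative with mean $1$, mutually independent and independent of the positions of the base stations. An interfering base station $b$ of tier $q$ has a gain $g_{q,b}$ whose law depends only on $q$; if the serving base station belongs to tier $t$, its link has a gain $g_{t,0}$, with a possibly different law. If $d_q$ denotes the distance from the terminal to the nearest base station of tier $q$, then the terminal is associated to the tier $t^*$ that maximizes $P_q d_q^{-\alpha_q}B_q$ and is served by the nearest base station of that tier; every other base station of every tier interferes. For a tier $t$ and $\xi>0$ let $$\mathcal R_t(\xi)=\mathbb E\left\{\ln\left(1+\frac{P_t\,g_{t,0}\,\xi^{-\alpha_t}}{\sigma_N^2+I_{\rm agg}(\xi)}\right)\right\},\qquad I_{\rm agg}=\sum_{q=1}^T\ \sum_{b\ \text{not serving}}P_q\,g_{q,b}\,d_{q,b}^{-\alpha_q},$$ where $d_{q,b}$ is the distance to the $b$-th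 base station of tier $q$ and the expectation is conditional on $t^*=t$ and on $d_t=\xi$, and let $$\tilde{\mathcal R}_t=2\pi\lambda_t\int_0^{\infty}\xi\exp\left\{-\pi\sum_{q=1}^T\lambda_q\left(\frac{P_q}{P_t}\frac{B_q}{B_t}\right)^{2/\alpha_q}\xi^{2\alpha_t/\alpha_q}\right\}\mathcal R_t(\xi)\,d\xi$$ be the contribution of tier $t$ to the average rate. Put ${\rm SNR}_q=P_q/\sigma_N^2$, $\mathcal M_{t,0}(s)=\mathbb E\{e^{-s g_{t,0}}\}$, $\mathcal M_{q,I}(s)=\mathbb E\{e^{-s g_{q,b}}\}$ and $\mathcal M_{q,I}^{(k)}(s)=\mathbb E\{g_{q,b}^{k+1}e^{-s g_{q,b}}\}$. Suppose that $\alpha_q=\alpha$ for all $q$. Then, for every tier $t$, $$\tilde{\mathcal R}_t=\int_0^\infty\left[1-\mathcal M_{t,0}({\rm SNR}_t\,y)\right]\frac{\tilde{\mathcal G}_I^{(t)}(y)}{y}\,dy,$$ $$\tilde{\mathcal G}_I^{(t)}(y)=\frac1{\tilde{\mathcal Z}_I^{(t)}(y)}-\frac{\alpha}{2}\,\frac{y}{\tilde{\mathcal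 Z}_I^{(t)}(y)}\int_0^\infty\xi^{\frac{\alpha}{2}-1}\exp\left\{-\pi\lambda_t\tilde{\mathcal Z}_I^{(t)}(y)\,\xi\right\}\exp\left\{-y\,\xi^{\alpha/2}\right\}d\xi,$$ where $$\tilde{\mathcal Z}_I^{(t)}(y)=\sum_{q=1}^T\frac{\lambda_q}{\lambda_t}\,\tilde{\mathcal Z}_I^{(t,q)}(y),\qquad \tilde{\mathcal Z}_I^{(t,q)}(y)=\rho^{2/\alpha}\left[\mathcal M_{q,I}\left(\rho^{-1}{\rm SNR}_q\,y\right)+\mathcal T_{q,I}\left(\rho^{-1}{\rm SNR}_q\,y\right)\right]\ \text{ with }\ \rho=\frac{P_q}{P_t}\frac{B_q}{B_t},$$ $$\mathcal T_{q,I}(y)=\Gamma\left(1-\frac2\alpha\right)\sum_{k=0}^{\infty}\frac{y^{k+1}\,\mathcal M_{q,I}^{(k)}(y)}{\Gamma\left(2-\frac2\alpha+k\right)}.$$ All the integrals and series here converge, and $\tilde{\mathcal Z}_I^{(t)}(y)>0$ for $y>0$. -/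

import Mathlib

open MeasureTheory ProbabilityTheory Set
open scoped ENNReal NNReal

noncomputable section

/-- The plane in which base stations live, with the Euclidean norm and Lebesgue measure. -/
abbrev Plane : Type := EuclideanSpace ℝ (Fin 2)

/-- A law of a power channel gain: a probability measure on `[0, ∞)` with mean one. -/
structure IsFadingLaw (ν : Measure ℝ) : Prop where
  isProbabilityMeasure : IsProbabilityMeasure ν
  nonneg : ∀ᵐ x ∂ν, 0 ≤ x
  integrable : Integrable (fun x => x) ν
  mean_one : ∫ x, x ∂ν = 1

/-- The number of indices `b` whose point `X b ω` lies in `A`. -/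
def pointCount {Ω : Type*} (X : ℕ → Ω → Plane) (A : Set Plane) (ω : Ω) : ℝ≥0∞ :=
  ∑' b, A.indicator (fun _ => (1 : ℝ≥0∞)) (X b ω)

/-- The random points `X 0, X 1, …` form a homogeneous Poisson point process of density `lam`
in the plane: counts of sets of finite area are Poisson distributed with mean
`lam * area`, and counts of pairwise disjoint sets are independent. -/
structure IsHomogeneousPoisson {Ω : Type*} [MeasurableSpace Ω] (μ : Measure Ω) (lam : ℝ)
    (X : ℕ → Ω → Plane) : Prop where
  measurable : ∀ b, Measurable (X b)
  count_law : ∀ A : Set Plane, MeasurableSet A → volume A < ∞ →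
    μ.map (pointCount X A) =
      (poissonMeasure (Real.toNNReal (lam * volume.real A))).map (fun n : ℕ => (n : ℝ≥0∞))
  count_indep : ∀ (n : ℕ) (A : Fin n → Set Plane), (∀ i, MeasurableSet (A i)) →
    Pairwise (fun i j => Disjoint (A i) (A j)) → iIndepFun (fun i => pointCount X (A i)) μ

/-- The parameters of a network with `T` tiers: per tier the density, transmit power, biasing
factor, path-loss exponent, law of the power gain of the serving link and common law of the
power gains of the interfering links; and the noise power. -/
structure NetworkParams (T : ℕ) where
  lam : Fin T → ℝ
  P : Fin T → ℝ
  B : Fin T → ℝ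
  alpha : Fin T → ℝ
  servingLaw : Fin T → Measure ℝ
  interfererLaw : Fin T → Measure ℝ
  noise : ℝ
  lam_pos : ∀ t, 0 < lam t
  P_pos : ∀ t, 0 < P t
  B_pos : ∀ t, 0 < B t
  two_lt_alpha : ∀ t, 2 < alpha t
  isFadingLaw_serving : ∀ t, IsFadingLaw (servingLaw t)
  isFadingLaw_interferer : ∀ t, IsFadingLaw (interfererLaw t)
  noise_pos : 0 < noise

/-- A network with the given parameters on the probability space `(Ω, μ)`, seen from a terminal at
the origin: `pos q b` is the position of the `b`-th base station of tier `q`, `gain q b` its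
power gain when it interferes, and `servingGain q` the power gain of the link from the
serving base station when that belongs to tier `q`. The tiers are independent Poisson
processes; the gains are mutually independent, and independent of all the positions. -/
structure CellularNetwork {T : ℕ} (par : NetworkParams T) {Ω : Type*} [MeasurableSpace Ω]
    (μ : Measure Ω) where
  pos : Fin T → ℕ → Ω → Plane
  gain : Fin T → ℕ → Ω → ℝ
  servingGain : Fin T → Ω → ℝ
  isPoisson : ∀ q, IsHomogeneousPoisson μ (par.lam q) (pos q)
  measurable_gain : ∀ q b, Measurable (gain q b)
  measurable_servingGain : ∀ q, Measurable (servingGain q)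
  gain_law : ∀ q b, μ.map (gain q b) = par.interfererLaw q
  servingGain_law : ∀ q, μ.map (servingGain q) = par.servingLaw q
  indep_tiers : iIndepFun (fun (q : Fin T) (ω : Ω) (b : ℕ) => pos q b ω) μ
  indep_gains : iIndepFun
    (fun (j : (Fin T × ℕ) ⊕ Fin T) (ω : Ω) =>
      Sum.elim (fun p : Fin T × ℕ => gain p.1 p.2 ω) (fun q => servingGain q ω) j) μ
  indep_pos_gains : IndepFun
    (fun (ω : Ω) (p : Fin T × ℕ) => pos p.1 p.2 ω)
    (fun (ω : Ω) (j : (Fin T × ℕ) ⊕ Fin T) =>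
      Sum.elim (fun p : Fin T × ℕ => gain p.1 p.2 ω) (fun q => servingGain q ω) j) μ

namespace CellularNetwork

variable {T : ℕ} {par : NetworkParams T} {Ω : Type*} [MeasurableSpace Ω] {μ : Measure Ω}

/-- The distance from the terminal to the nearest base station of tier `q`. -/
def dist (N : CellularNetwork par μ) (q : Fin T) (ω : Ω) : ℝ :=
  ⨅ b, ‖N.pos q b ω‖

/-- The event that the terminal is associated to tier `t`, which maximizes the biased
long-term received power of the nearest base station (ties have probability zero). -/
def associated (N : CellularNetwork par μ) (t : Fin T) : Set Ω :=
  {ω | ∀ q, par.P q * N.dist q ω ^ (-par.alpha q) * par.B q ≤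
    par.P t * N.dist t ω ^ (-par.alpha t) * par.B t}

open scoped Classical in
/-- The aggregate interference, generated by all base stations of all tiers except the
serving one, when the latter is the nearest base station of tier `t`. -/
def interference (N : CellularNetwork par μ) (t : Fin T) (ω : Ω) : ℝ≥0∞ :=
  ∑' (q : Fin T) (b : ℕ),
    if q = t ∧ ‖N.pos q b ω‖ = N.dist t ω then 0
    else ENNReal.ofReal (par.P q * N.gain q b ω * ‖N.pos q b ω‖ ^ (-par.alpha q))

/-- The joint law of the power gain of the serving link and the aggregate interference,
conditioned on the association to tier `t` and on the distance `ξ` to the serving base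
station. -/
def conditionalLaw [IsProbabilityMeasure μ] (N : CellularNetwork par μ) (t : Fin T) (ξ : ℝ) :
    Measure (ℝ × ℝ) :=
  condDistrib (fun ω => (N.servingGain t ω, (N.interference t ω).toReal)) (N.dist t)
    (cond μ (N.associated t)) ξ

end CellularNetwork

/-- `ln (1 + SINR)` at distance `ξ` from the serving base station of tier `t`, for the serving
gain `g` and the interference `i`. -/
def shannonRate {T : ℕ} (par : NetworkParams T) (t : Fin T) (ξ g i : ℝ) : ℝ :=
  Real.log (1 + par.P t * g * ξ ^ (-par.alpha t) / (par.noise + i))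

namespace CellularNetwork

variable {T : ℕ} {par : NetworkParams T} {Ω : Type*} [MeasurableSpace Ω] {μ : Measure Ω}

/-- The average rate conditioned on the association to tier `t` at serving distance `ξ`. -/
def conditionalRate [IsProbabilityMeasure μ] (N : CellularNetwork par μ) (t : Fin T) (ξ : ℝ) : ℝ :=
  ∫ p, shannonRate par t ξ p.1 p.2 ∂(N.conditionalLaw t ξ)

/-- The integrand of the contribution of tier `t` to the average rate. -/
def rateIntegrand [IsProbabilityMeasure μ] (N : CellularNetwork par μ) (t : Fin T) (ξ : ℝ) : ℝ :=
  ξ * Real.exp (-(Real.pi * ∑ q, par.lam q *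
      ((par.P q / par.P t) * (par.B q / par.B t)) ^ (2 / par.alpha q) *
        ξ ^ (2 * par.alpha t / par.alpha q))) * N.conditionalRate t ξ

/-- The contribution of tier `t` to the average rate. -/
def tierRate [IsProbabilityMeasure μ] (N : CellularNetwork par μ) (t : Fin T) : ℝ :=
  2 * Real.pi * par.lam t * ∫ ξ in Ioi (0 : ℝ), N.rateIntegrand t ξ

end CellularNetwork

namespace NetworkParams

variable {T : ℕ} (par : NetworkParams T)

/-- The signal-to-noise ratio of tier `t`. -/
def snr (t : Fin T) : ℝ := par.P t / par.noise

/-- The transform `s ↦ 𝔼 exp (-s g)` of the serving gain of tier `t`. -/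
def servingMGF (t : Fin T) (s : ℝ) : ℝ := ∫ x, Real.exp (-s * x) ∂(par.servingLaw t)

/-- The transform `s ↦ 𝔼 exp (-s g)` of an interfering gain of tier `q`. -/
def interfererMGF (q : Fin T) (s : ℝ) : ℝ := ∫ x, Real.exp (-s * x) ∂(par.interfererLaw q)

/-- `𝔼 (g ^ (k + 1) * exp (-s g))` for an interfering gain `g` of tier `q`. -/
def interfererMoment (q : Fin T) (k : ℕ) (s : ℝ) : ℝ :=
  ∫ x, x ^ (k + 1) * Real.exp (-s * x) ∂(par.interfererLaw q)

/-- The terms of the series in the function `𝒯` of tier `q`, for path-loss exponent `α`. -/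
def tailTerm (α : ℝ) (q : Fin T) (s : ℝ) (k : ℕ) : ℝ :=
  s ^ (k + 1) * par.interfererMoment q k s * (Real.Gamma (2 - 2 / α + k))⁻¹

/-- The function `𝒯` of tier `q`, for path-loss exponent `α`. -/
def tail (α : ℝ) (q : Fin T) (s : ℝ) : ℝ :=
  Real.Gamma (1 - 2 / α) * ∑' k : ℕ, par.tailTerm α q s k

/-- The ratio of the biased powers of tiers `q` and `t`. -/
def biasedRatio (t q : Fin T) : ℝ := (par.P q / par.P t) * (par.B q / par.B t)

/-- The per-tier function `𝒵^(t,q)`. -/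
def zPair (α : ℝ) (t q : Fin T) (y : ℝ) : ℝ :=
  par.biasedRatio t q ^ (2 / α) *
      par.interfererMGF q ((par.biasedRatio t q)⁻¹ * par.snr q * y) +
    par.biasedRatio t q ^ (2 / α) * par.tail α q ((par.biasedRatio t q)⁻¹ * par.snr q * y)

/-- The function `𝒵^(t)`. -/
def zTotal (α : ℝ) (t : Fin T) (y : ℝ) : ℝ :=
  ∑ q, par.lam q / par.lam t * par.zPair α t q y

/-- The integrand of the inner integral in `𝒢^(t)`. -/
def gIntegrand (α : ℝ) (t : Fin T) (y ξ : ℝ) : ℝ :=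
  ξ ^ (α / 2 - 1) * Real.exp (-(Real.pi * par.lam t * par.zTotal α t y * ξ)) *
    Real.exp (-(y * ξ ^ (α / 2)))

/-- The function `𝒢^(t)`. -/
def gFun (α : ℝ) (t : Fin T) (y : ℝ) : ℝ :=
  1 / par.zTotal α t y -
    α / 2 * (y / par.zTotal α t y) * ∫ ξ in Ioi (0 : ℝ), par.gIntegrand α t y ξ

end NetworkParams

end

/-! The proof starts from `log (1 + X / Y) = ∫ (1 - exp (-zX)) exp (-zY) / z dz` over `z > 0`
(`lintegral_exp_eq_log`), with `X` the received power and `Y` the noise plus interference. The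
interference then enters only through its Laplace transform, which a Poisson process makes explicit.
All integrands are nonnegative, so the expectations and exchanges are done with `[0, ∞]`-valued
integrals and Tonelli, and finiteness is proved only at the end.

Given the positions, the gains are independent, so the interference averages to a product over the
non-serving points of the factor `f q s`, the transform of an interfering gain at squared distance
`s` (`lintegral_expNeg_interference`). The Laplace functional
(`IsHomogeneousPoisson.lintegral_expNeg_tsum`) gives the weight of "no point at squared distance
below `r`, times the product of `f` over all points" as `voidWeight`, the exponential of `-π lam (r
+ ∫ (1 - f))`, the integral being over `(r, ∞)`. Minus its derivative in `r` is the weighted density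
of the nearest squared distance. This density carries a factor `f` from the nearest point; dividing
by it removes the serving point from the product. Independence of the tiers turns the association
event into one tail per tier. The result (`lintegral_expNeg_nonservingSum`) is `π lam t` times a
product of void weights evaluated at multiples of the squared serving distance `s`.

With one path-loss exponent these multiples are constants, and the substitution `z = y s^(α/2) /
noise` makes the product equal to `exp (-π lam t Z(y) s)` (`prod_voidWeight`). The integral over `s`
is then `𝒢` after an integration by parts (`gFun_eq_integral`). The series in `𝒵` is another form of
`1 + ∫ (1 - M(s v^(-α/2))) dv` over `v > 1`: Tonelli under the curve `w = v^(-β)`, an expansion of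
an exponential, and Beta integrals (`lintegral_one_sub_exp_rpow`, `lintegral_Ioo_rpow_mul_exp`,
`tsum_moments`).

On the side of the definition, the same Poisson computation with `z = 0` shows that the weight in
`tierRate` is the density of the serving distance on the association event. Disintegration along
`conditionalLaw` therefore identifies `tierRate` with the expected rate on that event. -/

noncomputable section

/-! ### Exponentials on `[0, ∞]` and the Laplace functional of a Poisson process -/

/-- The function `x ↦ exp (-x)` on `[0, ∞]`. -/
def expNeg (x : ℝ≥0∞) : ℝ≥0∞ := EReal.exp (-(x : EReal))

@[simp] lemma expNeg_zero : expNeg 0 = 1 := by simp [expNeg]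

@[simp] lemma expNeg_top : expNeg ∞ = 0 := by simp [expNeg]

lemma expNeg_ofReal {x : ℝ} (hx : 0 ≤ x) :
    expNeg (ENNReal.ofReal x) = ENNReal.ofReal (Real.exp (-x)) := by
  rw [expNeg, EReal.coe_ennreal_ofReal, max_eq_left hx, ← EReal.coe_neg, EReal.exp_coe]

lemma expNeg_antitone : Antitone expNeg := fun x y h => by
  unfold expNeg
  apply EReal.exp_monotone
  rw [EReal.neg_le_neg_iff]
  exact_mod_cast h

lemma expNeg_le_one (x : ℝ≥0∞) : expNeg x ≤ 1 := by
  simpa using expNeg_antitone (zero_le (a := x))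

lemma expNeg_ne_top (x : ℝ≥0∞) : expNeg x ≠ ∞ :=
  ((expNeg_le_one x).trans_lt ENNReal.one_lt_top).ne

lemma expNeg_add (x y : ℝ≥0∞) : expNeg (x + y) = expNeg x * expNeg y := by
  have h1 (z : ℝ≥0∞) : EReal.exp (z : EReal) ≠ 0 := by
    simp
  simp only [expNeg, EReal.exp_neg, EReal.coe_ennreal_add, EReal.exp_add]
  rw [ENNReal.mul_inv (Or.inl (h1 x)) (Or.inr (h1 y))]

lemma continuous_expNeg : Continuous expNeg :=
  ENNReal.continuous_exp.comp (continuous_neg.comp continuous_coe_ennreal_ereal)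

@[fun_prop]
lemma measurable_expNeg : Measurable expNeg := continuous_expNeg.measurable

lemma expNeg_sum {ι : Type*} (s : Finset ι) (f : ι → ℝ≥0∞) :
    expNeg (∑ i ∈ s, f i) = ∏ i ∈ s, expNeg (f i) := by
  induction s using Finset.cons_induction with
  | empty => simp
  | cons a s ha ih => rw [Finset.sum_cons, Finset.prod_cons, expNeg_add, ih]

lemma expNeg_mul_natCast (x : ℝ≥0∞) (n : ℕ) : expNeg (x * n) = expNeg x ^ n := by
  have := expNeg_sum (Finset.range n) (fun _ => x)
  simpa [mul_comm] using this

lemma expNeg_ofReal_neg_log {x : ℝ} (h0 : 0 < x) (h1 : x ≤ 1) :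
    expNeg (ENNReal.ofReal (-Real.log x)) = ENNReal.ofReal x := by
  rw [expNeg_ofReal (by simpa using Real.log_nonpos h0.le h1), neg_neg, Real.exp_log h0]

lemma lintegral_poissonMeasure (r : ℝ≥0) (f : ℕ → ℝ≥0∞) :
    ∫⁻ n, f n ∂(poissonMeasure r) =
      ∑' n, ENNReal.ofReal (Real.exp (-r) * r ^ n / n.factorial) * f n := by
  simp [poissonMeasure, lintegral_sum_measure]

/-- The generating function of the Poisson law, summed from the exponential series at `r * a`. -/
lemma lintegral_pow_poissonMeasure (r : ℝ≥0) {a : ℝ} (ha : 0 ≤ a) :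
    ∫⁻ n, ENNReal.ofReal a ^ n ∂(poissonMeasure r) =
      ENNReal.ofReal (Real.exp (r * a - r)) := by
  rw [lintegral_poissonMeasure]
  have h := (NormedSpace.expSeries_div_hasSum_exp ((r : ℝ) * a)).mul_left (Real.exp (-r))
  rw [← Real.exp_eq_exp_ℝ, ← Real.exp_add] at h
  rw [sub_eq_neg_add, ← h.tsum_eq, ENNReal.ofReal_tsum_of_nonneg _ h.summable]
  · refine tsum_congr fun n => ?_
    rw [← ENNReal.ofReal_pow ha, ← ENNReal.ofReal_mul (by positivity), mul_pow]
    ring_nf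
  · intro n; positivity

lemma lintegral_natCast_poissonMeasure (r : ℝ≥0) :
    ∫⁻ n, (n : ℝ≥0∞) ∂(poissonMeasure r) = r := by
  rw [lintegral_poissonMeasure, tsum_eq_zero_add' ENNReal.summable]
  have h := (NormedSpace.expSeries_div_hasSum_exp (r : ℝ)).mul_left (Real.exp (-r) * r)
  rw [← Real.exp_eq_exp_ℝ, mul_right_comm, ← Real.exp_add, neg_add_cancel, Real.exp_zero,
    one_mul] at h
  rw [← ENNReal.ofReal_coe_nnreal (p := r)]
  conv_rhs => rw [← h.tsum_eq]
  rw [ENNReal.ofReal_tsum_of_nonneg _ h.summable]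
  · simp only [Nat.cast_zero, mul_zero, zero_add]
    refine tsum_congr fun n => ?_
    rw [← ENNReal.ofReal_natCast, ← ENNReal.ofReal_mul (by positivity)]
    congr 1
    rw [Nat.factorial_succ]
    push_cast
    field_simp
    ring
  · intro n; positivity

/-- Since `exp (-r) ≥ 1 - r`, the complement has mass at least `(1 - r) * (1 + r)`. The quadratic
order in `r` is what later excludes two points at equal distance. -/
lemma poissonMeasure_two_le (r : ℝ≥0) :
    poissonMeasure r {n | 2 ≤ n} ≤ ENNReal.ofReal ((r : ℝ) ^ 2) := by
  have hc : {n : ℕ | 2 ≤ n} = ({0, 1} : Set ℕ)ᶜ := by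
    ext n; simp; omega
  have h01 : poissonMeasure r {0, 1} = ENNReal.ofReal (Real.exp (-r) * (1 + r)) := by
    rw [insert_eq, measure_union (by simp) (by simp), poissonMeasure_singleton,
      poissonMeasure_singleton, ← ENNReal.ofReal_add (by positivity) (by positivity)]
    congr 1
    simp
    ring
  rw [hc, prob_compl_eq_one_sub (by measurability), h01, ← ENNReal.ofReal_one,
    ← ENNReal.ofReal_sub _ (by positivity)]
  apply ENNReal.ofReal_le_ofReal
  have := Real.add_one_le_exp (-(r : ℝ))
  have hr : (0 : ℝ) ≤ r := r.2
  nlinarith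

variable {Ω : Type*} [MeasurableSpace Ω] {μ : Measure Ω} {lam : ℝ} {X : ℕ → Ω → Plane}

lemma measurable_pointCount (hX : ∀ b, Measurable (X b)) {A : Set Plane} (hA : MeasurableSet A) :
    Measurable (pointCount X A) := by
  unfold pointCount
  exact Measurable.tsum fun b => (measurable_const.indicator hA).comp (hX b)

/-- Grouping the points by the value of `g` reduces the sum to counts in disjoint level sets, the
only quantities about which the Poisson hypotheses speak. -/
lemma tsum_simpleFunc_eq {Ω : Type*} {X : ℕ → Ω → Plane} (g : SimpleFunc Plane ℝ≥0∞) (ω : Ω) :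
    ∑' b, g (X b ω) = ∑ v ∈ g.range, v * pointCount X (g ⁻¹' {v}) ω := by
  have h (x : Plane) : g x = ∑ v ∈ g.range, v * (g ⁻¹' {v}).indicator (fun _ => 1) x := by
    rw [Finset.sum_eq_single (g x)]
    · simp
    · intro v _ hv
      simp [hv.symm]
    · simp
  simp_rw [pointCount, ← ENNReal.tsum_mul_left]
  rw [← Summable.tsum_finsetSum (fun _ _ => ENNReal.summable)]
  exact tsum_congr fun b => h _

namespace IsHomogeneousPoisson

lemma lintegral_comp_pointCount (h : IsHomogeneousPoisson μ lam X) {A : Set Plane}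
    (hA : MeasurableSet A) (hv : volume A < ∞) {F : ℝ≥0∞ → ℝ≥0∞} (hF : Measurable F) :
    ∫⁻ ω, F (pointCount X A ω) ∂μ =
      ∫⁻ n : ℕ, F n ∂(poissonMeasure (Real.toNNReal (lam * volume.real A))) := by
  rw [← lintegral_map hF (measurable_pointCount h.measurable hA), h.count_law A hA hv,
    lintegral_map hF (by fun_prop)]

lemma lintegral_pointCount (h : IsHomogeneousPoisson μ lam X) (hl : 0 ≤ lam) {A : Set Plane}
    (hA : MeasurableSet A) (hv : volume A < ∞) :
    ∫⁻ ω, pointCount X A ω ∂μ = ENNReal.ofReal lam * volume A := by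
  have := h.lintegral_comp_pointCount hA hv measurable_id
  simp only [id] at this
  rw [this, lintegral_natCast_poissonMeasure, ← ENNReal.ofReal.eq_1, ENNReal.ofReal_mul hl,
    ofReal_measureReal hv.ne]

lemma lintegral_expNeg_pointCount (h : IsHomogeneousPoisson μ lam X) (hl : 0 ≤ lam)
    {A : Set Plane} (hA : MeasurableSet A) (hv : volume A < ∞) (v : ℝ≥0∞) :
    ∫⁻ ω, expNeg (v * pointCount X A ω) ∂μ =
      expNeg (ENNReal.ofReal lam * ((1 - expNeg v) * volume A)) := by
  rw [h.lintegral_comp_pointCount hA hv (F := fun x => expNeg (v * x)) (by fun_prop)]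
  simp_rw [expNeg_mul_natCast]
  have ha : expNeg v = ENNReal.ofReal (expNeg v).toReal :=
    (ENNReal.ofReal_toReal (expNeg_ne_top v)).symm
  have ha1 : (expNeg v).toReal ≤ 1 := by
    simpa using ENNReal.toReal_mono ENNReal.one_ne_top (expNeg_le_one v)
  have ha0 : 0 ≤ (expNeg v).toReal := ENNReal.toReal_nonneg
  generalize (expNeg v).toReal = a at *
  rw [ha, lintegral_pow_poissonMeasure _ ha0, ← ENNReal.ofReal_one, ← ENNReal.ofReal_sub _ ha0,
    ← ofReal_measureReal hv.ne, ← ENNReal.ofReal_mul (by linarith), ← ENNReal.ofReal_mul hl,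
    expNeg_ofReal, Real.coe_toNNReal]
  · ring_nf
  · positivity
  · have : 0 ≤ 1 - a := by linarith
    positivity

/-- The level sets of `g` are disjoint, so their counts are independent and the expectation factors
into Poisson generating functions. -/
lemma lintegral_expNeg_tsum_simpleFunc (h : IsHomogeneousPoisson μ lam X) (hl : 0 ≤ lam)
    (g : SimpleFunc Plane ℝ≥0∞) (hg : ∀ v ≠ 0, volume (g ⁻¹' {v}) < ∞) :
    ∫⁻ ω, expNeg (∑' b, g (X b ω)) ∂μ =
      expNeg (ENNReal.ofReal lam * ∫⁻ x, (1 - expNeg (g x))) := by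
  have hind : iIndepFun (fun i : Fin g.range.card =>
      pointCount X (g ⁻¹' {(g.range.equivFin.symm i : ℝ≥0∞)})) μ := by
    refine h.count_indep _ _ (fun i => g.measurableSet_preimage _) fun i j hij => ?_
    refine Disjoint.preimage _ ?_
    rw [disjoint_singleton]
    intro he
    exact hij (g.range.equivFin.symm.injective (Subtype.ext he))
  have hind' := hind.comp (fun i x => expNeg ((g.range.equivFin.symm i : ℝ≥0∞) * x))
    (fun i => by fun_prop)
  have hsum (f : ℝ≥0∞ → ℝ≥0∞) : ∏ v ∈ g.range, f v =
      ∏ i : Fin g.range.card, f (g.range.equivFin.symm i) := by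
    rw [← Finset.prod_coe_sort]
    exact (Equiv.prod_comp g.range.equivFin.symm (fun v : g.range => f v)).symm
  simp_rw [tsum_simpleFunc_eq, expNeg_sum, hsum]
  refine (lintegral_prod_eq_prod_lintegral_of_indepFun _ _ hind' ?_).trans ?_
  swap
  · rw [← hsum (fun v => ∫⁻ ω, ((fun x => expNeg (v * x)) ∘ pointCount X (g ⁻¹' {v})) ω ∂μ)]
    have h1 : ∫⁻ x, (1 - expNeg (g x)) =
        ∑ v ∈ g.range, (1 - expNeg v) * volume (g ⁻¹' {v}) := by
      rw [← SimpleFunc.map_lintegral (fun v => 1 - expNeg v) g, ← SimpleFunc.lintegral_eq_lintegral]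
      rfl
    rw [h1, Finset.mul_sum, expNeg_sum]
    refine Finset.prod_congr rfl fun v _ => ?_
    -- The zero level may have infinite area, where the count law says nothing; its factor is
    -- trivially one.
    by_cases hv : v = 0
    · have := hind.isProbabilityMeasure
      simp [hv]
    · exact h.lintegral_expNeg_pointCount hl (g.measurableSet_preimage _) (hg v hv) v
  · intro i
    exact (by fun_prop : Measurable fun x => expNeg ((g.range.equivFin.symm i : ℝ≥0∞) * x)).comp
      (measurable_pointCount h.measurable (g.measurableSet_preimage _))

/-- The Laplace functional of a homogeneous Poisson point process. -/
theorem lintegral_expNeg_tsum (h : IsHomogeneousPoisson μ lam X) (hl : 0 ≤ lam)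
    {g : Plane → ℝ≥0∞} (hg : Measurable g) :
    ∫⁻ ω, expNeg (∑' b, g (X b ω)) ∂μ =
      expNeg (ENNReal.ofReal lam * ∫⁻ x, (1 - expNeg (g x))) := by
  have hprob : IsProbabilityMeasure μ :=
    (h.count_indep 0 (fun _ => ∅) (fun _ => MeasurableSet.empty)
      (fun i => i.elim0)).isProbabilityMeasure
  -- Restricting the simple approximations to growing balls keeps every nonzero level set of finite
  -- area.
  set s : ℕ → SimpleFunc Plane ℝ≥0∞ := fun n =>
    (SimpleFunc.eapprox g n).restrict (Metric.ball 0 n) with hs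
  have hs_apply (n : ℕ) (x : Plane) : s n x =
      (Metric.ball (0 : Plane) n).indicator (SimpleFunc.eapprox g n) x := by
    rw [hs]; exact SimpleFunc.restrict_apply _ Metric.isOpen_ball.measurableSet _
  have hmono : Monotone fun n => (s n : Plane → ℝ≥0∞) := by
    intro m n hmn x
    simp only [hs_apply]
    refine (indicator_le_indicator (SimpleFunc.monotone_eapprox g hmn x)).trans ?_
    exact indicator_le_indicator_of_subset (Metric.ball_subset_ball (by exact_mod_cast hmn))
      (fun _ => zero_le) x
  have hlim (x : Plane) : Filter.Tendsto (fun n => s n x) Filter.atTop (nhds (g x)) := by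
    have h1 := SimpleFunc.tendsto_eapprox hg x
    refine h1.congr' ?_
    obtain ⟨m, hm⟩ := exists_nat_gt ‖x‖
    filter_upwards [Filter.eventually_ge_atTop m] with n hn
    rw [hs_apply, indicator_of_mem]
    rw [mem_ball_zero_iff]
    exact hm.trans_le (by exact_mod_cast hn)
  have hsup (x : Plane) : ⨆ n, s n x = g x :=
    iSup_eq_of_tendsto (fun m n hmn => hmono hmn x) (hlim x)
  -- Monotone convergence for the sum over the points, seen as an integral against counting measure.
  have htsum (ω : Ω) : Filter.Tendsto (fun n => ∑' b, s n (X b ω)) Filter.atTop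
      (nhds (∑' b, g (X b ω))) := by
    have := lintegral_tendsto_of_tendsto_of_monotone (μ := Measure.count)
      (f := fun n b => s n (X b ω)) (F := fun b => g (X b ω))
      (fun n => Measurable.of_discrete.aemeasurable)
      (ae_of_all _ fun b m n hmn => hmono hmn _) (ae_of_all _ fun b => hlim _)
    simpa [lintegral_count] using this
  have hL : Filter.Tendsto (fun n => ∫⁻ ω, expNeg (∑' b, s n (X b ω)) ∂μ) Filter.atTop
      (nhds (∫⁻ ω, expNeg (∑' b, g (X b ω)) ∂μ)) := by
    refine tendsto_lintegral_of_dominated_convergence (fun _ => 1) (fun n => ?_)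
      (fun n => ae_of_all _ fun ω => expNeg_le_one _) (by simp) (ae_of_all _ fun ω =>
        (continuous_expNeg.tendsto _).comp (htsum ω))
    exact measurable_expNeg.comp (Measurable.tsum fun b => (s n).measurable.comp (h.measurable b))
  have hR : Filter.Tendsto (fun n => expNeg (ENNReal.ofReal lam * ∫⁻ x, (1 - expNeg (s n x))))
      Filter.atTop (nhds (expNeg (ENNReal.ofReal lam * ∫⁻ x, (1 - expNeg (g x))))) := by
    refine (continuous_expNeg.tendsto _).comp (ENNReal.Tendsto.const_mul ?_
      (Or.inr ENNReal.ofReal_ne_top))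
    refine lintegral_tendsto_of_tendsto_of_monotone (fun n => ?_) (ae_of_all _ fun x m n hmn => ?_)
      (ae_of_all _ fun x => ?_)
    · exact (measurable_const.sub (measurable_expNeg.comp (s n).measurable)).aemeasurable
    · exact tsub_le_tsub_left (expNeg_antitone (hmono hmn x)) 1
    · exact ENNReal.Tendsto.sub tendsto_const_nhds ((continuous_expNeg.tendsto _).comp (hlim x))
        (Or.inl ENNReal.one_ne_top)
  refine tendsto_nhds_unique hL (hR.congr fun n => ?_)
  refine (h.lintegral_expNeg_tsum_simpleFunc hl (s n) fun v hv => ?_).symm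
  refine (measure_mono ?_).trans_lt (measure_ball_lt_top (x := (0 : Plane)) (r := n))
  intro x hx
  by_contra hxb
  rw [mem_preimage, mem_singleton_iff, hs_apply, indicator_of_notMem hxb] at hx
  exact hv hx.symm

end IsHomogeneousPoisson

end

/-! ### Squared distances, Campbell's theorem and the nearest point -/

noncomputable section

lemma volume_norm_sq_lt (c : ℝ) :
    volume {x : Plane | ‖x‖ ^ 2 < c} = ENNReal.ofReal Real.pi * ENNReal.ofReal c := by
  rcases le_or_gt c 0 with hc | hc
  · have : {x : Plane | ‖x‖ ^ 2 < c} = ∅ := by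
      ext x
      simp only [mem_ofPred_eq, mem_empty_iff_false, iff_false, not_lt]
      exact hc.trans (by positivity)
    simp [this, ENNReal.ofReal_of_nonpos hc]
  · have : {x : Plane | ‖x‖ ^ 2 < c} = Metric.ball 0 (Real.sqrt c) := by
      ext x
      simp [Real.lt_sqrt (norm_nonneg x)]
    rw [this, EuclideanSpace.volume_ball_fin_two, ← ENNReal.ofReal_pow (Real.sqrt_nonneg c),
      Real.sq_sqrt hc.le, mul_comm]

/-- The area of a disc is linear in its squared radius. Hence the squared distance turns planar
measure into a multiple of Lebesgue measure on the half-line, and the squared distance is the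
convenient variable throughout. -/
lemma map_norm_sq_volume :
    (volume : Measure Plane).map (fun x => ‖x‖ ^ 2) =
      ENNReal.ofReal Real.pi • volume.restrict (Ioi (0 : ℝ)) := by
  have hm : Measurable fun x : Plane => ‖x‖ ^ 2 := by fun_prop
  have h1 (c : ℝ) : (volume : Measure Plane).map (fun x => ‖x‖ ^ 2) (Iio c) =
      ENNReal.ofReal Real.pi * ENNReal.ofReal c := by
    rw [Measure.map_apply hm measurableSet_Iio]
    exact volume_norm_sq_lt c
  have h2 (c : ℝ) : (ENNReal.ofReal Real.pi • volume.restrict (Ioi (0 : ℝ))) (Iio c) =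
      ENNReal.ofReal Real.pi * ENNReal.ofReal c := by
    rw [Measure.smul_apply, Measure.restrict_apply measurableSet_Iio, smul_eq_mul, inter_comm,
      Ioi_inter_Iio, Real.volume_Ioo, sub_zero]
  have hfin (c : ℝ) : ENNReal.ofReal Real.pi * ENNReal.ofReal c ≠ ∞ :=
    ENNReal.mul_ne_top ENNReal.ofReal_ne_top ENNReal.ofReal_ne_top
  have h3 {a b : ℝ} (hab : a < b) : (volume : Measure Plane).map (fun x => ‖x‖ ^ 2) (Ico a b) =
      ENNReal.ofReal Real.pi * ENNReal.ofReal b - ENNReal.ofReal Real.pi * ENNReal.ofReal a := by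
    rw [← Iio_sdiff_Iio, measure_sdiff (Iio_subset_Iio hab.le)
      measurableSet_Iio.nullMeasurableSet (by rw [h1]; exact hfin a), h1, h1]
  refine Measure.ext_of_Ico' _ _ (fun a b hab => ?_) fun a b hab => ?_
  · rw [h3 hab]
    exact ENNReal.sub_ne_top (hfin b)
  · rw [h3 hab, ← Iio_sdiff_Iio, measure_sdiff (Iio_subset_Iio hab.le)
      measurableSet_Iio.nullMeasurableSet (by rw [h2]; exact hfin a), h2, h2]

lemma lintegral_norm_sq {φ : ℝ → ℝ≥0∞} (hφ : Measurable φ) :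
    ∫⁻ x : Plane, φ (‖x‖ ^ 2) = ENNReal.ofReal Real.pi * ∫⁻ s in Ioi (0 : ℝ), φ s := by
  rw [← lintegral_map hφ (by fun_prop), map_norm_sq_volume, lintegral_smul_measure, smul_eq_mul]

/-- The distance from the origin to the nearest of the points `X b ω`. -/
def nearest {Ω : Type*} (X : ℕ → Ω → Plane) (ω : Ω) : ℝ := ⨅ b, ‖X b ω‖

section Deterministic

variable {Ω : Type*} {X : ℕ → Ω → Plane}

lemma bddBelow_range_norm (X : ℕ → Ω → Plane) (ω : Ω) : BddBelow (range fun b => ‖X b ω‖) :=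
  ⟨0, by rintro _ ⟨b, rfl⟩; exact norm_nonneg _⟩

lemma nearest_nonneg (X : ℕ → Ω → Plane) (ω : Ω) : 0 ≤ nearest X ω :=
  le_ciInf fun _ => norm_nonneg _

lemma nearest_le (X : ℕ → Ω → Plane) (b : ℕ) (ω : Ω) : nearest X ω ≤ ‖X b ω‖ :=
  ciInf_le (bddBelow_range_norm X ω) b

lemma le_nearest_sq_iff {r : ℝ} (ω : Ω) : r ≤ nearest X ω ^ 2 ↔ ∀ b, r ≤ ‖X b ω‖ ^ 2 := by
  rw [← Real.sqrt_le_left (nearest_nonneg X ω), nearest,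
    le_ciInf_iff (bddBelow_range_norm X ω)]
  exact forall_congr' fun b => Real.sqrt_le_left (norm_nonneg _)

lemma two_le_pointCount {A : Set Plane} {ω : Ω} {b c : ℕ} (hbc : b ≠ c) (hb : X b ω ∈ A)
    (hc : X c ω ∈ A) : 2 ≤ pointCount X A ω := by
  have := ENNReal.sum_le_tsum (f := fun b => A.indicator (fun _ => (1 : ℝ≥0∞)) (X b ω)) {b, c}
  rw [Finset.sum_pair hbc, indicator_of_mem hb, indicator_of_mem hc, one_add_one_eq_two] at this
  exact this

lemma finite_of_pointCount_ne_top {A : Set Plane} {ω : Ω} (h : pointCount X A ω ≠ ∞) :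
    {b | X b ω ∈ A}.Finite := by
  refine (ENNReal.finite_const_le_of_tsum_ne_top h one_ne_zero).subset fun b hb => ?_
  rw [mem_ofPred_eq] at hb
  rw [mem_ofPred_eq, indicator_of_mem hb]

end Deterministic

variable {Ω : Type*} [MeasurableSpace Ω] {μ : Measure Ω} {lam : ℝ} {X : ℕ → Ω → Plane}

lemma measurable_nearest (hX : ∀ b, Measurable (X b)) : Measurable (nearest X) :=
  Measurable.iInf fun b => (hX b).norm

namespace IsHomogeneousPoisson

lemma isProbabilityMeasure (h : IsHomogeneousPoisson μ lam X) : IsProbabilityMeasure μ :=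
  (h.count_indep 0 (fun _ => ∅) (fun _ => MeasurableSet.empty)
    (fun i => i.elim0)).isProbabilityMeasure

/-- Campbell's theorem. -/
theorem lintegral_tsum (h : IsHomogeneousPoisson μ lam X) (hl : 0 ≤ lam) {g : Plane → ℝ≥0∞}
    (hg : Measurable g) :
    ∫⁻ ω, ∑' b, g (X b ω) ∂μ = ENNReal.ofReal lam * ∫⁻ x, g x := by
  -- The intensity measure of the process agrees with the multiple of Lebesgue measure on every
  -- ball, by the mean of the Poisson law; balls exhaust the plane.
  have key : Measure.sum (fun b => μ.map (X b)) = ENNReal.ofReal lam • volume := by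
    refine (Measure.ext_iff_of_iUnion_eq_univ
      (s := fun n : ℕ => Metric.ball (0 : Plane) n) (Metric.iUnion_ball_nat 0)).2 fun n => ?_
    ext A hA
    have hAn : MeasurableSet (A ∩ Metric.ball (0 : Plane) n) :=
      hA.inter Metric.isOpen_ball.measurableSet
    rw [Measure.restrict_apply hA, Measure.restrict_apply hA, Measure.sum_apply _ hAn,
      Measure.smul_apply, smul_eq_mul, ← h.lintegral_pointCount hl hAn
        ((measure_mono inter_subset_right).trans_lt measure_ball_lt_top)]
    unfold pointCount
    rw [MeasureTheory.lintegral_tsum]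
    · refine tsum_congr fun b => ?_
      rw [Measure.map_apply (h.measurable b) hAn, ← lintegral_indicator_one (h.measurable b hAn)]
      rfl
    · exact fun b => ((measurable_const.indicator hAn).comp (h.measurable b)).aemeasurable
  rw [MeasureTheory.lintegral_tsum (f := fun b ω => g (X b ω)) fun b => (hg.comp (h.measurable b)).aemeasurable]
  simp_rw [← lintegral_map hg (h.measurable _)]
  rw [← lintegral_sum_measure, key, lintegral_smul_measure, smul_eq_mul]

lemma ae_pointCount_lt_top (h : IsHomogeneousPoisson μ lam X) (hl : 0 ≤ lam) {A : Set Plane}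
    (hA : MeasurableSet A) (hv : volume A < ∞) : ∀ᵐ ω ∂μ, pointCount X A ω < ∞ := by
  refine ae_lt_top (measurable_pointCount h.measurable hA) ?_
  rw [h.lintegral_pointCount hl hA hv]
  exact ENNReal.mul_ne_top ENNReal.ofReal_ne_top hv.ne

lemma ae_finite_ball (h : IsHomogeneousPoisson μ lam X) (hl : 0 ≤ lam) :
    ∀ᵐ ω ∂μ, ∀ n : ℕ, {b | ‖X b ω‖ < n}.Finite := by
  rw [ae_all_iff]
  intro n
  filter_upwards [h.ae_pointCount_lt_top hl (Metric.isOpen_ball (x := (0 : Plane)) (ε := n)).measurableSet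
    measure_ball_lt_top] with ω hω
  simpa using finite_of_pointCount_ne_top hω.ne

lemma ae_norm_pos (h : IsHomogeneousPoisson μ lam X) (hl : 0 ≤ lam) :
    ∀ᵐ ω ∂μ, ∀ b, 0 < ‖X b ω‖ := by
  have h0 : ∫⁻ ω, pointCount X {0} ω ∂μ = 0 := by
    rw [h.lintegral_pointCount hl (measurableSet_singleton 0) (by simp)]
    simp
  rw [lintegral_eq_zero_iff (measurable_pointCount h.measurable (measurableSet_singleton 0))] at h0
  filter_upwards [h0] with ω hω b
  rw [norm_pos_iff]
  intro hb
  have := ENNReal.tsum_eq_zero.1 hω b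
  simp [hb] at this

lemma measure_two_le_pointCount (h : IsHomogeneousPoisson μ lam X) (hl : 0 ≤ lam) {A : Set Plane}
    (hA : MeasurableSet A) (hv : volume A < ∞) :
    μ {ω | 2 ≤ pointCount X A ω} ≤ ENNReal.ofReal ((lam * volume.real A) ^ 2) := by
  have h1 : {ω | 2 ≤ pointCount X A ω} = pointCount X A ⁻¹' (Ici 2) := rfl
  rw [h1, ← Measure.map_apply (measurable_pointCount h.measurable hA) measurableSet_Ici,
    h.count_law A hA hv, Measure.map_apply (by fun_prop) measurableSet_Ici]
  refine (measure_mono ?_).trans ((poissonMeasure_two_le _).trans_eq ?_)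
  · intro n hn
    have : (2 : ℝ≥0∞) ≤ n := hn
    exact_mod_cast this
  · rw [Real.coe_toNNReal _ (by positivity)]

/-- Cut a disc into `n` annuli of equal area. Two points at equal distance share an annulus, which
for each annulus has probability of order `1 / n ^ 2`, so the total is of order `1 / n`. -/
lemma ae_norm_ne (h : IsHomogeneousPoisson μ lam X) (hl : 0 ≤ lam) :
    ∀ᵐ ω ∂μ, ∀ b c, b ≠ c → ‖X b ω‖ ≠ ‖X c ω‖ := by
  have key (R : ℕ) : ∀ᵐ ω ∂μ, ¬ ∃ b c, b ≠ c ∧ ‖X b ω‖ = ‖X c ω‖ ∧ ‖X b ω‖ ^ 2 < R := by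
    rcases Nat.eq_zero_or_pos R with rfl | hR
    · refine ae_of_all _ fun ω => ?_
      rintro ⟨b, c, -, -, hb⟩
      have : 0 ≤ ‖X b ω‖ ^ 2 := by positivity
      simp only [Nat.cast_zero] at hb
      linarith
    have hR' : (0 : ℝ) < R := by exact_mod_cast hR
    -- Equal steps in the squared radius give annuli of equal area `π * R / n`.
    set A : ℕ → ℕ → Set Plane := fun n i =>
      {x | ‖x‖ ^ 2 ∈ Ico ((i : ℝ) * (R / n)) ((i + 1 : ℝ) * (R / n))} with hA
    have hAm (n i : ℕ) : MeasurableSet (A n i) :=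
      (by fun_prop : Measurable fun x : Plane => ‖x‖ ^ 2) measurableSet_Ico
    have hAv (n i : ℕ) : volume (A n i) ≤ ENNReal.ofReal (Real.pi * (R / n)) := by
      have : volume (A n i) = (volume : Measure Plane).map (fun x => ‖x‖ ^ 2)
          (Ico ((i : ℝ) * (R / n)) ((i + 1 : ℝ) * (R / n))) := by
        rw [Measure.map_apply (by fun_prop) measurableSet_Ico]; rfl
      rw [this, map_norm_sq_volume, Measure.smul_apply, smul_eq_mul,
        ENNReal.ofReal_mul Real.pi_pos.le]
      gcongr
      refine (Measure.restrict_apply_le _ _).trans_eq ?_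
      rw [Real.volume_Ico]
      ring_nf
    have hbound (n : ℕ) (hn : 0 < n) :
        μ {ω | ∃ b c, b ≠ c ∧ ‖X b ω‖ = ‖X c ω‖ ∧ ‖X b ω‖ ^ 2 < R} ≤
          ENNReal.ofReal ((lam * Real.pi * R) ^ 2 / n) := by
      have hn' : (0 : ℝ) < n := by exact_mod_cast hn
      have hsub : {ω | ∃ b c, b ≠ c ∧ ‖X b ω‖ = ‖X c ω‖ ∧ ‖X b ω‖ ^ 2 < R} ⊆
          ⋃ i ∈ Finset.range n, {ω | 2 ≤ pointCount X (A n i) ω} := by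
        rintro ω ⟨b, c, hbc, he, hlt⟩
        have hd : 0 < (R : ℝ) / n := by positivity
        set i := ⌊‖X b ω‖ ^ 2 / (R / n)⌋₊ with hi
        have hi1 : (i : ℝ) * (R / n) ≤ ‖X b ω‖ ^ 2 := by
          rw [← le_div_iff₀ hd]
          exact Nat.floor_le (by positivity)
        have hi2 : ‖X b ω‖ ^ 2 < (i + 1 : ℝ) * (R / n) := by
          rw [← div_lt_iff₀ hd]
          exact Nat.lt_floor_add_one _
        have hin : i < n := by
          rw [hi, Nat.floor_lt (by positivity), div_lt_iff₀ hd, mul_div_cancel₀ _ hn'.ne']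
          exact hlt
        simp only [mem_iUnion, Finset.mem_range]
        refine ⟨i, hin, two_le_pointCount hbc ⟨hi1, hi2⟩ ?_⟩
        show ‖X c ω‖ ^ 2 ∈ Ico ((i : ℝ) * (R / n)) ((i + 1 : ℝ) * (R / n))
        rw [← he]
        exact ⟨hi1, hi2⟩
      refine (measure_mono hsub).trans ((measure_biUnion_finset_le _ _).trans ?_)
      refine (Finset.sum_le_sum (g := fun _ =>
        ENNReal.ofReal ((lam * (Real.pi * (R / n))) ^ 2)) fun i _ => ?_).trans ?_
      · refine (h.measure_two_le_pointCount hl (hAm n i)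
          ((hAv n i).trans_lt ENNReal.ofReal_lt_top)).trans (ENNReal.ofReal_le_ofReal ?_)
        have : volume.real (A n i) ≤ Real.pi * (R / n) :=
          ENNReal.toReal_le_of_le_ofReal (by positivity) (hAv n i)
        gcongr
      · rw [Finset.sum_const, Finset.card_range, nsmul_eq_mul, ← ENNReal.ofReal_natCast,
          ← ENNReal.ofReal_mul (by positivity)]
        refine (congrArg ENNReal.ofReal ?_).le
        field_simp
    rw [ae_iff]
    simp only [not_not]
    have hlim : Filter.Tendsto (fun n : ℕ => ENNReal.ofReal ((lam * Real.pi * R) ^ 2 / n))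
        Filter.atTop (nhds 0) := by
      have := ENNReal.tendsto_ofReal
        (tendsto_const_div_atTop_nhds_zero_nat ((lam * Real.pi * R) ^ 2))
      simpa using this
    refine le_antisymm (ge_of_tendsto hlim ?_) (zero_le)
    filter_upwards [Filter.eventually_gt_atTop 0] with n hn using hbound n hn
  rw [← ae_all_iff] at key
  filter_upwards [key] with ω hω b c hbc he
  obtain ⟨R, hR⟩ := exists_nat_gt (‖X b ω‖ ^ 2)
  exact hω R ⟨b, c, hbc, he, hR⟩

/-- Almost surely there is a unique nearest point, and it is not the origin. -/
lemma ae_exists_nearest (h : IsHomogeneousPoisson μ lam X) (hl : 0 ≤ lam) :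
    ∀ᵐ ω ∂μ, 0 < nearest X ω ∧ ∃ b, ∀ c, ‖X c ω‖ = nearest X ω ↔ c = b := by
  filter_upwards [h.ae_finite_ball hl, h.ae_norm_pos hl, h.ae_norm_ne hl] with ω hfin hpos hne
  obtain ⟨R, hR⟩ := exists_nat_gt ‖X 0 ω‖
  obtain ⟨b, hb, hmin⟩ := Set.exists_min_image _ (fun b => ‖X b ω‖) (hfin R) ⟨0, hR⟩
  have hle (c : ℕ) : ‖X b ω‖ ≤ ‖X c ω‖ := by
    rcases lt_or_ge ‖X c ω‖ R with hc | hc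
    · exact hmin c hc
    · exact (le_of_lt hb).trans hc
  have heq : nearest X ω = ‖X b ω‖ := le_antisymm (nearest_le X b ω) (le_ciInf hle)
  rw [heq]
  refine ⟨hpos b, b, fun c => ⟨fun hc => ?_, fun hc => by rw [hc]⟩⟩
  by_contra hcb
  exact hne c b hcb hc

end IsHomogeneousPoisson
end

/-! ### The nearest squared distance, weighted by a product over the points -/

noncomputable section

/-- A factor in `(0, 1]`, as a function of the squared distance, attached to the points of a
Poisson process, which tends to one at infinity in the integrated sense. -/
structure IsAttenuation (f : ℝ → ℝ) : Prop where
  pos : ∀ s, 0 ≤ s → 0 < f s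
  le_one : ∀ s, 0 ≤ s → f s ≤ 1
  measurable : Measurable f
  continuousOn : ContinuousOn f (Ioi 0)
  integrableOn : IntegrableOn (fun s => 1 - f s) (Ioi 0)

/-- The effective squared distance at `r`. -/
def effectiveSq (f : ℝ → ℝ) (r : ℝ) : ℝ := r + ∫ s in Ioi r, (1 - f s)

/-- The probability that no point of a Poisson process of density `lam` has squared distance less
than `r`, weighted by the product of the factors `f`. -/
def voidWeight (lam : ℝ) (f : ℝ → ℝ) (r : ℝ) : ℝ :=
  Real.exp (-(Real.pi * lam * effectiveSq f r))

/-- The product of the factors `f` over the points of the process. -/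
def pointWeight {Ω : Type*} (f : ℝ → ℝ) (X : ℕ → Ω → Plane) (ω : Ω) : ℝ≥0∞ :=
  expNeg (∑' b, ENNReal.ofReal (-Real.log (f (‖X b ω‖ ^ 2))))

namespace IsAttenuation

variable {f : ℝ → ℝ}

lemma integrableOn_Ioi (hf : IsAttenuation f) {r : ℝ} (hr : 0 ≤ r) :
    IntegrableOn (fun s => 1 - f s) (Ioi r) :=
  hf.integrableOn.mono_set (Ioi_subset_Ioi hr)

lemma integral_nonneg (hf : IsAttenuation f) {r : ℝ} (hr : 0 ≤ r) :
    0 ≤ ∫ s in Ioi r, (1 - f s) :=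
  setIntegral_nonneg measurableSet_Ioi fun s hs =>
    sub_nonneg.2 (hf.le_one s (hr.trans (le_of_lt hs)))

lemma effectiveSq_nonneg (hf : IsAttenuation f) {r : ℝ} (hr : 0 ≤ r) : 0 ≤ effectiveSq f r :=
  add_nonneg hr (hf.integral_nonneg hr)

/-- Moves `r` into the endpoint of an interval integral, so that the fundamental theorem of calculus
applies; the derivative is then `1 - (1 - f r) = f r`. -/
lemma effectiveSq_eq (hf : IsAttenuation f) {r : ℝ} (hr : 0 ≤ r) :
    effectiveSq f r = r + ((∫ s in Ioi (0 : ℝ), (1 - f s)) - ∫ s in (0 : ℝ)..r, (1 - f s)) := by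
  rw [effectiveSq, intervalIntegral.integral_of_le hr, ← Ioc_union_Ioi_eq_Ioi hr,
    setIntegral_union (Ioc_disjoint_Ioi le_rfl) measurableSet_Ioi
      (hf.integrableOn.mono_set Ioc_subset_Ioi_self) (hf.integrableOn_Ioi hr)]
  ring

lemma intervalIntegrable (hf : IsAttenuation f) {r : ℝ} (hr : 0 ≤ r) :
    IntervalIntegrable (fun s => 1 - f s) volume 0 r := by
  rw [intervalIntegrable_iff_integrableOn_Ioc_of_le hr]
  exact hf.integrableOn.mono_set Ioc_subset_Ioi_self

lemma hasDerivAt_effectiveSq (hf : IsAttenuation f) {r : ℝ} (hr : 0 < r) :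
    HasDerivAt (effectiveSq f) (f r) r := by
  have hc : ContinuousAt (fun s => 1 - f s) r :=
    continuousAt_const.sub (hf.continuousOn.continuousAt (Ioi_mem_nhds hr))
  have h1 := intervalIntegral.integral_hasDerivAt_right (hf.intervalIntegrable hr.le)
    ((measurable_const.sub hf.measurable).stronglyMeasurable.stronglyMeasurableAtFilter) hc
  have h2 := (hasDerivAt_id r).add (h1.const_sub (∫ s in Ioi (0 : ℝ), (1 - f s)))
  refine (h2.congr_of_eventuallyEq ?_).congr_deriv (by ring)
  filter_upwards [Ioi_mem_nhds hr] with s hs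
  exact hf.effectiveSq_eq (le_of_lt hs)

/-- The point at stake is `r = 0`: `f` is only assumed continuous on `(0, ∞)`, so differentiability
is not available there. -/
lemma continuousOn_effectiveSq (hf : IsAttenuation f) {r : ℝ} (hr : 0 ≤ r) :
    ContinuousWithinAt (effectiveSq f) (Ici r) r := by
  rcases hr.eq_or_lt with rfl | hr
  · have h1 : ContinuousWithinAt (fun r => ∫ s in (0 : ℝ)..r, (1 - f s)) (Icc 0 1) 0 := by
      have hi : IntegrableOn (fun s => 1 - f s) (uIcc 0 1) := by
        rw [uIcc_of_le zero_le_one, integrableOn_Icc_iff_integrableOn_Ioc]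
        exact hf.integrableOn.mono_set Ioc_subset_Ioi_self
      have := intervalIntegral.continuousOn_primitive_interval hi
      rw [uIcc_of_le zero_le_one] at this
      exact this 0 (by simp)
    have h2 : ContinuousWithinAt (fun r => ∫ s in (0 : ℝ)..r, (1 - f s)) (Ici 0) 0 :=
      h1.mono_of_mem_nhdsWithin (Icc_mem_nhdsGE zero_lt_one)
    have h3 := continuousWithinAt_id.add
      ((continuousWithinAt_const (b := ∫ s in Ioi (0 : ℝ), (1 - f s))).sub h2)
    exact h3.congr (fun s hs => hf.effectiveSq_eq hs) (hf.effectiveSq_eq le_rfl)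
  · exact (hf.hasDerivAt_effectiveSq hr).continuousAt.continuousWithinAt

/-- The integrand is minus the derivative of `voidWeight`, which tends to zero at infinity because
`effectiveSq f s ≥ s` for `s ≥ 0`. -/
lemma lintegral_voidWeight (hf : IsAttenuation f) {lam : ℝ} (hl : 0 < lam) {r : ℝ} (hr : 0 ≤ r) :
    ∫⁻ s in Ioi r, ENNReal.ofReal (Real.pi * lam * f s * voidWeight lam f s) =
      ENNReal.ofReal (voidWeight lam f r) := by
  have hpl : 0 < Real.pi * lam := by positivity
  have hcont : ContinuousWithinAt (fun s => -voidWeight lam f s) (Ici r) r := by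
    unfold voidWeight
    exact (((hf.continuousOn_effectiveSq hr).const_mul _).neg.rexp).neg
  have hderiv : ∀ s ∈ Ioi r, HasDerivAt (fun s => -voidWeight lam f s)
      (Real.pi * lam * f s * voidWeight lam f s) s := by
    intro s hs
    have h1 := (((hf.hasDerivAt_effectiveSq (hr.trans_lt hs)).const_mul
      (Real.pi * lam)).fun_neg.exp).fun_neg
    refine h1.congr_deriv ?_
    rw [voidWeight]
    ring
  have hpos : ∀ s ∈ Ioi r, 0 ≤ Real.pi * lam * f s * voidWeight lam f s := fun s hs =>
    mul_nonneg (mul_nonneg hpl.le (hf.pos s (hr.trans (le_of_lt hs))).le) (Real.exp_pos _).le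
  have hlim : Filter.Tendsto (fun s => -voidWeight lam f s) Filter.atTop (nhds 0) := by
    rw [← neg_zero]
    refine Filter.Tendsto.neg (Real.tendsto_exp_neg_atTop_nhds_zero.comp ?_)
    refine Filter.Tendsto.const_mul_atTop hpl ?_
    refine Filter.tendsto_atTop_mono' _ ?_ Filter.tendsto_id
    filter_upwards [Filter.eventually_ge_atTop 0] with s hs
    exact le_add_of_nonneg_right (hf.integral_nonneg hs)
  rw [← ofReal_integral_eq_lintegral_ofReal
    (integrableOn_Ioi_deriv_of_nonneg hcont hderiv hpos hlim)
    ((ae_restrict_iff' measurableSet_Ioi).2 (ae_of_all _ hpos)),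
    integral_Ioi_of_hasDerivAt_of_nonneg hcont hderiv hpos hlim]
  simp

end IsAttenuation

/-- The law of the squared distance to the nearest point, weighted by the product of the factors
`f` over all points. -/
def weightedNearestLaw (lam : ℝ) (f : ℝ → ℝ) : Measure ℝ :=
  (volume.restrict (Ioi 0)).withDensity
    (fun s => ENNReal.ofReal (Real.pi * lam * f s * voidWeight lam f s))

lemma IsAttenuation.weightedNearestLaw_Ici {lam : ℝ} (hl : 0 < lam) {f : ℝ → ℝ}
    (hf : IsAttenuation f) {r : ℝ} (hr : 0 ≤ r) :
    weightedNearestLaw lam f (Ici r) = ENNReal.ofReal (voidWeight lam f r) := by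
  rw [weightedNearestLaw, withDensity_apply _ measurableSet_Ici,
    Measure.restrict_restrict measurableSet_Ici, ← hf.lintegral_voidWeight hl hr]
  refine (setLIntegral_congr ?_).symm
  refine (Filter.EventuallyEq.inter (Ioi_ae_eq_Ici (a := r) (μ := volume)).symm
    Filter.EventuallyEq.rfl).trans ?_ |>.symm
  rw [inter_eq_left.2 (Ioi_subset_Ioi hr)]
  exact Filter.EventuallyEq.rfl

variable {Ω : Type*} [MeasurableSpace Ω] {μ : Measure Ω} {lam : ℝ} {X : ℕ → Ω → Plane} {f : ℝ → ℝ}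

lemma measurable_pointWeight (hX : ∀ b, Measurable (X b)) (hf : Measurable f) :
    Measurable (pointWeight f X) := by
  refine measurable_expNeg.comp (Measurable.tsum fun b => ?_)
  exact (Real.measurable_log.comp (hf.comp ((hX b).norm.pow_const 2))).neg.ennreal_ofReal

namespace IsHomogeneousPoisson

/-- The constraint on the nearest point can be absorbed into the Laplace functional: a point inside
the disc receives the exponent `∞`, hence the factor zero. The disc then contributes `r` to the
exponent, and its exterior contributes the integral of `1 - f`. -/
lemma lintegral_pointWeight_of_le (h : IsHomogeneousPoisson μ lam X) (hl : 0 < lam)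
    (hf : IsAttenuation f) {r : ℝ} (hr : 0 ≤ r) :
    ∫⁻ ω, {ω | r ≤ nearest X ω ^ 2}.indicator (pointWeight f X) ω ∂μ =
      ENNReal.ofReal (voidWeight lam f r) := by
  set φ : ℝ → ℝ≥0∞ := fun s => if s < r then ∞ else ENNReal.ofReal (-Real.log (f s)) with hφ
  have hφm : Measurable φ :=
    Measurable.ite measurableSet_Iio measurable_const
      (Real.measurable_log.comp hf.measurable).neg.ennreal_ofReal
  have h1 (ω : Ω) : {ω | r ≤ nearest X ω ^ 2}.indicator (pointWeight f X) ω =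
      expNeg (∑' b, φ (‖X b ω‖ ^ 2)) := by
    by_cases hω : r ≤ nearest X ω ^ 2
    · rw [indicator_of_mem (by exact hω), pointWeight]
      congr 1
      refine tsum_congr fun b => ?_
      rw [hφ]
      simp only
      rw [if_neg (not_lt.2 ((le_nearest_sq_iff ω).1 hω b))]
    · rw [indicator_of_notMem (by exact hω)]
      rw [le_nearest_sq_iff] at hω
      push Not at hω
      obtain ⟨b, hb⟩ := hω
      have : ∑' b, φ (‖X b ω‖ ^ 2) = ∞ := by
        refine ENNReal.tsum_eq_top_of_eq_top ⟨b, ?_⟩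
        rw [hφ]
        simp only
        rw [if_pos hb]
      rw [this, expNeg_top]
  have h2 : ∫⁻ x : Plane, (1 - expNeg (φ (‖x‖ ^ 2))) =
      ENNReal.ofReal (Real.pi * effectiveSq f r) := by
    rw [lintegral_norm_sq (φ := fun s => 1 - expNeg (φ s)) (by fun_prop),
      ← Ioc_union_Ioi_eq_Ioi hr, lintegral_union measurableSet_Ioi (Ioc_disjoint_Ioi le_rfl),
      ENNReal.ofReal_mul Real.pi_pos.le, effectiveSq,
      ENNReal.ofReal_add hr (hf.integral_nonneg hr)]
    congr 2
    · rw [← restrict_Ioo_eq_restrict_Ioc, setLIntegral_congr_fun (g := fun _ => 1)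
        measurableSet_Ioo]
      · simp
      · intro s hs
        simp [hφ, hs.2]
    · rw [ofReal_integral_eq_lintegral_ofReal (hf.integrableOn_Ioi hr)
        ((ae_restrict_iff' measurableSet_Ioi).2 (ae_of_all _ fun s hs =>
          sub_nonneg.2 (hf.le_one s (hr.trans (le_of_lt hs)))))]
      refine setLIntegral_congr_fun measurableSet_Ioi fun s hs => ?_
      have hs0 : 0 ≤ s := hr.trans (le_of_lt hs)
      simp only [hφ]
      rw [if_neg (not_lt.2 (le_of_lt hs)), expNeg_ofReal_neg_log (hf.pos s hs0) (hf.le_one s hs0),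
        ENNReal.ofReal_sub _ (hf.pos s hs0).le, ENNReal.ofReal_one]
  simp_rw [h1]
  rw [h.lintegral_expNeg_tsum hl.le (g := fun x => φ (‖x‖ ^ 2)) (by fun_prop), h2,
    ← ENNReal.ofReal_mul hl.le, expNeg_ofReal, voidWeight]
  · ring_nf
  · have := hf.effectiveSq_nonneg hr
    positivity

/-- The law of the squared distance to the nearest point, weighted by the product of the factors
`f` over all points. -/
theorem map_nearest_sq_withDensity (h : IsHomogeneousPoisson μ lam X) (hl : 0 < lam)
    (hf : IsAttenuation f) :
    (μ.withDensity (pointWeight f X)).map (fun ω => nearest X ω ^ 2) =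
      weightedNearestLaw lam f := by
  have hprob := h.isProbabilityMeasure
  have hm : Measurable fun ω => nearest X ω ^ 2 := (measurable_nearest h.measurable).pow_const 2
  -- Finite measures on the line are determined by the half-lines `Ici r`, so comparing tails
  -- suffices.
  have hfin : IsFiniteMeasure (μ.withDensity (pointWeight f X)) := by
    refine isFiniteMeasure_withDensity ?_
    refine ((lintegral_mono fun ω => expNeg_le_one _).trans_lt ?_).ne
    simp
  have key {r : ℝ} (hr : 0 ≤ r) :
      (μ.withDensity (pointWeight f X)).map (fun ω => nearest X ω ^ 2) (Ici r) =
        ENNReal.ofReal (voidWeight lam f r) := by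
    rw [Measure.map_apply hm measurableSet_Ici, withDensity_apply _ (hm measurableSet_Ici),
      ← lintegral_indicator (hm measurableSet_Ici)]
    exact h.lintegral_pointWeight_of_le hl hf hr
  refine Measure.ext_of_Ici _ _ fun r => ?_
  rcases le_total 0 r with hr | hr
  · rw [key hr, hf.weightedNearestLaw_Ici hl hr]
  · have hsub : Ioi (0 : ℝ) ⊆ Ici r := fun s hs => hr.trans (le_of_lt hs)
    rw [weightedNearestLaw, withDensity_apply _ measurableSet_Ici,
      Measure.restrict_restrict measurableSet_Ici, inter_eq_right.2 hsub,
      hf.lintegral_voidWeight hl le_rfl, ← key le_rfl,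
      Measure.map_apply hm measurableSet_Ici, Measure.map_apply hm measurableSet_Ici]
    congr 1
    ext ω
    simp only [mem_preimage, mem_Ici]
    exact ⟨fun _ => by positivity, fun h => hr.trans h⟩

end IsHomogeneousPoisson

end

/-! ### Several independent tiers and the association event -/

noncomputable section

lemma measurable_effectiveSq_uncurry {f : ℝ → ℝ → ℝ} (hf : Measurable (Function.uncurry f)) :
    Measurable fun p : ℝ × ℝ => effectiveSq (f p.1) p.2 := by
  unfold effectiveSq
  have h1 : Measurable fun x : (ℝ × ℝ) × ℝ => (Ioi x.1.2).indicator (fun s => 1 - f x.1.1 s) x.2 := by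
    have : (fun x : (ℝ × ℝ) × ℝ => (Ioi x.1.2).indicator (fun s => 1 - f x.1.1 s) x.2) =
        {x : (ℝ × ℝ) × ℝ | x.1.2 < x.2}.indicator (fun x => 1 - f x.1.1 x.2) := by
      ext x
      simp [indicator_apply]
    rw [this]
    have hm : Measurable fun x : (ℝ × ℝ) × ℝ => f x.1.1 x.2 :=
      hf.comp (by fun_prop : Measurable fun x : (ℝ × ℝ) × ℝ => (x.1.1, x.2))
    exact (measurable_const.sub hm).indicator (measurableSet_lt (by fun_prop) (by fun_prop))
  have h2 := StronglyMeasurable.integral_prod_right (ν := volume)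
    (f := fun (p : ℝ × ℝ) (s : ℝ) => (Ioi p.2).indicator (fun s => 1 - f p.1 s) s)
    h1.stronglyMeasurable
  simp_rw [integral_indicator measurableSet_Ioi] at h2
  exact measurable_snd.add h2.measurable

lemma measurable_effectiveSq {f : ℝ → ℝ} (hf : Measurable f) : Measurable (effectiveSq f) :=
  (measurable_effectiveSq_uncurry (f := fun _ => f) (hf.comp measurable_snd)).comp
    (measurable_prodMk_left (x := (0 : ℝ)))

lemma measurable_voidWeight (lam : ℝ) {f : ℝ → ℝ} (hf : Measurable f) :
    Measurable (voidWeight lam f) := by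
  unfold voidWeight
  have := measurable_effectiveSq hf
  fun_prop

lemma weightedNearestLaw_univ_lt_top {lam : ℝ} (hl : 0 < lam) {f : ℝ → ℝ}
    (hf : IsAttenuation f) : weightedNearestLaw lam f univ < ∞ := by
  rw [weightedNearestLaw, withDensity_apply _ MeasurableSet.univ, Measure.restrict_univ,
    hf.lintegral_voidWeight hl le_rfl]
  exact ENNReal.ofReal_lt_top

section

variable {Ω : Type*} [MeasurableSpace Ω] {μ : Measure Ω} {T : ℕ} {X : Fin T → ℕ → Ω → Plane}
  {lam : Fin T → ℝ} {f : Fin T → ℝ → ℝ}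

/-- On a product set, the weight and the indicator both split into one functional per tier, so
independence of the tiers reduces the claim to the law for one tier. -/
lemma map_nearest_sq_pi (hX : ∀ q, IsHomogeneousPoisson μ (lam q) (X q)) (hl : ∀ q, 0 < lam q)
    (hind : iIndepFun (fun (q : Fin T) (ω : Ω) (b : ℕ) => X q b ω) μ)
    (hf : ∀ q, IsAttenuation (f q)) :
    (μ.withDensity (fun ω => ∏ q, pointWeight (f q) (X q) ω)).map
        (fun ω q => nearest (X q) ω ^ 2) =
      Measure.pi (fun q => weightedNearestLaw (lam q) (f q)) := by
  have hfin (q : Fin T) : IsFiniteMeasure (weightedNearestLaw (lam q) (f q)) :=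
    ⟨weightedNearestLaw_univ_lt_top (hl q) (hf q)⟩
  have hn (q : Fin T) : Measurable fun ω => nearest (X q) ω ^ 2 :=
    (measurable_nearest (hX q).measurable).pow_const 2
  have hm : Measurable fun ω (q : Fin T) => nearest (X q) ω ^ 2 := measurable_pi_lambda _ hn
  have hw (q : Fin T) : Measurable (pointWeight (f q) (X q)) :=
    measurable_pointWeight (hX q).measurable (hf q).measurable
  refine (Measure.pi_eq fun A hA => ?_).symm
  rw [Measure.map_apply hm (MeasurableSet.univ_pi hA),
    withDensity_apply _ (hm (MeasurableSet.univ_pi hA)),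
    ← lintegral_indicator (hm (MeasurableSet.univ_pi hA))]
  -- The functional is written on configurations of points, because independence is assumed for
  -- whole configurations and not for the nearest distances alone.
  set Φ : Fin T → (ℕ → Plane) → ℝ≥0∞ := fun q x =>
    (A q).indicator 1 (nearest (fun b (x : ℕ → Plane) => x b) x ^ 2) *
      pointWeight (f q) (fun b (x : ℕ → Plane) => x b) x with hΦ
  have hΦm (q : Fin T) : Measurable (Φ q) := by
    refine Measurable.mul ?_ ?_
    · exact (measurable_one.indicator (hA q)).comp
        ((measurable_nearest fun b => measurable_pi_apply b).pow_const 2)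
    · exact measurable_pointWeight (fun b => measurable_pi_apply b) (hf q).measurable
  have hXm (q : Fin T) : Measurable fun ω (b : ℕ) => X q b ω :=
    measurable_pi_lambda _ (hX q).measurable
  have h1 (ω : Ω) : ((fun ω (q : Fin T) => nearest (X q) ω ^ 2) ⁻¹' univ.pi A).indicator
      (fun ω => ∏ q, pointWeight (f q) (X q) ω) ω = ∏ q, Φ q (fun b => X q b ω) := by
    have hΦ' (q : Fin T) : Φ q (fun b => X q b ω) =
        (A q).indicator 1 (nearest (X q) ω ^ 2) * pointWeight (f q) (X q) ω := rfl
    simp_rw [hΦ', Finset.prod_mul_distrib]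
    by_cases hω : ∀ q, nearest (X q) ω ^ 2 ∈ A q
    · have h1 : ∏ q, (A q).indicator 1 (nearest (X q) ω ^ 2) = (1 : ℝ≥0∞) :=
        Finset.prod_eq_one fun q _ => by rw [indicator_of_mem (hω q), Pi.one_apply]
      rw [indicator_of_mem (by simpa using hω), h1, one_mul]
    · rw [indicator_of_notMem (by simpa using hω)]
      push Not at hω
      obtain ⟨q, hq⟩ := hω
      rw [Finset.prod_eq_zero (Finset.mem_univ q) (indicator_of_notMem hq _), zero_mul]
  simp_rw [h1]
  refine (lintegral_prod_eq_prod_lintegral_of_indepFun _ _ (hind.comp Φ hΦm)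
    fun q => (hΦm q).comp (hXm q)).trans (Finset.prod_congr rfl fun q _ => ?_)
  rw [← (hX q).map_nearest_sq_withDensity (hl q) (hf q),
    Measure.map_apply (hn q) (hA q), withDensity_apply _ (hn q (hA q)),
    ← lintegral_indicator (hn q (hA q))]
  refine lintegral_congr fun ω => ?_
  show (A q).indicator 1 (nearest (X q) ω ^ 2) * pointWeight (f q) (X q) ω = _
  by_cases hω : nearest (X q) ω ^ 2 ∈ A q
  · rw [indicator_of_mem hω, indicator_of_mem (by exact hω), Pi.one_apply, one_mul]
  · rw [indicator_of_notMem hω, indicator_of_notMem (by exact hω), zero_mul]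

/-- Once the squared distance `s` of tier `t` is fixed, association only asks every other tier `q`
to lie in the tail from `κ q * s` on. Its weighted mass is `voidWeight`, while tier `t` contributes
its density. -/
lemma lintegral_weighted_nearest (hX : ∀ q, IsHomogeneousPoisson μ (lam q) (X q))
    (hl : ∀ q, 0 < lam q) (hind : iIndepFun (fun (q : Fin T) (ω : Ω) (b : ℕ) => X q b ω) μ)
    (hf : ∀ q, IsAttenuation (f q)) (t : Fin T) {κ : Fin T → ℝ} (hκ : ∀ q, 0 ≤ κ q)
    (hκt : κ t = 1) {φ : ℝ → ℝ≥0∞} (hφ : Measurable φ) :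
    ∫⁻ ω, {ω | ∀ q, κ q * nearest (X t) ω ^ 2 ≤ nearest (X q) ω ^ 2}.indicator
        (fun ω => φ (nearest (X t) ω ^ 2) * ∏ q, pointWeight (f q) (X q) ω) ω ∂μ =
      ∫⁻ s in Ioi (0 : ℝ), φ s * ENNReal.ofReal (Real.pi * lam t * f t s) *
        ∏ q, ENNReal.ofReal (voidWeight (lam q) (f q) (κ q * s)) := by
  have hn (q : Fin T) : Measurable fun ω => nearest (X q) ω ^ 2 :=
    (measurable_nearest (hX q).measurable).pow_const 2
  have hm : Measurable fun ω (q : Fin T) => nearest (X q) ω ^ 2 := measurable_pi_lambda _ hn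
  have hw : Measurable fun ω => ∏ q, pointWeight (f q) (X q) ω :=
    Finset.measurable_fun_prod _ fun q _ =>
      measurable_pointWeight (hX q).measurable (hf q).measurable
  have hfin (q : Fin T) : IsFiniteMeasure (weightedNearestLaw (lam q) (f q)) :=
    ⟨weightedNearestLaw_univ_lt_top (hl q) (hf q)⟩
  have hsetm : MeasurableSet {x : Fin T → ℝ | ∀ q, κ q * x t ≤ x q} := by
    simp_rw [ofPred_forall]
    exact MeasurableSet.iInter fun q => measurableSet_le (by fun_prop) (by fun_prop)
  have h1 : ∫⁻ ω, {ω | ∀ q, κ q * nearest (X t) ω ^ 2 ≤ nearest (X q) ω ^ 2}.indicator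
        (fun ω => φ (nearest (X t) ω ^ 2) * ∏ q, pointWeight (f q) (X q) ω) ω ∂μ =
      ∫⁻ x : Fin T → ℝ, {x : Fin T → ℝ | ∀ q, κ q * x t ≤ x q}.indicator (fun x => φ (x t)) x
        ∂(Measure.pi fun q => weightedNearestLaw (lam q) (f q)) := by
    rw [← map_nearest_sq_pi hX hl hind hf,
      lintegral_map ((by fun_prop : Measurable fun x : Fin T → ℝ => φ (x t)).indicator hsetm) hm,
      lintegral_withDensity_eq_lintegral_mul _ hw
        (g := fun ω => {x : Fin T → ℝ | ∀ q, κ q * x t ≤ x q}.indicator (fun x => φ (x t))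
          fun q => nearest (X q) ω ^ 2) (((by fun_prop : Measurable fun x : Fin T → ℝ => φ (x t)).indicator hsetm).comp hm)]
    refine lintegral_congr fun ω => ?_
    simp only [indicator_apply, Pi.mul_apply, mem_ofPred_eq]
    split_ifs
    · rw [mul_comm]
    · simp
  rw [h1]
  -- Writing the number of tiers as a successor allows the coordinate `t` to be split off the
  -- product measure. The condition for `q = t` is void since `κ t = 1`.
  obtain ⟨n, rfl⟩ : ∃ n, T = n + 1 := ⟨T - 1, by have := t.pos; omega⟩
  set m := fun q => weightedNearestLaw (lam q) (f q) with hmdef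
  have hset' : MeasurableSet {p : ℝ × (Fin n → ℝ) | ∀ j, κ (t.succAbove j) * p.1 ≤ p.2 j} := by
    simp_rw [ofPred_forall]
    exact MeasurableSet.iInter fun q => measurableSet_le (by fun_prop) (by fun_prop)
  have h2 (x : Fin (n + 1) → ℝ) :
      {x : Fin (n + 1) → ℝ | ∀ q, κ q * x t ≤ x q}.indicator (fun x => φ (x t)) x =
      {p : ℝ × (Fin n → ℝ) | ∀ j, κ (t.succAbove j) * p.1 ≤ p.2 j}.indicator (fun p => φ p.1)
        (MeasurableEquiv.piFinSuccAbove (fun _ => ℝ) t x) := by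
    have : (∀ q, κ q * x t ≤ x q) ↔ ∀ j, κ (t.succAbove j) * x t ≤ x (t.succAbove j) := by
      rw [Fin.forall_iff_succAbove t]
      simp [hκt]
    simp only [indicator_apply, mem_ofPred_eq, this]
    rfl
  simp_rw [h2]
  rw [(measurePreserving_piFinSuccAbove m t).lintegral_comp
    ((by fun_prop : Measurable fun p : ℝ × (Fin n → ℝ) => φ p.1).indicator hset'),
    lintegral_prod _
      ((by fun_prop : Measurable fun p : ℝ × (Fin n → ℝ) => φ p.1).indicator hset').aemeasurable]
  have hvm (q : Fin (n + 1)) : Measurable (voidWeight (lam q) (f q)) :=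
    measurable_voidWeight _ (hf q).measurable
  have hftm := (hf t).measurable
  have h3 : ∀ a ∈ Ioi (0 : ℝ), ∫⁻ y, {p : ℝ × (Fin n → ℝ) | ∀ j, κ (t.succAbove j) * p.1 ≤
      p.2 j}.indicator (fun p => φ p.1) (a, y) ∂(Measure.pi fun j => m (t.succAbove j)) =
      φ a * ∏ j, ENNReal.ofReal (voidWeight (lam (t.succAbove j)) (f (t.succAbove j))
        (κ (t.succAbove j) * a)) := by
    intro a ha
    have hi (y : Fin n → ℝ) : {p : ℝ × (Fin n → ℝ) | ∀ j, κ (t.succAbove j) * p.1 ≤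
        p.2 j}.indicator (fun p => φ p.1) (a, y) =
        (univ.pi fun j => Ici (κ (t.succAbove j) * a)).indicator (fun _ => φ a) y := by
      have hy : y ∈ univ.pi (fun j => Ici (κ (t.succAbove j) * a)) ↔
          ∀ j, κ (t.succAbove j) * a ≤ y j := by simp only [mem_univ_pi, mem_Ici]
      by_cases h : y ∈ univ.pi (fun j => Ici (κ (t.succAbove j) * a))
      · rw [indicator_of_mem h, indicator_of_mem (by exact hy.1 h)]
      · rw [indicator_of_notMem h, indicator_of_notMem (by exact fun h' => h (hy.2 h'))]
    simp_rw [hi]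
    rw [lintegral_indicator_const (MeasurableSet.univ_pi fun j => measurableSet_Ici),
      Measure.pi_pi]
    congr 1
    refine Finset.prod_congr rfl fun j _ => ?_
    exact (hf _).weightedNearestLaw_Ici (hl _) (mul_nonneg (hκ _) (le_of_lt ha))
  have hmt : m t = (volume.restrict (Ioi 0)).withDensity
    (fun s => ENNReal.ofReal (Real.pi * lam t * f t s * voidWeight (lam t) (f t) s)) := rfl
  have hvt := hvm t
  rw [hmt, lintegral_withDensity_eq_lintegral_mul₀]
  · refine setLIntegral_congr_fun measurableSet_Ioi fun s hs => ?_
    simp only [Pi.mul_apply]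
    rw [h3 s hs, Fin.prod_univ_succAbove _ t, hκt, one_mul,
      ENNReal.ofReal_mul (mul_nonneg (by have := hl t; positivity) ((hf t).pos s (le_of_lt hs)).le)]
    ring
  · fun_prop
  · exact (Measurable.lintegral_prod_right'
      ((by fun_prop : Measurable fun p : ℝ × (Fin n → ℝ) => φ p.1).indicator hset')).aemeasurable

open scoped Classical in
/-- The sum of `L q (‖x‖ ^ 2)` over all points `x` of all processes `q` except the nearest point
of the process `t`. -/
def nonservingSum {Ω : Type*} (X : Fin T → ℕ → Ω → Plane) (t : Fin T) (L : Fin T → ℝ → ℝ≥0∞)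
    (ω : Ω) : ℝ≥0∞ :=
  ∑' (q : Fin T) (b : ℕ),
    if q = t ∧ ‖X q b ω‖ = nearest (X t) ω then 0 else L q (‖X q b ω‖ ^ 2)

/-- Uniqueness of the nearest point makes the omitted terms exactly one. Adding it back avoids
subtraction in `[0, ∞]`. -/
lemma nonservingSum_add {Ω : Type*} {X : Fin T → ℕ → Ω → Plane} {ω : Ω} {t : Fin T} {b : ℕ}
    (hb : ∀ c, ‖X t c ω‖ = nearest (X t) ω ↔ c = b) (L : Fin T → ℝ → ℝ≥0∞) :
    nonservingSum X t L ω + L t (nearest (X t) ω ^ 2) = ∑' (q : Fin T) (b : ℕ),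
      L q (‖X q b ω‖ ^ 2) := by
  classical
  have h1 : L t (nearest (X t) ω ^ 2) = ∑' (q : Fin T) (c : ℕ),
      if q = t ∧ ‖X q c ω‖ = nearest (X t) ω then L q (‖X q c ω‖ ^ 2) else 0 := by
    rw [tsum_eq_single t, tsum_eq_single b]
    · rw [if_pos ⟨rfl, (hb b).2 rfl⟩, (hb b).2 rfl]
    · intro c hc
      rw [if_neg fun h => hc ((hb c).1 h.2)]
    · intro q hq
      simp [hq]
  rw [h1, nonservingSum, ← ENNReal.tsum_add]
  refine tsum_congr fun q => ?_
  rw [← ENNReal.tsum_add]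
  refine tsum_congr fun c => ?_
  split_ifs <;> simp

/-- The joint law of the distance to the serving point and of a multiplicative functional of the
other points, on the event of association. -/
theorem lintegral_expNeg_nonservingSum (hX : ∀ q, IsHomogeneousPoisson μ (lam q) (X q))
    (hl : ∀ q, 0 < lam q) (hind : iIndepFun (fun (q : Fin T) (ω : Ω) (b : ℕ) => X q b ω) μ)
    (hf : ∀ q, IsAttenuation (f q)) (t : Fin T) {κ : Fin T → ℝ} (hκ : ∀ q, 0 ≤ κ q)
    (hκt : κ t = 1) {φ : ℝ → ℝ≥0∞} (hφ : Measurable φ) :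
    ∫⁻ ω, {ω | ∀ q, κ q * nearest (X t) ω ^ 2 ≤ nearest (X q) ω ^ 2}.indicator
        (fun ω => φ (nearest (X t) ω ^ 2) * expNeg (nonservingSum X t
          (fun q s => ENNReal.ofReal (-Real.log (f q s))) ω)) ω ∂μ =
      ∫⁻ s in Ioi (0 : ℝ), φ s * ENNReal.ofReal (Real.pi * lam t) *
        ∏ q, ENNReal.ofReal (voidWeight (lam q) (f q) (κ q * s)) := by
  have hft := (hf t).measurable
  -- The test function is divided by `f t` because the product of point weights contains the factor
  -- of the serving point, which must not be there.
  have h := lintegral_weighted_nearest hX hl hind hf t hκ hκt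
    (φ := fun s => φ s * (ENNReal.ofReal (f t s))⁻¹) (by fun_prop)
  refine Eq.trans (lintegral_congr_ae ?_) (h.trans ?_)
  · filter_upwards [(hX t).ae_exists_nearest (hl t).le] with ω hω
    obtain ⟨hpos, b, hb⟩ := hω
    simp only [indicator_apply]
    split_ifs
    · have hs : 0 ≤ nearest (X t) ω ^ 2 := by positivity
      have h1 := congrArg expNeg
        (nonservingSum_add hb fun q s => ENNReal.ofReal (-Real.log (f q s)))
      have h0 : ENNReal.ofReal (f t (nearest (X t) ω ^ 2)) ≠ 0 := by
        simpa using (hf t).pos _ hs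
      rw [expNeg_add, expNeg_ofReal_neg_log ((hf t).pos _ hs) ((hf t).le_one _ hs), tsum_fintype,
        expNeg_sum] at h1
      simp only [pointWeight]
      rw [← h1, mul_assoc, mul_comm (expNeg _), ← mul_assoc (ENNReal.ofReal _)⁻¹,
        ENNReal.inv_mul_cancel h0 ENNReal.ofReal_ne_top, one_mul]
    · rfl
  · refine setLIntegral_congr_fun measurableSet_Ioi fun s hs => ?_
    have h0 : ENNReal.ofReal (f t s) ≠ 0 := by
      simpa using (hf t).pos _ (le_of_lt hs)
    rw [ENNReal.ofReal_mul (by have := hl t; positivity : 0 ≤ Real.pi * lam t),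
      mul_comm (ENNReal.ofReal (Real.pi * lam t)), mul_assoc (φ s),
      ← mul_assoc (ENNReal.ofReal (f t s))⁻¹, ENNReal.inv_mul_cancel h0 ENNReal.ofReal_ne_top,
      one_mul]

end

end

/-! ### Transforms of fading laws -/

noncomputable section

namespace IsFadingLaw

variable {ν : Measure ℝ}

lemma ae_exp_le_one (h : IsFadingLaw ν) {s : ℝ} (hs : 0 ≤ s) :
    ∀ᵐ x ∂ν, Real.exp (-s * x) ≤ 1 := by
  filter_upwards [h.nonneg] with x hx
  rw [Real.exp_le_one_iff]
  nlinarith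

lemma integrable_exp (h : IsFadingLaw ν) {s : ℝ} (hs : 0 ≤ s) :
    Integrable (fun x => Real.exp (-s * x)) ν := by
  have := h.isProbabilityMeasure
  refine (integrable_const (1 : ℝ)).mono' (by fun_prop) ?_
  filter_upwards [h.ae_exp_le_one hs] with x hx
  rwa [Real.norm_of_nonneg (Real.exp_pos _).le]

lemma integral_exp_pos (h : IsFadingLaw ν) {s : ℝ} (hs : 0 ≤ s) :
    0 < ∫ x, Real.exp (-s * x) ∂ν := by
  have := h.isProbabilityMeasure
  exact MeasureTheory.integral_exp_pos (h.integrable_exp hs)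

lemma integral_exp_le_one (h : IsFadingLaw ν) {s : ℝ} (hs : 0 ≤ s) :
    ∫ x, Real.exp (-s * x) ∂ν ≤ 1 := by
  have := h.isProbabilityMeasure
  simpa using integral_mono_ae (h.integrable_exp hs) (integrable_const (1 : ℝ)) (h.ae_exp_le_one hs)

/-- Integrate `exp (-s x) ≥ 1 - s x` and use that the mean is one. This linear bound controls both
the far interferers and the rate integrand near `y = 0`. -/
lemma one_sub_le_integral_exp (h : IsFadingLaw ν) {s : ℝ} (hs : 0 ≤ s) :
    1 - s ≤ ∫ x, Real.exp (-s * x) ∂ν := by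
  have := h.isProbabilityMeasure
  have h1 : ∫ x, (1 - s * x) ∂ν = 1 - s := by
    rw [integral_sub (integrable_const _) (h.integrable.const_mul s), integral_const_mul,
      h.mean_one]
    simp
  rw [← h1]
  refine integral_mono ((integrable_const _).sub (h.integrable.const_mul s))
    (h.integrable_exp hs) fun x => ?_
  have := Real.add_one_le_exp (-s * x)
  simp only
  linarith

lemma continuousOn_integral_exp (h : IsFadingLaw ν) :
    ContinuousOn (fun s => ∫ x, Real.exp (-s * x) ∂ν) (Ici 0) := by
  have := h.isProbabilityMeasure
  refine continuousOn_of_dominated (bound := fun _ => 1) (fun s _ => by fun_prop)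
    (fun s hs => ?_) (integrable_const _) (ae_of_all _ fun x => by fun_prop)
  filter_upwards [h.ae_exp_le_one hs] with x hx
  rwa [Real.norm_of_nonneg (Real.exp_pos _).le]

lemma measurable_integral_exp (h : IsFadingLaw ν) :
    Measurable (fun s => ∫ x, Real.exp (-s * x) ∂ν) := by
  have := h.isProbabilityMeasure
  have h1 : StronglyMeasurable (Function.uncurry fun s x : ℝ => Real.exp (-s * x)) := by
    refine Measurable.stronglyMeasurable ?_
    unfold Function.uncurry
    fun_prop
  exact h1.integral_prod_right.measurable

lemma lintegral_expNeg (h : IsFadingLaw ν) {s : ℝ} (hs : 0 ≤ s) :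
    ∫⁻ x, expNeg (ENNReal.ofReal (s * x)) ∂ν =
      ENNReal.ofReal (∫ x, Real.exp (-s * x) ∂ν) := by
  rw [ofReal_integral_eq_lintegral_ofReal (h.integrable_exp hs)
    (ae_of_all _ fun x => (Real.exp_pos _).le)]
  refine lintegral_congr_ae ?_
  filter_upwards [h.nonneg] with x hx
  rw [expNeg_ofReal (mul_nonneg hs hx), neg_mul]

/-- The transform of a fading law along a power law path loss. -/
lemma isAttenuation (h : IsFadingLaw ν) {c β : ℝ} (hc : 0 ≤ c) (hβ : 1 < β) :
    IsAttenuation fun s => ∫ x, Real.exp (-(c * s ^ (-β)) * x) ∂ν where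
  pos s hs := h.integral_exp_pos (mul_nonneg hc (Real.rpow_nonneg hs _))
  le_one s hs := h.integral_exp_le_one (mul_nonneg hc (Real.rpow_nonneg hs _))
  measurable := h.measurable_integral_exp.comp (g := fun s => ∫ x, Real.exp (-s * x) ∂ν)
    (f := fun s => c * s ^ (-β)) (by fun_prop)
  continuousOn := by
    refine h.continuousOn_integral_exp.comp (f := fun s => c * s ^ (-β)) (t := Ici 0) ?_
      fun s hs => mul_nonneg hc (Real.rpow_nonneg (le_of_lt hs) _)
    exact continuousOn_const.mul (continuousOn_id.rpow_const fun s hs => Or.inl (ne_of_gt hs))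
  integrableOn := by
    have hm : Measurable fun s : ℝ => 1 - ∫ x, Real.exp (-(c * s ^ (-β)) * x) ∂ν :=
      measurable_const.sub (h.measurable_integral_exp.comp
        (g := fun s => ∫ x, Real.exp (-s * x) ∂ν) (f := fun s => c * s ^ (-β)) (by fun_prop))
    have hnn {s : ℝ} (hs : 0 < s) : 0 ≤ c * s ^ (-β) := mul_nonneg hc (Real.rpow_nonneg hs.le _)
    rw [← Ioc_union_Ioi_eq_Ioi (zero_le_one' ℝ)]
    -- Near the origin `1 - f` is bounded by one. Beyond `1` it is at most `c * s ^ (-β)`,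
    -- integrable because `β > 1`.
    refine IntegrableOn.union ?_ ?_
    · refine Measure.integrableOn_of_bounded (M := 1) (by simp) hm.aestronglyMeasurable ?_
      refine (ae_restrict_iff' measurableSet_Ioc).2 (ae_of_all _ fun s hs => ?_)
      rw [Real.norm_of_nonneg (sub_nonneg.2 (h.integral_exp_le_one (hnn hs.1)))]
      linarith [h.integral_exp_pos (hnn hs.1)]
    · refine Integrable.mono' ((integrableOn_Ioi_rpow_of_lt (by linarith : -β < -1)
        zero_lt_one).const_mul c) hm.aestronglyMeasurable ?_
      refine (ae_restrict_iff' measurableSet_Ioi).2 (ae_of_all _ fun s hs => ?_)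
      have hs0 : 0 < s := zero_lt_one.trans hs
      rw [Real.norm_of_nonneg (sub_nonneg.2 (h.integral_exp_le_one (hnn hs0)))]
      linarith [h.one_sub_le_integral_exp (hnn hs0)]

end IsFadingLaw

/-- The joint law is a product, so Tonelli applies. It serves to average over the gains while the
positions are frozen. -/
lemma lintegral_comp_of_indepFun {Ω E F : Type*} [MeasurableSpace Ω] [MeasurableSpace E]
    [MeasurableSpace F] {μ : Measure Ω} [IsProbabilityMeasure μ] {X : Ω → E} {Y : Ω → F}
    (h : IndepFun X Y μ) (hX : Measurable X) (hY : Measurable Y) {Ψ : E → F → ℝ≥0∞}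
    (hΨ : Measurable (Function.uncurry Ψ)) :
    ∫⁻ ω, Ψ (X ω) (Y ω) ∂μ = ∫⁻ ω, ∫⁻ ω', Ψ (X ω) (Y ω') ∂μ ∂μ := by
  have h1 := (indepFun_iff_map_prod_eq_prod_map_map hX.aemeasurable hY.aemeasurable).1 h
  have h2 : ∫⁻ ω, Ψ (X ω) (Y ω) ∂μ =
      ∫⁻ p, Function.uncurry Ψ p ∂(μ.map fun ω => (X ω, Y ω)) := by
    rw [lintegral_map hΨ (hX.prodMk hY)]
    rfl
  have := Measure.isProbabilityMeasure_map (μ := μ) hY.aemeasurable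
  rw [h2, h1, lintegral_prod _ hΨ.aemeasurable, lintegral_map hΨ.lintegral_prod_right' hX]
  refine lintegral_congr fun ω => ?_
  exact lintegral_map (f := fun y => Ψ (X ω) y) (hΨ.comp measurable_prodMk_left) hY

/-! ### Averaging over the gains at fixed positions -/

namespace CellularNetwork

variable {T : ℕ} {par : NetworkParams T} {Ω : Type*} [MeasurableSpace Ω] {μ : Measure Ω}

/-- The transform of the interfering gains of tier `q` as a function of the squared distance. -/
def _root_.NetworkParams.attenuation (par : NetworkParams T) (z : ℝ) (q : Fin T) (s : ℝ) : ℝ :=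
  par.interfererMGF q (z * par.P q * s ^ (-(par.alpha q / 2)))

lemma _root_.NetworkParams.isAttenuation (par : NetworkParams T) {z : ℝ} (hz : 0 ≤ z) (q : Fin T) :
    IsAttenuation (par.attenuation z q) :=
  (par.isFadingLaw_interferer q).isAttenuation (mul_nonneg hz (par.P_pos q).le)
    (by linarith [par.two_lt_alpha q])

lemma isProbabilityMeasure (N : CellularNetwork par μ) : IsProbabilityMeasure μ :=
  N.indep_tiers.isProbabilityMeasure

lemma ae_gain_nonneg (N : CellularNetwork par μ) : ∀ᵐ ω ∂μ, ∀ q b, 0 ≤ N.gain q b ω := by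
  simp_rw [ae_all_iff]
  intro q b
  have h := (par.isFadingLaw_interferer q).nonneg
  rw [← N.gain_law q b] at h
  exact ae_of_ae_map (N.measurable_gain q b).aemeasurable h

lemma ae_servingGain_nonneg (N : CellularNetwork par μ) : ∀ᵐ ω ∂μ, ∀ q, 0 ≤ N.servingGain q ω := by
  simp_rw [ae_all_iff]
  intro q
  have h := (par.isFadingLaw_serving q).nonneg
  rw [← N.servingGain_law q] at h
  exact ae_of_ae_map (N.measurable_servingGain q).aemeasurable h

lemma measurable_pos (N : CellularNetwork par μ) (q : Fin T) (b : ℕ) : Measurable (N.pos q b) :=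
  (N.isPoisson q).measurable b

/-- All gains of the network. -/
def gains (N : CellularNetwork par μ) (j : (Fin T × ℕ) ⊕ Fin T) (ω : Ω) : ℝ :=
  Sum.elim (fun p : Fin T × ℕ => N.gain p.1 p.2 ω) (fun q => N.servingGain q ω) j

lemma measurable_gains (N : CellularNetwork par μ) (j : (Fin T × ℕ) ⊕ Fin T) :
    Measurable (N.gains j) := by
  cases j with
  | inl p => exact N.measurable_gain p.1 p.2
  | inr q => exact N.measurable_servingGain q

lemma lintegral_gain (N : CellularNetwork par μ) (q : Fin T) (b : ℕ) {F : ℝ → ℝ≥0∞}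
    (hF : Measurable F) : ∫⁻ ω, F (N.gain q b ω) ∂μ = ∫⁻ x, F x ∂(par.interfererLaw q) := by
  rw [← N.gain_law q b, lintegral_map hF (N.measurable_gain q b)]

lemma lintegral_servingGain (N : CellularNetwork par μ) (q : Fin T) {F : ℝ → ℝ≥0∞}
    (hF : Measurable F) : ∫⁻ ω, F (N.servingGain q ω) ∂μ = ∫⁻ x, F x ∂(par.servingLaw q) := by
  rw [← N.servingGain_law q, lintegral_map hF (N.measurable_servingGain q)]

/-- The expectation over the gains, for a finite number of interfering base stations. -/
lemma lintegral_gains_finset (N : CellularNetwork par μ) (t : Fin T) {a : Fin T → ℕ → ℝ}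
    (ha : ∀ q b, 0 ≤ a q b) {k : ℝ → ℝ≥0∞} (hk : Measurable k) (n : ℕ) :
    ∫⁻ ω, k (N.servingGain t ω) * expNeg (∑ q, ∑ b ∈ Finset.range n,
        ENNReal.ofReal (a q b * N.gain q b ω)) ∂μ =
      (∫⁻ x, k x ∂(par.servingLaw t)) * expNeg (∑ q, ∑ b ∈ Finset.range n,
        ENNReal.ofReal (-Real.log (par.interfererMGF q (a q b)))) := by
  set h : (Fin T × ℕ) ⊕ Fin T → ℝ → ℝ≥0∞ :=
    Sum.elim (fun p x => expNeg (ENNReal.ofReal (a p.1 p.2 * x))) (fun _ => k) with hh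
  have hm (j) : Measurable (h j) := by
    cases j with
    | inl p => simp only [hh, Sum.elim_inl]; fun_prop
    | inr q => exact hk
  -- The gains involved: the first `n` interferers of every tier, and the single serving gain of
  -- tier `t`.
  set s : Finset ((Fin T × ℕ) ⊕ Fin T) :=
    Finset.disjSum (Finset.univ ×ˢ Finset.range n) {t} with hs
  have h1 (ω : Ω) : k (N.servingGain t ω) * expNeg (∑ q, ∑ b ∈ Finset.range n,
        ENNReal.ofReal (a q b * N.gain q b ω)) = ∏ j ∈ s, (h j ∘ N.gains j) ω := by
    rw [hs, Finset.prod_disjSum, ← Finset.sum_product', expNeg_sum, Finset.prod_singleton, mul_comm]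
    rfl
  simp_rw [h1]
  refine (lintegral_prod_eq_prod_lintegral_of_indepFun s _ (N.indep_gains.comp h hm)
    fun j => (hm j).comp (N.measurable_gains j)).trans ?_
  rw [hs, Finset.prod_disjSum, ← Finset.sum_product', expNeg_sum, Finset.prod_singleton, mul_comm]
  congr 1
  · exact N.lintegral_servingGain t hk
  · refine Finset.prod_congr rfl fun p _ => ?_
    refine (N.lintegral_gain p.1 p.2 (hm (Sum.inl p))).trans ?_
    have hp := par.isFadingLaw_interferer p.1
    rw [NetworkParams.interfererMGF, expNeg_ofReal_neg_log (hp.integral_exp_pos (ha _ _))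
      (hp.integral_exp_le_one (ha _ _))]
    exact hp.lintegral_expNeg (ha _ _)

lemma tendsto_sum_range (u : Fin T → ℕ → ℝ≥0∞) :
    Filter.Tendsto (fun n => ∑ q, ∑ b ∈ Finset.range n, u q b) Filter.atTop
      (nhds (∑' (q : Fin T) (b : ℕ), u q b)) := by
  rw [tsum_fintype]
  exact tendsto_finsetSum _ fun q _ => ENNReal.tendsto_nat_tsum _

/-- The expectation over the gains. -/
lemma lintegral_gains (N : CellularNetwork par μ) (t : Fin T) {a : Fin T → ℕ → ℝ}
    (ha : ∀ q b, 0 ≤ a q b) {k : ℝ → ℝ≥0∞} (hk : Measurable k) (hk1 : ∀ x, k x ≤ 1) :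
    ∫⁻ ω, k (N.servingGain t ω) * expNeg (∑' (q : Fin T) (b : ℕ),
        ENNReal.ofReal (a q b * N.gain q b ω)) ∂μ =
      (∫⁻ x, k x ∂(par.servingLaw t)) * expNeg (∑' (q : Fin T) (b : ℕ),
        ENNReal.ofReal (-Real.log (par.interfererMGF q (a q b)))) := by
  have hprob := N.isProbabilityMeasure
  have hprob' := (par.isFadingLaw_serving t).isProbabilityMeasure
  have hL : Filter.Tendsto (fun n => ∫⁻ ω, k (N.servingGain t ω) * expNeg (∑ q,
      ∑ b ∈ Finset.range n, ENNReal.ofReal (a q b * N.gain q b ω)) ∂μ) Filter.atTop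
      (nhds (∫⁻ ω, k (N.servingGain t ω) * expNeg (∑' (q : Fin T) (b : ℕ),
        ENNReal.ofReal (a q b * N.gain q b ω)) ∂μ)) := by
    -- The bound `k ≤ 1` supplies the dominating constant.
    refine tendsto_lintegral_of_dominated_convergence (fun _ => 1) (fun n => ?_)
      (fun n => ae_of_all _ fun ω => mul_le_one' (hk1 _) (expNeg_le_one _)) (by simp)
      (ae_of_all _ fun ω => ?_)
    · refine (hk.comp (N.measurable_servingGain t)).mul (measurable_expNeg.comp ?_)
      exact Finset.measurable_fun_sum _ fun q _ => Finset.measurable_fun_sum _ fun b _ =>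
        ((N.measurable_gain q b).const_mul _).ennreal_ofReal
    · exact ENNReal.Tendsto.const_mul ((continuous_expNeg.tendsto _).comp (tendsto_sum_range _))
        (Or.inr ((hk1 _).trans_lt ENNReal.one_lt_top).ne)
  have hR := ENNReal.Tendsto.const_mul (a := ∫⁻ x, k x ∂(par.servingLaw t))
    ((continuous_expNeg.tendsto _).comp (tendsto_sum_range
      (fun q b => ENNReal.ofReal (-Real.log (par.interfererMGF q (a q b))))))
    (Or.inr ((lintegral_mono hk1).trans_lt (by simp)).ne)
  refine tendsto_nhds_unique hL (hR.congr fun n => ?_)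
  exact (N.lintegral_gains_finset t ha hk n).symm

lemma dist_eq_nearest (N : CellularNetwork par μ) (q : Fin T) (ω : Ω) :
    N.dist q ω = nearest (N.pos q) ω := rfl

lemma rpow_neg_alpha (x : ℝ) (hx : 0 ≤ x) (a : ℝ) : x ^ (-a) = (x ^ 2) ^ (-(a / 2)) := by
  rw [← Real.rpow_natCast_mul hx]
  congr 1
  push_cast
  ring

/-- All positions of the network. -/
def positions (N : CellularNetwork par μ) (ω : Ω) (p : Fin T × ℕ) : Plane := N.pos p.1 p.2 ω

lemma measurable_positions (N : CellularNetwork par μ) : Measurable N.positions :=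
  measurable_pi_lambda _ fun p => N.measurable_pos p.1 p.2

open scoped Classical in
/-- The expectation over the gains, given the positions. -/
theorem lintegral_expNeg_interference (N : CellularNetwork par μ) (t : Fin T) {z : ℝ} (hz : 0 ≤ z)
    {k : (Fin T × ℕ → Plane) → ℝ → ℝ≥0∞} (hk : Measurable (Function.uncurry k))
    (hk1 : ∀ p x, k p x ≤ 1) :
    ∫⁻ ω, k (N.positions ω) (N.servingGain t ω) *
        expNeg (ENNReal.ofReal z * N.interference t ω) ∂μ =
      ∫⁻ ω, (∫⁻ x, k (N.positions ω) x ∂(par.servingLaw t)) * expNeg (nonservingSum N.pos t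
        (fun q s => ENNReal.ofReal (-Real.log (par.attenuation z q s))) ω) ∂μ := by
  have hprob := N.isProbabilityMeasure
  set S : (Fin T × ℕ → Plane) → Fin T → ℕ → Prop := fun p q b =>
    q = t ∧ ‖p (q, b)‖ = nearest (fun b (p : Fin T × ℕ → Plane) => p (t, b)) p with hS
  have hSm (q : Fin T) (b : ℕ) : MeasurableSet {p | S p q b} := by
    by_cases hq : q = t
    · simp only [hS, hq, true_and]
      exact measurableSet_eq_fun (by fun_prop) (measurable_nearest fun b => by fun_prop)
    · simp [hS, hq]
  -- The serving point is encoded by the coefficient zero, for which the transform of its gain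
  -- equals one, so it drops out on both sides.
  set a : (Fin T × ℕ → Plane) → Fin T → ℕ → ℝ := fun p q b =>
    if S p q b then 0 else z * par.P q * (‖p (q, b)‖ ^ 2) ^ (-(par.alpha q / 2)) with ha
  have ham (q : Fin T) (b : ℕ) : Measurable fun p => a p q b :=
    Measurable.ite (hSm q b) measurable_const (by fun_prop)
  have ha0 (p) (q : Fin T) (b : ℕ) : 0 ≤ a p q b := by
    simp only [ha]
    split_ifs
    · exact le_rfl
    · have := (par.P_pos q).le
      positivity
  set Ψ : (Fin T × ℕ → Plane) → ((Fin T × ℕ) ⊕ Fin T → ℝ) → ℝ≥0∞ := fun p g =>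
    k p (g (Sum.inr t)) * expNeg (∑' (q : Fin T) (b : ℕ),
      ENNReal.ofReal (a p q b * g (Sum.inl (q, b)))) with hΨ
  have hΨm : Measurable (Function.uncurry Ψ) := by
    refine Measurable.mul ?_ (measurable_expNeg.comp ?_)
    · exact hk.comp (measurable_fst.prodMk ((measurable_pi_apply _).comp measurable_snd))
    · refine Measurable.tsum fun q => Measurable.tsum fun b => Measurable.ennreal_ofReal ?_
      exact ((ham q b).comp measurable_fst).mul ((measurable_pi_apply _).comp measurable_snd)
  have h1 : ∫⁻ ω, k (N.positions ω) (N.servingGain t ω) *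
        expNeg (ENNReal.ofReal z * N.interference t ω) ∂μ =
      ∫⁻ ω, Ψ (N.positions ω) (fun j => N.gains j ω) ∂μ := by
    refine lintegral_congr_ae ?_
    filter_upwards [N.ae_gain_nonneg] with ω hω
    simp only [hΨ]
    congr 2
    rw [interference, ← ENNReal.tsum_mul_left]
    refine tsum_congr fun q => ?_
    rw [← ENNReal.tsum_mul_left]
    refine tsum_congr fun b => ?_
    simp only [ha]
    by_cases hs : S (N.positions ω) q b
    · have hs' : q = t ∧ ‖N.pos q b ω‖ = N.dist t ω := hs
      rw [if_pos hs, if_pos hs']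
      simp
    · have hs' : ¬ (q = t ∧ ‖N.pos q b ω‖ = N.dist t ω) := hs
      rw [if_neg hs, if_neg hs', ← ENNReal.ofReal_mul hz, rpow_neg_alpha _ (norm_nonneg _)]
      congr 1
      simp only [positions, gains, Sum.elim_inl]
      ring
  refine h1.trans ((lintegral_comp_of_indepFun N.indep_pos_gains N.measurable_positions
    (measurable_pi_lambda _ N.measurable_gains) hΨm).trans ?_)
  refine lintegral_congr fun ω => ?_
  refine (N.lintegral_gains t (ha0 (N.positions ω)) (hk.of_uncurry_left) (hk1 _)).trans ?_
  congr 2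
  rw [nonservingSum]
  refine tsum_congr fun q => tsum_congr fun b => ?_
  simp only [ha]
  by_cases hs : S (N.positions ω) q b
  · have hs' : q = t ∧ ‖N.pos q b ω‖ = nearest (N.pos t) ω := hs
    rw [if_pos hs, if_pos hs']
    have := (par.isFadingLaw_interferer q).isProbabilityMeasure
    simp [NetworkParams.interfererMGF]
  · have hs' : ¬ (q = t ∧ ‖N.pos q b ω‖ = nearest (N.pos t) ω) := hs
    rw [if_neg hs, if_neg hs']
    rfl

/-- The aggregate interference is almost surely finite. -/
lemma ae_interference_lt_top (N : CellularNetwork par μ) (t : Fin T) :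
    ∀ᵐ ω ∂μ, N.interference t ω < ∞ := by
  have hprob := N.isProbabilityMeasure
  have key (q : Fin T) : ∀ᵐ ω ∂μ, ∑' b, ENNReal.ofReal (par.P q * N.gain q b ω *
      ‖N.pos q b ω‖ ^ (-par.alpha q)) < ∞ := by
    -- Only the far field, outside the unit disc, has finite mean: the path loss is not integrable
    -- at the origin. The disc contains almost surely finitely many points, each with a finite
    -- contribution.
    set l : Plane → ℝ≥0∞ := fun x =>
      (Ici (1 : ℝ)).indicator (fun s => ENNReal.ofReal (par.P q * s ^ (-(par.alpha q / 2))))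
        (‖x‖ ^ 2) with hl
    have hlm' : Measurable ((Ici (1 : ℝ)).indicator
        (fun s => ENNReal.ofReal (par.P q * s ^ (-(par.alpha q / 2))))) :=
      (by fun_prop : Measurable fun s => ENNReal.ofReal (par.P q * s ^ (-(par.alpha q / 2)))).indicator
        measurableSet_Ici
    have hlm : Measurable l := hlm'.comp (by fun_prop)
    have h1 : ∫⁻ ω, ∑' b, l (N.pos q b ω) * ENNReal.ofReal (N.gain q b ω) ∂μ < ∞ := by
      have h2 (b : ℕ) : ∫⁻ ω, l (N.pos q b ω) * ENNReal.ofReal (N.gain q b ω) ∂μ =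
          ∫⁻ ω, l (N.pos q b ω) ∂μ := by
        have hi := N.indep_pos_gains.comp (φ := fun p : Fin T × ℕ → Plane => l (p (q, b)))
          (ψ := fun g : (Fin T × ℕ) ⊕ Fin T → ℝ => ENNReal.ofReal (g (Sum.inl (q, b))))
          (by fun_prop) (by fun_prop)
        refine (lintegral_mul_eq_lintegral_mul_lintegral_of_indepFun
          (hlm.comp (N.measurable_pos q b)) (N.measurable_gain q b).ennreal_ofReal hi).trans ?_
        have hg := par.isFadingLaw_interferer q
        rw [N.lintegral_gain q b (F := fun x => ENNReal.ofReal x) (by fun_prop),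
          ← ofReal_integral_eq_lintegral_ofReal hg.integrable hg.nonneg, hg.mean_one]
        simp
      rw [MeasureTheory.lintegral_tsum
        (f := fun b ω => l (N.pos q b ω) * ENNReal.ofReal (N.gain q b ω))
        fun b => ((hlm.comp (N.measurable_pos q b)).mul
        (N.measurable_gain q b).ennreal_ofReal).aemeasurable]
      simp_rw [h2]
      rw [← MeasureTheory.lintegral_tsum (f := fun b ω => l (N.pos q b ω))
        fun b => (hlm.comp (N.measurable_pos q b)).aemeasurable,
        (N.isPoisson q).lintegral_tsum (par.lam_pos q).le hlm, hl, lintegral_norm_sq hlm']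
      refine ENNReal.mul_lt_top ENNReal.ofReal_lt_top
        (ENNReal.mul_lt_top ENNReal.ofReal_lt_top ?_)
      rw [lintegral_indicator measurableSet_Ici, Measure.restrict_restrict measurableSet_Ici,
        inter_eq_left.2 (Ici_subset_Ioi.2 zero_lt_one), ← setLIntegral_congr Ioi_ae_eq_Ici]
      have hint : IntegrableOn (fun s : ℝ => par.P q * s ^ (-(par.alpha q / 2))) (Ioi 1) :=
        (integrableOn_Ioi_rpow_of_lt (by linarith [par.two_lt_alpha q]) zero_lt_one).const_mul _
      exact hint.lintegral_lt_top
    have h3 := ae_lt_top (Measurable.tsum fun b => (hlm.comp (N.measurable_pos q b)).mul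
        (N.measurable_gain q b).ennreal_ofReal) h1.ne
    filter_upwards [h3, (N.isPoisson q).ae_finite_ball (par.lam_pos q).le, N.ae_gain_nonneg]
      with ω hω hfin hg
    -- Each term is bounded by its far-field part plus a part supported on the points of the unit
    -- disc.
    have h4 (b : ℕ) : ENNReal.ofReal (par.P q * N.gain q b ω * ‖N.pos q b ω‖ ^ (-par.alpha q)) ≤
        l (N.pos q b ω) * ENNReal.ofReal (N.gain q b ω) + {b | ‖N.pos q b ω‖ < (1 : ℕ)}.indicator
          (fun b => ENNReal.ofReal (par.P q * N.gain q b ω * ‖N.pos q b ω‖ ^ (-par.alpha q))) b := by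
      by_cases hb : ‖N.pos q b ω‖ < (1 : ℕ)
      · rw [indicator_of_mem (by exact hb)]
        exact le_add_self
      · refine le_add_right ?_
        simp only [Nat.cast_one, not_lt] at hb
        simp only [hl]
        rw [indicator_of_mem (by simpa using hb), rpow_neg_alpha _ (norm_nonneg _),
          ← ENNReal.ofReal_mul' (hg q b)]
        refine (congrArg _ ?_).le
        ring
    refine (ENNReal.tsum_le_tsum h4).trans_lt ?_
    rw [ENNReal.tsum_add]
    refine ENNReal.add_lt_top.2 ⟨hω, ?_⟩
    rw [tsum_eq_sum (s := (hfin 1).toFinset)]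
    · refine ENNReal.sum_lt_top.2 fun b hb => ?_
      refine (indicator_le_self _ _ _).trans_lt ENNReal.ofReal_lt_top
    · intro b hb
      exact indicator_of_notMem (by simpa using hb) _
  rw [← ae_all_iff] at key
  filter_upwards [key] with ω hω
  rw [interference, tsum_fintype]
  refine ENNReal.sum_lt_top.2 fun q _ => lt_of_le_of_lt (ENNReal.tsum_le_tsum fun b => ?_) (hω q)
  split_ifs
  · exact zero_le
  · exact le_rfl

end CellularNetwork

end

/-! ### Integral representation of the logarithm, and the path-loss integrals -/

noncomputable section

section Exponentials

lemma lintegral_Ioc_exp {c : ℝ} (hc : 0 ≤ c) {a b : ℝ} (hab : a ≤ b) :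
    ∫⁻ w in Ioc a b, ENNReal.ofReal (c * Real.exp (-(c * w))) =
      ENNReal.ofReal (Real.exp (-(c * a)) - Real.exp (-(c * b))) := by
  have hcont : Continuous fun w : ℝ => c * Real.exp (-(c * w)) := by fun_prop
  rw [← ofReal_integral_eq_lintegral_ofReal
    ((hcont.intervalIntegrable a b).1) (ae_of_all _ fun w => by positivity),
    ← intervalIntegral.integral_of_le hab,
    intervalIntegral.integral_eq_sub_of_hasDerivAt (f := fun w => -Real.exp (-(c * w)))
      (fun w _ => ?_) (hcont.intervalIntegrable a b)]
  · ring_nf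
  · have := ((hasDerivAt_id w).const_mul c).fun_neg.exp.fun_neg
    refine this.congr_deriv ?_
    simp only [id]
    ring

lemma lintegral_Ioi_exp {w : ℝ} (hw : 0 < w) :
    ∫⁻ z in Ioi (0 : ℝ), ENNReal.ofReal (Real.exp (-(z * w))) = ENNReal.ofReal w⁻¹ := by
  have hi := integrableOn_exp_mul_Ioi (neg_lt_zero.2 hw) 0
  have h := integral_exp_mul_Ioi (neg_lt_zero.2 hw) 0
  have he (z : ℝ) : Real.exp (-(z * w)) = Real.exp (-w * z) := by ring_nf
  simp_rw [he]
  rw [← ofReal_integral_eq_lintegral_ofReal hi (ae_of_all _ fun z => (Real.exp_pos _).le), h]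
  simp

/-- The integral representation of `log (1 + X / Y)`. -/
theorem lintegral_exp_eq_log {X Y : ℝ} (hX : 0 ≤ X) (hY : 0 < Y) :
    ∫⁻ z in Ioi (0 : ℝ), ENNReal.ofReal ((1 - Real.exp (-(z * X))) * Real.exp (-(z * Y)) / z) =
      ENNReal.ofReal (Real.log (1 + X / Y)) := by
  -- The quotient by `z` is an integral of `exp (-z w)` over `w` in `(Y, Y + X]`. Exchanging the
  -- integrals leaves the integral of `1 / w`, which is the logarithm.
  have h1 : ∀ z ∈ Ioi (0 : ℝ),
      ENNReal.ofReal ((1 - Real.exp (-(z * X))) * Real.exp (-(z * Y)) / z) =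
        ∫⁻ w in Ioc Y (Y + X), ENNReal.ofReal (Real.exp (-(z * w))) := by
    intro z hz
    have hz0 : 0 < z := hz
    have h := lintegral_Ioc_exp hz0.le (le_add_of_nonneg_right hX : Y ≤ Y + X)
    simp_rw [ENNReal.ofReal_mul hz0.le] at h
    rw [lintegral_const_mul' _ _ ENNReal.ofReal_ne_top] at h
    have hz' : ENNReal.ofReal z ≠ 0 := by simpa using hz0
    rw [← ENNReal.mul_right_inj hz' ENNReal.ofReal_ne_top, h, ← ENNReal.ofReal_mul hz0.le]
    congr 1
    rw [mul_div_cancel₀ _ hz0.ne', mul_add, neg_add, Real.exp_add]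
    ring
  rw [setLIntegral_congr_fun measurableSet_Ioi h1, lintegral_lintegral_swap]
  · rw [setLIntegral_congr_fun (g := fun w => ENNReal.ofReal w⁻¹) measurableSet_Ioc
      fun w hw => lintegral_Ioi_exp (hY.trans hw.1)]
    have hYX : 0 < Y + X := by linarith
    have hnot : (0 : ℝ) ∉ uIcc Y (Y + X) := notMem_uIcc_of_lt hY hYX
    rw [← ofReal_integral_eq_lintegral_ofReal
      ((intervalIntegral.intervalIntegrable_inv (fun w hw h => hnot (h ▸ hw))
        continuousOn_id).1) ((ae_restrict_iff' measurableSet_Ioc).2 (ae_of_all _ fun w hw =>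
          inv_nonneg.2 (hY.trans hw.1).le)), ← intervalIntegral.integral_of_le (by linarith)]
    rw [integral_inv_of_pos hY hYX]
    congr 2
    field_simp
  · exact (by fun_prop : Measurable fun p : ℝ × ℝ =>
      ENNReal.ofReal (Real.exp (-(p.1 * p.2)))).aemeasurable

end Exponentials

section PathLoss

/-- The Beta integral with parameters `1 - δ` and `k + 1`, read off from the normalisation of the
Beta density. -/
lemma lintegral_Ioo_beta {δ : ℝ} (hδ : δ < 1) (k : ℕ) :
    ∫⁻ w in Ioo (0 : ℝ) 1, ENNReal.ofReal (w ^ (-δ) * (1 - w) ^ k) =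
      ENNReal.ofReal (Real.Gamma (1 - δ) * k.factorial * (Real.Gamma (2 - δ + k))⁻¹) := by
  have hk : (0 : ℝ) < k + 1 := by positivity
  have hd : 0 < 1 - δ := by linarith
  have hb := beta_pos hd hk
  have h := lintegral_betaPDF_eq_one hd hk
  rw [lintegral_betaPDF] at h
  have h1 (w : ℝ) : ENNReal.ofReal (1 / beta (1 - δ) (k + 1) * w ^ (1 - δ - 1) *
      (1 - w) ^ ((k : ℝ) + 1 - 1)) = ENNReal.ofReal (1 / beta (1 - δ) (k + 1)) *
        ENNReal.ofReal (w ^ (-δ) * (1 - w) ^ k) := by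
    rw [← ENNReal.ofReal_mul (by positivity), mul_assoc]
    norm_num
  simp_rw [h1] at h
  rw [lintegral_const_mul' _ _ ENNReal.ofReal_ne_top] at h
  have h2 : ENNReal.ofReal (Real.Gamma (1 - δ) * k.factorial * (Real.Gamma (2 - δ + k))⁻¹) =
      ENNReal.ofReal (beta (1 - δ) (k + 1)) := by
    rw [beta, Real.Gamma_nat_eq_factorial, div_eq_mul_inv]
    ring_nf
  have hne : ENNReal.ofReal (1 / beta (1 - δ) (k + 1)) ≠ 0 := by simpa using hb
  rw [h2, ← ENNReal.mul_right_inj hne ENNReal.ofReal_ne_top, h, ← ENNReal.ofReal_mul (by positivity),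
    one_div_mul_cancel hb.ne', ENNReal.ofReal_one]

/-- Write `exp (-a w) = exp (-a) * exp (a (1 - w))` and expand the second factor: all terms are
nonnegative, and they integrate to Beta functions whose factorials cancel those of the series. -/
lemma lintegral_Ioo_rpow_mul_exp {δ a : ℝ} (hδ : δ < 1) (ha : 0 ≤ a) :
    ∫⁻ w in Ioo (0 : ℝ) 1, ENNReal.ofReal (w ^ (-δ)) * ENNReal.ofReal (a * Real.exp (-(a * w))) =
      ∑' k : ℕ, ENNReal.ofReal (Real.Gamma (1 - δ) *
        (a ^ (k + 1) * Real.exp (-a) * (Real.Gamma (2 - δ + k))⁻¹)) := by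
  have h1 : ∀ w ∈ Ioo (0 : ℝ) 1,
      ENNReal.ofReal (w ^ (-δ)) * ENNReal.ofReal (a * Real.exp (-(a * w))) =
        ∑' k : ℕ, ENNReal.ofReal (a ^ (k + 1) * Real.exp (-a) / k.factorial) *
          ENNReal.ofReal (w ^ (-δ) * (1 - w) ^ k) := by
    intro w hw
    have hw1 : 0 ≤ 1 - w := by linarith [hw.2]
    have hwd : 0 ≤ w ^ (-δ) := Real.rpow_nonneg hw.1.le _
    have h := (NormedSpace.expSeries_div_hasSum_exp (a * (1 - w))).mul_left
      (w ^ (-δ) * a * Real.exp (-a))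
    rw [← Real.exp_eq_exp_ℝ, mul_assoc _ (Real.exp (-a)), ← Real.exp_add] at h
    have he : -a + a * (1 - w) = -(a * w) := by ring
    rw [he] at h
    rw [← ENNReal.ofReal_mul hwd, ← mul_assoc, ← h.tsum_eq,
      ENNReal.ofReal_tsum_of_nonneg (fun k => by positivity) h.summable]
    refine tsum_congr fun k => ?_
    rw [← ENNReal.ofReal_mul (by positivity)]
    congr 1
    rw [mul_pow]
    ring
  rw [setLIntegral_congr_fun measurableSet_Ioo h1, lintegral_tsum fun k => by fun_prop]
  refine tsum_congr fun k => ?_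
  rw [lintegral_const_mul' _ _ ENNReal.ofReal_ne_top, lintegral_Ioo_beta hδ,
    ← ENNReal.ofReal_mul (by positivity)]
  congr 1
  have : (k.factorial : ℝ) ≠ 0 := by positivity
  field_simp

/-- Both sides integrate `a * exp (-a w)` over the region `0 < w < 1`, `0 < v`, `w < v ^ (-β)`. For
fixed `v` the range of `w` is cut at `min (v ^ (-β)) 1`, which separates `v ≤ 1` from `v > 1`; for
fixed `w` the range of `v` has length `w ^ (-1/β)`. -/
lemma lintegral_one_sub_exp_rpow {β a : ℝ} (hβ : 1 < β) (ha : 0 ≤ a) :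
    ENNReal.ofReal (1 - Real.exp (-a)) +
        ∫⁻ v in Ioi (1 : ℝ), ENNReal.ofReal (1 - Real.exp (-(a * v ^ (-β)))) =
      ∫⁻ w in Ioo (0 : ℝ) 1, ENNReal.ofReal (w ^ (-(1 / β))) *
        ENNReal.ofReal (a * Real.exp (-(a * w))) := by
  have hβ0 : 0 < β := by linarith
  set h : ℝ → ℝ≥0∞ := fun w => ENNReal.ofReal (a * Real.exp (-(a * w))) with hh
  set D : Set (ℝ × ℝ) := {p | p.2 < p.1 ^ (-β)} with hD
  have hDm : MeasurableSet D := measurableSet_lt (by fun_prop) (by fun_prop)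
  have hint {m : ℝ} (hm : 0 ≤ m) : ∫⁻ w in Ioo 0 m, h w =
      ENNReal.ofReal (1 - Real.exp (-(a * m))) := by
    rw [restrict_Ioo_eq_restrict_Ioc, hh, lintegral_Ioc_exp ha hm]
    simp
  have hv {v : ℝ} (hv0 : 0 < v) : ∫⁻ w in Ioo (0 : ℝ) 1, D.indicator (fun p => h p.2) (v, w) =
      ∫⁻ w in Ioo 0 (min (v ^ (-β)) 1), h w := by
    have : ∀ w, D.indicator (fun p => h p.2) (v, w) = (Iio (v ^ (-β))).indicator h w := by
      intro w
      simp [hD, indicator_apply]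
    simp_rw [this]
    rw [lintegral_indicator measurableSet_Iio, Measure.restrict_restrict measurableSet_Iio,
      inter_comm, Ioo_inter_Iio, min_comm]
  have hL : ∫⁻ v in Ioi (0 : ℝ), ∫⁻ w in Ioo (0 : ℝ) 1, D.indicator (fun p => h p.2) (v, w) =
      ENNReal.ofReal (1 - Real.exp (-a)) +
        ∫⁻ v in Ioi (1 : ℝ), ENNReal.ofReal (1 - Real.exp (-(a * v ^ (-β)))) := by
    rw [← Ioc_union_Ioi_eq_Ioi (zero_le_one' ℝ),
      lintegral_union measurableSet_Ioi (Ioc_disjoint_Ioi le_rfl)]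
    congr 1
    · rw [setLIntegral_congr_fun (g := fun _ => ENNReal.ofReal (1 - Real.exp (-a)))
        measurableSet_Ioc]
      · simp
      · intro v hv'
        simp only
        rw [hv hv'.1, min_eq_right (Real.one_le_rpow_of_pos_of_le_one_of_nonpos hv'.1 hv'.2
          (by linarith)), hint zero_le_one, mul_one]
    · refine setLIntegral_congr_fun measurableSet_Ioi fun v hv' => ?_
      have hv1 : 1 < v := hv'
      have hv0 : 0 < v := by linarith
      rw [hv hv0, min_eq_left (Real.rpow_le_one_of_one_le_of_nonpos hv1.le (by linarith)),
        hint (Real.rpow_nonneg hv0.le _)]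
  rw [← hL, lintegral_lintegral_swap]
  · refine setLIntegral_congr_fun measurableSet_Ioo fun w hw => ?_
    have hw0 : 0 < w := hw.1
    have : ∀ v ∈ Ioi (0 : ℝ), D.indicator (fun p => h p.2) (v, w) =
        (Iio (w ^ (-(1 / β)))).indicator (fun _ => h w) v := by
      intro v hv0
      have hv0' : 0 < v := hv0
      have hiff : w < v ^ (-β) ↔ v < w ^ (-(1 / β)) := by
        rw [← Real.lt_rpow_inv_iff_of_neg hv0' hw0 (by linarith : -β < 0)]
        rw [one_div, inv_neg]
      simp only [hD, indicator_apply, mem_ofPred_eq, mem_Iio, hiff]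
    rw [setLIntegral_congr_fun measurableSet_Ioi this, lintegral_indicator measurableSet_Iio,
      Measure.restrict_restrict measurableSet_Iio, inter_comm, Ioi_inter_Iio, lintegral_const,
      Measure.restrict_apply MeasurableSet.univ, univ_inter, Real.volume_Ioo, sub_zero, mul_comm]
  · have hm : Measurable fun p : ℝ × ℝ => h p.2 := by fun_prop
    exact (hm.indicator hDm).aemeasurable

end PathLoss

end

/-! ### The path-loss series and the functions `𝒵` and `𝒢` -/

noncomputable section

/-- The substitution `s = r v`: under a power law, scaling the radius only changes the constant in
front of the path loss. -/
lemma effectiveSq_powerLaw (L : ℝ → ℝ) (c β : ℝ) {r : ℝ} (hr : 0 < r) :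
    effectiveSq (fun s => L (c * s ^ (-β))) r =
      r * effectiveSq (fun v => L (c * r ^ (-β) * v ^ (-β))) 1 := by
  have h := integral_comp_mul_left_Ioi (fun s => 1 - L (c * s ^ (-β))) 1 hr
  have h2 : ∫ v in Ioi (1 : ℝ), (1 - L (c * r ^ (-β) * v ^ (-β))) =
      ∫ v in Ioi (1 : ℝ), (1 - L (c * (r * v) ^ (-β))) := by
    refine setIntegral_congr_fun measurableSet_Ioi fun v hv => ?_
    have hv0 : 0 ≤ v := (zero_lt_one.trans (show 1 < v from hv)).le
    rw [Real.mul_rpow hr.le hv0, mul_assoc]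
  rw [mul_one, smul_eq_mul] at h
  rw [effectiveSq, effectiveSq, h2, h]
  field_simp

namespace IsFadingLaw

variable {ν : Measure ℝ}

lemma integrable_pow_mul_exp (h : IsFadingLaw ν) {s : ℝ} (hs : 0 < s) (n : ℕ) :
    Integrable (fun x => x ^ n * Real.exp (-s * x)) ν := by
  have := h.isProbabilityMeasure
  refine (integrable_const (n.factorial / s ^ n : ℝ)).mono' (by fun_prop) ?_
  filter_upwards [h.nonneg] with x hx
  rw [Real.norm_of_nonneg (by positivity), neg_mul, Real.exp_neg, ← div_eq_mul_inv,
    div_le_div_iff₀ (Real.exp_pos _) (by positivity), ← mul_pow, mul_comm x]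
  have := Real.pow_div_factorial_le_exp (s * x) (by positivity) n
  rw [div_le_iff₀ (by positivity)] at this
  linarith

lemma integral_pow_mul_exp_nonneg (h : IsFadingLaw ν) (s : ℝ) (n : ℕ) :
    0 ≤ ∫ x, x ^ n * Real.exp (-s * x) ∂ν := by
  refine integral_nonneg_of_ae ?_
  filter_upwards [h.nonneg] with x hx
  simp only [Pi.zero_apply]
  positivity

lemma ofReal_one_sub_integral_exp (h : IsFadingLaw ν) {s : ℝ} (hs : 0 ≤ s) :
    ENNReal.ofReal (1 - ∫ x, Real.exp (-s * x) ∂ν) =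
      ∫⁻ x, ENNReal.ofReal (1 - Real.exp (-(s * x))) ∂ν := by
  have := h.isProbabilityMeasure
  have h1 : 1 - ∫ x, Real.exp (-s * x) ∂ν = ∫ x, (1 - Real.exp (-s * x)) ∂ν := by
    rw [integral_sub (integrable_const _) (h.integrable_exp hs)]
    simp
  have h2 : 0 ≤ᵐ[ν] fun x => 1 - Real.exp (-s * x) := by
    filter_upwards [h.ae_exp_le_one hs] with x hx
    simpa using hx
  rw [h1, ofReal_integral_eq_lintegral_ofReal (f := fun x => 1 - Real.exp (-s * x))
    ((integrable_const _).sub (h.integrable_exp hs)) h2]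
  simp_rw [neg_mul]

/-- The two preceding path-loss identities with `a = s * x`, averaged over the gain `x`. The term `1
- 𝔼 exp (-s x)` is the contribution of `0 < v ≤ 1` in the layer argument. -/
lemma tsum_moments (h : IsFadingLaw ν) {β s : ℝ} (hβ : 1 < β) (hs : 0 < s) :
    ∑' k : ℕ, ENNReal.ofReal (Real.Gamma (1 - 1 / β) * (s ^ (k + 1) *
        (∫ x, x ^ (k + 1) * Real.exp (-s * x) ∂ν) * (Real.Gamma (2 - 1 / β + k))⁻¹)) =
      ENNReal.ofReal (1 - ∫ x, Real.exp (-s * x) ∂ν) +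
        ENNReal.ofReal (∫ v in Ioi (1 : ℝ), (1 - ∫ x, Real.exp (-(s * v ^ (-β)) * x) ∂ν)) := by
  have := h.isProbabilityMeasure
  have hδ : 1 / β < 1 := (div_lt_one (by linarith)).2 hβ
  have hΓ : 0 < Real.Gamma (1 - 1 / β) := Real.Gamma_pos_of_pos (by linarith)
  have hΓk (k : ℕ) : 0 < Real.Gamma (2 - 1 / β + k) := 
    Real.Gamma_pos_of_pos (by linarith [(Nat.cast_nonneg k : (0 : ℝ) ≤ k)])
  have hA := h.isAttenuation hs.le hβ
  rw [ofReal_integral_eq_lintegral_ofReal (hA.integrableOn_Ioi zero_le_one)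
    ((ae_restrict_iff' measurableSet_Ioi).2 (ae_of_all _ fun v hv => sub_nonneg.2
      (hA.le_one v (zero_le_one.trans (le_of_lt hv)))))]
  have h1 : ∀ v ∈ Ioi (1 : ℝ), ENNReal.ofReal (1 - ∫ x, Real.exp (-(s * v ^ (-β)) * x) ∂ν) =
      ∫⁻ x, ENNReal.ofReal (1 - Real.exp (-(s * x * v ^ (-β)))) ∂ν := by
    intro v hv
    have hv0 : 0 ≤ v := zero_le_one.trans (le_of_lt hv)
    rw [h.ofReal_one_sub_integral_exp (by positivity)]
    simp_rw [mul_right_comm s]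
  rw [setLIntegral_congr_fun measurableSet_Ioi h1, h.ofReal_one_sub_integral_exp hs.le,
    lintegral_lintegral_swap (by fun_prop), ← lintegral_add_left (by fun_prop)]
  have h2 : ∀ᵐ x ∂ν, ENNReal.ofReal (1 - Real.exp (-(s * x))) +
      ∫⁻ v in Ioi (1 : ℝ), ENNReal.ofReal (1 - Real.exp (-(s * x * v ^ (-β)))) =
      ∑' k : ℕ, ENNReal.ofReal (Real.Gamma (1 - 1 / β) *
        ((s * x) ^ (k + 1) * Real.exp (-(s * x)) * (Real.Gamma (2 - 1 / β + k))⁻¹)) := by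
    filter_upwards [h.nonneg] with x hx
    have hsx : 0 ≤ s * x := by positivity
    rw [lintegral_one_sub_exp_rpow hβ hsx, lintegral_Ioo_rpow_mul_exp hδ hsx]
  rw [lintegral_congr_ae h2, lintegral_tsum fun k => by fun_prop]
  refine tsum_congr fun k => ?_
  have h3 (x : ℝ) : Real.Gamma (1 - 1 / β) *
        ((s * x) ^ (k + 1) * Real.exp (-(s * x)) * (Real.Gamma (2 - 1 / β + k))⁻¹) =
      Real.Gamma (1 - 1 / β) * s ^ (k + 1) * (Real.Gamma (2 - 1 / β + k))⁻¹ *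
        (x ^ (k + 1) * Real.exp (-s * x)) := by
    rw [mul_pow, neg_mul]
    ring
  have hc : 0 ≤ Real.Gamma (1 - 1 / β) * s ^ (k + 1) * (Real.Gamma (2 - 1 / β + k))⁻¹ := by
    have := hΓk k
    positivity
  simp_rw [h3, ENNReal.ofReal_mul hc]
  rw [lintegral_const_mul' _ _ ENNReal.ofReal_ne_top,
    ← ofReal_integral_eq_lintegral_ofReal (h.integrable_pow_mul_exp hs (k + 1)),
    ← ENNReal.ofReal_mul hc]
  · congr 1
    ring
  · filter_upwards [h.nonneg] with x hx
    simp only [Pi.zero_apply]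
    positivity

end IsFadingLaw

namespace NetworkParams

variable {T : ℕ} (par : NetworkParams T) {α : ℝ}

lemma tailTerm_nonneg (hα : 2 < α) (q : Fin T) {s : ℝ} (hs : 0 ≤ s) (k : ℕ) :
    0 ≤ par.tailTerm α q s k := by
  have h1 : 2 / α < 1 := (div_lt_one (by linarith)).2 hα
  have hk : (0 : ℝ) ≤ k := Nat.cast_nonneg k
  have hΓk : 0 < Real.Gamma (2 - 2 / α + k) := Real.Gamma_pos_of_pos (by linarith)
  have := (par.isFadingLaw_interferer q).integral_pow_mul_exp_nonneg s (k + 1)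
  exact mul_nonneg (mul_nonneg (by positivity) this) (by positivity)

lemma tsum_tailTerm (hα : 2 < α) (q : Fin T) {s : ℝ} (hs : 0 < s) :
    ∑' k : ℕ, ENNReal.ofReal (Real.Gamma (1 - 2 / α) * par.tailTerm α q s k) =
      ENNReal.ofReal (1 - par.interfererMGF q s) +
        ENNReal.ofReal (∫ v in Ioi (1 : ℝ), (1 - par.interfererMGF q (s * v ^ (-(α / 2))))) := by
  have h := (par.isFadingLaw_interferer q).tsum_moments (β := α / 2) (by linarith) hs
  rw [one_div_div] at h
  exact h

lemma Gamma_one_sub_pos (hα : 2 < α) : 0 < Real.Gamma (1 - 2 / α) := by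
  have h1 : 2 / α < 1 := (div_lt_one (by linarith)).2 hα
  exact Real.Gamma_pos_of_pos (by linarith)

lemma summable_tailTerm (hα : 2 < α) (q : Fin T) {s : ℝ} (hs : 0 < s) :
    Summable (par.tailTerm α q s) := by
  have hΓ := Gamma_one_sub_pos hα
  have h : ∑' k : ℕ, ENNReal.ofReal (Real.Gamma (1 - 2 / α) * par.tailTerm α q s k) ≠ ∞ := by
    rw [par.tsum_tailTerm hα q hs]
    exact ENNReal.add_ne_top.2 ⟨ENNReal.ofReal_ne_top, ENNReal.ofReal_ne_top⟩
  have h2 := ENNReal.summable_toReal h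
  simp_rw [ENNReal.toReal_ofReal (mul_nonneg hΓ.le (par.tailTerm_nonneg hα q hs.le _))] at h2
  exact (summable_mul_left_iff hΓ.ne').1 h2

/-- The transform cancels the one inside the term `1 - M(s)` of the series, leaving one plus the
integral over `v > 1`. This explains why `𝒵` contains `M + 𝒯`. -/
lemma interfererMGF_add_tail (hα : 2 < α) (q : Fin T) {s : ℝ} (hs : 0 < s) :
    par.interfererMGF q s + par.tail α q s =
      effectiveSq (fun v => par.interfererMGF q (s * v ^ (-(α / 2)))) 1 := by
  have hΓ := Gamma_one_sub_pos hα
  have hq := par.isFadingLaw_interferer q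
  have hA := hq.isAttenuation (β := α / 2) hs.le (by linarith)
  have h1 : 0 ≤ 1 - par.interfererMGF q s := sub_nonneg.2 (hq.integral_exp_le_one hs.le)
  have h2 : 0 ≤ ∫ v in Ioi (1 : ℝ), (1 - par.interfererMGF q (s * v ^ (-(α / 2)))) :=
    hA.integral_nonneg zero_le_one
  have hnn (k : ℕ) := mul_nonneg hΓ.le (par.tailTerm_nonneg hα q hs.le k)
  have h := par.tsum_tailTerm hα q hs
  rw [← ENNReal.ofReal_add h1 h2, ← ENNReal.ofReal_tsum_of_nonneg hnn
    ((par.summable_tailTerm hα q hs).mul_left _), ENNReal.ofReal_eq_ofReal_iff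
      (tsum_nonneg hnn) (add_nonneg h1 h2), tsum_mul_left] at h
  rw [tail, h, effectiveSq]
  ring

lemma biasedRatio_pos (t q : Fin T) : 0 < par.biasedRatio t q :=
  mul_pos (div_pos (par.P_pos q) (par.P_pos t)) (div_pos (par.B_pos q) (par.B_pos t))

lemma snr_pos (t : Fin T) : 0 < par.snr t := div_pos (par.P_pos t) par.noise_pos

lemma biasedRatio_self (t : Fin T) : par.biasedRatio t t = 1 := by
  rw [biasedRatio, div_self (par.P_pos t).ne', div_self (par.B_pos t).ne', one_mul]

lemma zPair_eq (hα : 2 < α) (t q : Fin T) {y : ℝ} (hy : 0 < y) :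
    par.zPair α t q y = par.biasedRatio t q ^ (2 / α) * effectiveSq
      (fun v => par.interfererMGF q
        ((par.biasedRatio t q)⁻¹ * par.snr q * y * v ^ (-(α / 2)))) 1 := by
  have := par.biasedRatio_pos t q
  have := par.snr_pos q
  rw [zPair, ← mul_add, par.interfererMGF_add_tail hα q (by positivity)]

lemma rpow_biasedRatio_le_zPair (hα : 2 < α) (t q : Fin T) {y : ℝ} (hy : 0 < y) :
    par.biasedRatio t q ^ (2 / α) ≤ par.zPair α t q y := by
  have h1 := par.biasedRatio_pos t q
  have h2 := par.snr_pos q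
  rw [par.zPair_eq hα t q hy]
  refine le_mul_of_one_le_right (Real.rpow_nonneg h1.le _) ?_
  exact le_add_of_nonneg_right (((par.isFadingLaw_interferer q).isAttenuation (β := α / 2)
    (by positivity : 0 ≤ (par.biasedRatio t q)⁻¹ * par.snr q * y)
    (by linarith)).integral_nonneg zero_le_one)

/-- The summand `q = t` alone is at least one: its density ratio and biased ratio are both one. -/
lemma one_le_zTotal (hα : 2 < α) (t : Fin T) {y : ℝ} (hy : 0 < y) : 1 ≤ par.zTotal α t y := by
  have hnn (q : Fin T) : 0 ≤ par.lam q / par.lam t * par.zPair α t q y :=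
    mul_nonneg (div_nonneg (par.lam_pos q).le (par.lam_pos t).le)
      ((Real.rpow_nonneg (par.biasedRatio_pos t q).le _).trans
        (par.rpow_biasedRatio_le_zPair hα t q hy))
  refine le_trans ?_ (Finset.single_le_sum (fun q _ => hnn q) (Finset.mem_univ t))
  rw [div_self (par.lam_pos t).ne', one_mul]
  have := par.rpow_biasedRatio_le_zPair hα t t hy
  rwa [par.biasedRatio_self, Real.one_rpow] at this

/-- The product of the void weights of all tiers after rescaling. -/
lemma prod_voidWeight (hα : ∀ q, par.alpha q = α) (t : Fin T) {y s : ℝ} (hy : 0 < y)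
    (hs : 0 < s) :
    ∏ q, ENNReal.ofReal (voidWeight (par.lam q)
        (par.attenuation (y * s ^ (α / 2) / par.noise) q) (par.biasedRatio t q ^ (2 / α) * s)) =
      ENNReal.ofReal (Real.exp (-(Real.pi * par.lam t * par.zTotal α t y * s))) := by
  have hα2 : 2 < α := hα t ▸ par.two_lt_alpha t
  have h1 (q : Fin T) : effectiveSq (par.attenuation (y * s ^ (α / 2) / par.noise) q)
      (par.biasedRatio t q ^ (2 / α) * s) = s * par.zPair α t q y := by
    have hρ := par.biasedRatio_pos t q
    have hκ : 0 < par.biasedRatio t q ^ (2 / α) := Real.rpow_pos_of_pos hρ _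
    have hr : 0 < par.biasedRatio t q ^ (2 / α) * s := mul_pos hκ hs
    have he : par.attenuation (y * s ^ (α / 2) / par.noise) q = fun x => par.interfererMGF q
        (y * s ^ (α / 2) / par.noise * par.P q * x ^ (-(α / 2))) := by
      ext x
      rw [attenuation, hα]
    -- The rescaling is chosen for this cancellation: the factor `s ^ (α / 2)` disappears, so the
    -- remaining effective squared distance depends on `y` only.
    have hc : y * s ^ (α / 2) / par.noise * par.P q *
        (par.biasedRatio t q ^ (2 / α) * s) ^ (-(α / 2)) =
        (par.biasedRatio t q)⁻¹ * par.snr q * y := by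
      have h3 : (par.biasedRatio t q ^ (2 / α)) ^ (-(α / 2)) = (par.biasedRatio t q)⁻¹ := by
        rw [← Real.rpow_mul hρ.le, ← Real.rpow_neg_one]
        congr 1
        have : α ≠ 0 := by linarith
        field_simp
      have hsa : s ^ (α / 2) ≠ 0 := (Real.rpow_pos_of_pos hs _).ne'
      rw [Real.mul_rpow hκ.le hs.le, h3, Real.rpow_neg hs.le, snr]
      field_simp
    rw [he, effectiveSq_powerLaw _ _ _ hr, hc, par.zPair_eq hα2 t q hy]
    ring
  simp only [voidWeight]
  rw [← ENNReal.ofReal_prod_of_nonneg fun q _ => (Real.exp_pos _).le, ← Real.exp_sum,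
    Finset.sum_neg_distrib, zTotal, Finset.mul_sum, Finset.sum_mul]
  congr 3
  refine Finset.sum_congr rfl fun q _ => ?_
  have := (par.lam_pos t).ne'
  rw [h1]
  field_simp

lemma prod_voidWeight_zero (t : Fin T) (s : ℝ) :
    ∏ q, ENNReal.ofReal (voidWeight (par.lam q) (par.attenuation 0 q)
        (par.biasedRatio t q ^ (2 / α) * s)) =
      ENNReal.ofReal (Real.exp (-(Real.pi * ∑ q, par.lam q *
        par.biasedRatio t q ^ (2 / α) * s))) := by
  simp only [voidWeight]
  rw [← ENNReal.ofReal_prod_of_nonneg fun q _ => (Real.exp_pos _).le, ← Real.exp_sum,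
    Finset.sum_neg_distrib, Finset.mul_sum]
  congr 3
  refine Finset.sum_congr rfl fun q _ => ?_
  have hp := (par.isFadingLaw_interferer q).isProbabilityMeasure
  simp [effectiveSq, attenuation, interfererMGF]
  ring

/-! ### The function `𝒢` -/

lemma integrableOn_exp_mul_exp {c : ℝ} (hc : 0 ≤ c) {y : ℝ} (hy : 0 < y) (hα : 2 < α) {p : ℝ}
    (hp : -1 < p) :
    IntegrableOn (fun ξ : ℝ => ξ ^ p * Real.exp (-(c * ξ)) * Real.exp (-(y * ξ ^ (α / 2))))
      (Ioi 0) := by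
  have h := integrableOn_rpow_mul_exp_neg_mul_rpow hp (by linarith : 0 < α / 2) hy
  refine Integrable.mono' h (by fun_prop) ?_
  refine (ae_restrict_iff' measurableSet_Ioi).2 (ae_of_all _ fun ξ hξ => ?_)
  have hξ0 : 0 < ξ := hξ
  have h1 : 0 ≤ ξ ^ p := Real.rpow_nonneg hξ0.le _
  rw [Real.norm_of_nonneg (by positivity), neg_mul]
  refine mul_le_mul_of_nonneg_right (mul_le_of_le_one_right h1 ?_) (Real.exp_pos _).le
  rw [Real.exp_le_one_iff]
  have : 0 ≤ c * ξ := by positivity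
  linarith

lemma integrableOn_gIntegrand (hα : 2 < α) (t : Fin T) {y : ℝ} (hy : 0 < y) :
    IntegrableOn (par.gIntegrand α t y) (Ioi 0) := by
  have hz := par.one_le_zTotal hα t hy
  have hl := par.lam_pos t
  exact integrableOn_exp_mul_exp (by positivity) hy hα (by linarith)

/-- Integration by parts: the derivative of `-(exp (-c s) * exp (-y s^(α/2)))` with `c = π * lam t *
Z` integrates to one over the half-line. Its two terms are `c` times the wanted integral and the
integral in `gFun`; dividing by `Z` gives the identity. -/
lemma gFun_eq_integral (hα : 2 < α) (t : Fin T) {y : ℝ} (hy : 0 < y) :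
    par.gFun α t y = ∫ s in Ioi (0 : ℝ), Real.pi * par.lam t *
      (Real.exp (-(Real.pi * par.lam t * par.zTotal α t y * s)) *
        Real.exp (-(y * s ^ (α / 2)))) := by
  have hz := par.one_le_zTotal hα t hy
  have hl := par.lam_pos t
  set Z := par.zTotal α t y with hZ
  set c := Real.pi * par.lam t * Z with hc
  have hc0 : 0 < c := by positivity
  have h0 : IntegrableOn (fun s : ℝ => Real.exp (-(c * s)) * Real.exp (-(y * s ^ (α / 2))))
      (Ioi 0) := by
    have := integrableOn_exp_mul_exp hc0.le hy hα (p := 0) (by norm_num)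
    simpa using this
  have h1 : IntegrableOn (par.gIntegrand α t y) (Ioi 0) := par.integrableOn_gIntegrand hα t hy
  set F : ℝ → ℝ := fun s => -(Real.exp (-(c * s)) * Real.exp (-(y * s ^ (α / 2)))) with hF
  have hcont : ContinuousWithinAt F (Ici 0) 0 := by
    refine Continuous.continuousWithinAt ?_
    have : Continuous fun s : ℝ => s ^ (α / 2) := Real.continuous_rpow_const (by linarith)
    fun_prop
  have hderiv : ∀ s ∈ Ioi (0 : ℝ), HasDerivAt F
      (c * (Real.exp (-(c * s)) * Real.exp (-(y * s ^ (α / 2)))) +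
        y * (α / 2) * par.gIntegrand α t y s) s := by
    intro s hs
    have hs0 : 0 < s := hs
    have hd1 := ((hasDerivAt_id s).const_mul c).fun_neg.exp
    have hd2 := ((Real.hasDerivAt_rpow_const (p := α / 2) (Or.inl hs0.ne')).const_mul y).fun_neg.exp
    refine (hd1.fun_mul hd2).fun_neg.congr_deriv ?_
    rw [gIntegrand, ← hZ, ← hc]
    simp only [id]
    ring
  have hlim : Filter.Tendsto F Filter.atTop (nhds 0) := by
    have h3 : Filter.Tendsto (fun s => Real.exp (-(c * s))) Filter.atTop (nhds 0) :=
      Real.tendsto_exp_neg_atTop_nhds_zero.comp (Filter.tendsto_id.const_mul_atTop hc0)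
    have h4 : Filter.Tendsto (fun s : ℝ => Real.exp (-(y * s ^ (α / 2)))) Filter.atTop (nhds 0) :=
      Real.tendsto_exp_neg_atTop_nhds_zero.comp
        ((tendsto_rpow_atTop (by linarith)).const_mul_atTop hy)
    simpa using (h3.mul h4).neg
  have h := integral_Ioi_of_hasDerivAt_of_tendsto hcont hderiv
    ((h0.const_mul c).add (h1.const_mul _)) hlim
  rw [integral_add (h0.const_mul c) (h1.const_mul _), integral_const_mul, integral_const_mul] at h
  have hF0 : F 0 = -1 := by
    simp [hF, Real.zero_rpow (by linarith : α / 2 ≠ 0)]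
  rw [hF0] at h
  rw [gFun, integral_const_mul, ← hZ]
  have hZ0 : Z ≠ 0 := by linarith
  have : Real.pi * par.lam t = c / Z := by
    rw [hc]; field_simp
  rw [this]
  field_simp
  linarith

lemma ofReal_gFun (hα : 2 < α) (t : Fin T) {y : ℝ} (hy : 0 < y) :
    ENNReal.ofReal (par.gFun α t y) = ∫⁻ s in Ioi (0 : ℝ), ENNReal.ofReal (Real.pi * par.lam t *
      (Real.exp (-(Real.pi * par.lam t * par.zTotal α t y * s)) *
        Real.exp (-(y * s ^ (α / 2))))) := by
  have hz := par.one_le_zTotal hα t hy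
  have hl := par.lam_pos t
  rw [par.gFun_eq_integral hα t hy, ofReal_integral_eq_lintegral_ofReal]
  · have := integrableOn_exp_mul_exp (by positivity :
      0 ≤ Real.pi * par.lam t * par.zTotal α t y) hy hα (p := 0) (by norm_num)
    simp only [Real.rpow_zero, one_mul] at this
    exact this.const_mul _
  · exact ae_of_all _ fun s => by positivity

lemma gFun_nonneg (hα : 2 < α) (t : Fin T) {y : ℝ} (hy : 0 < y) : 0 ≤ par.gFun α t y := by
  have hl := par.lam_pos t
  rw [par.gFun_eq_integral hα t hy]
  exact integral_nonneg fun s => by positivity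

lemma gFun_le_one (hα : 2 < α) (t : Fin T) {y : ℝ} (hy : 0 < y) : par.gFun α t y ≤ 1 := by
  have hz := par.one_le_zTotal hα t hy
  have h1 : 0 ≤ ∫ ξ in Ioi (0 : ℝ), par.gIntegrand α t y ξ := by
    refine setIntegral_nonneg measurableSet_Ioi fun ξ hξ => ?_
    have := Real.rpow_nonneg (le_of_lt hξ : (0 : ℝ) ≤ ξ) (α / 2 - 1)
    unfold gIntegrand
    positivity
  have h2 : 1 / par.zTotal α t y ≤ 1 := (div_le_one (by linarith)).2 hz
  have h3 : 0 ≤ α / 2 * (y / par.zTotal α t y) * ∫ ξ in Ioi (0 : ℝ), par.gIntegrand α t y ξ := by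
    have : 0 < α := by linarith
    positivity
  rw [gFun]
  linarith

/-- Dropping the factor that contains `Z` leaves a Gamma integral. The decay in `y` makes the rate
integrand integrable at infinity. -/
lemma gFun_le_rpow (hα : 2 < α) (t : Fin T) {y : ℝ} (hy : 0 < y) :
    par.gFun α t y ≤ Real.pi * par.lam t * Real.Gamma (1 / (α / 2) + 1) * y ^ (-1 / (α / 2)) := by
  have hz := par.one_le_zTotal hα t hy
  have hl := par.lam_pos t
  rw [par.gFun_eq_integral hα t hy, integral_const_mul, mul_assoc (Real.pi * par.lam t),
    mul_comm (Real.Gamma _), ← integral_exp_neg_mul_rpow (by linarith) hy]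
  refine mul_le_mul_of_nonneg_left ?_ (by positivity)
  refine integral_mono_of_nonneg (ae_of_all _ fun s => by positivity) ?_
    ((ae_restrict_iff' measurableSet_Ioi).2 (ae_of_all _ fun s hs => ?_))
  · have := integrableOn_rpow_mul_exp_neg_mul_rpow (s := 0) (by norm_num)
      (by linarith : 0 < α / 2) hy
    simpa [IntegrableOn] using this
  · have hs0 : 0 < s := hs
    simp only [neg_mul]
    refine mul_le_of_le_one_left (Real.exp_pos _).le ?_
    rw [Real.exp_le_one_iff]
    have : 0 ≤ Real.pi * par.lam t * par.zTotal α t y * s := by positivity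
    linarith

/-- The integrand of the average rate is integrable on `(0, ∞)`. -/
lemma lintegral_rate_lt_top (hα : 2 < α) (t : Fin T) :
    ∫⁻ y in Ioi (0 : ℝ), ENNReal.ofReal
      ((1 - par.servingMGF t (par.snr t * y)) * (par.gFun α t y / y)) < ∞ := by
  have hν := par.isFadingLaw_serving t
  have hsnr := par.snr_pos t
  rw [← Ioc_union_Ioi_eq_Ioi (zero_le_one' ℝ),
    lintegral_union measurableSet_Ioi (Ioc_disjoint_Ioi le_rfl)]
  refine ENNReal.add_lt_top.2 ⟨?_, ?_⟩
  -- Near zero, `1 - M(SNR y) ≤ SNR y` cancels the `1 / y`, and `𝒢 ≤ 1`.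
  · refine (setLIntegral_mono measurable_const (g := fun _ => ENNReal.ofReal (par.snr t))
      fun y hy => ENNReal.ofReal_le_ofReal ?_).trans_lt (by simp)
    have hy0 : 0 < y := hy.1
    have h1 := hν.one_sub_le_integral_exp (by positivity : 0 ≤ par.snr t * y)
    have h2 := hν.integral_exp_le_one (by positivity : 0 ≤ par.snr t * y)
    have h3 := par.gFun_le_one hα t hy0
    have h4 := par.gFun_nonneg hα t hy0
    rw [← mul_div_assoc, div_le_iff₀ hy0]
    change (1 - ∫ x, Real.exp (-(par.snr t * y) * x) ∂(par.servingLaw t)) * _ ≤ _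
    nlinarith
  -- At infinity `1 - M ≤ 1`, and the decay of `𝒢` improves `1 / y` to an integrable power.
  · have hint : IntegrableOn (fun y : ℝ => Real.pi * par.lam t * Real.Gamma (1 / (α / 2) + 1) *
        y ^ (-1 / (α / 2) - 1)) (Ioi 1) := by
      refine (integrableOn_Ioi_rpow_of_lt ?_ zero_lt_one).const_mul _
      have : -1 / (α / 2) < 0 := div_neg_of_neg_of_pos (by norm_num) (by linarith)
      linarith
    refine (setLIntegral_mono (by fun_prop) fun y hy => ENNReal.ofReal_le_ofReal ?_).trans_lt
      hint.lintegral_lt_top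
    have hy1 : 1 < y := hy
    have hy0 : 0 < y := by linarith
    have h1 := hν.integral_exp_pos (by positivity : 0 ≤ par.snr t * y)
    have h3 := par.gFun_le_rpow hα t hy0
    have h4 := par.gFun_nonneg hα t hy0
    rw [Real.rpow_sub_one hy0.ne', ← mul_div_assoc, ← mul_div_assoc]
    refine div_le_div_of_nonneg_right ?_ hy0.le
    change (1 - ∫ x, Real.exp (-(par.snr t * y) * x) ∂(par.servingLaw t)) * _ ≤ _
    nlinarith

end NetworkParams

end

/-! ### The rate kernel and its rescaling -/

noncomputable section

lemma lintegral_Ioi_sq (u : ℝ → ℝ≥0∞) :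
    ∫⁻ s in Ioi (0 : ℝ), u s = ∫⁻ ξ in Ioi (0 : ℝ), ENNReal.ofReal (2 * ξ) * u (ξ ^ 2) := by
  have himg : (fun ξ : ℝ => ξ ^ 2) '' Ioi 0 = Ioi 0 := by
    ext s
    simp only [mem_image, mem_Ioi]
    constructor
    · rintro ⟨ξ, hξ, rfl⟩
      positivity
    · intro hs
      exact ⟨Real.sqrt s, Real.sqrt_pos.2 hs, Real.sq_sqrt hs.le⟩
  have h := lintegral_image_eq_lintegral_deriv_mul_of_monotoneOn (s := Ioi (0 : ℝ))
    (f := fun ξ => ξ ^ 2) (f' := fun ξ => 2 * ξ) measurableSet_Ioi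
    (fun ξ _ => by simpa using (hasDerivAt_pow 2 ξ).hasDerivWithinAt)
    (fun a ha b _ hab => pow_le_pow_left₀ (le_of_lt ha) hab 2) u
  rwa [himg] at h

lemma lintegral_Ioi_const_mul {c : ℝ} (hc : 0 < c) (u : ℝ → ℝ≥0∞) :
    ∫⁻ z in Ioi (0 : ℝ), u z = ∫⁻ y in Ioi (0 : ℝ), ENNReal.ofReal c * u (c * y) := by
  have himg : (fun y : ℝ => c * y) '' Ioi 0 = Ioi 0 := by
    ext s
    simp only [mem_image, mem_Ioi]
    constructor
    · rintro ⟨ξ, hξ, rfl⟩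
      positivity
    · intro hs
      exact ⟨s / c, div_pos hs hc, mul_div_cancel₀ _ hc.ne'⟩
  have h := lintegral_image_eq_lintegral_deriv_mul_of_monotoneOn (s := Ioi (0 : ℝ))
    (f := fun y => c * y) (f' := fun _ => c) measurableSet_Ioi
    (fun ξ _ => by simpa using ((hasDerivAt_id ξ).const_mul c).hasDerivWithinAt)
    (fun a _ b _ hab => mul_le_mul_of_nonneg_left hab hc.le) u
  rwa [himg] at h

namespace NetworkParams

variable {T : ℕ} (par : NetworkParams T)

/-- The density of the distance to the serving base station, on the event of association to
tier `t`. -/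
def servingDensity (t : Fin T) (ξ : ℝ) : ℝ :=
  2 * Real.pi * par.lam t * (ξ * Real.exp (-(Real.pi * ∑ q, par.lam q *
      ((par.P q / par.P t) * (par.B q / par.B t)) ^ (2 / par.alpha q) *
        ξ ^ (2 * par.alpha t / par.alpha q))))

lemma servingDensity_pos (t : Fin T) {ξ : ℝ} (hξ : 0 < ξ) : 0 < par.servingDensity t ξ := by
  have := par.lam_pos t
  unfold servingDensity
  positivity

lemma measurable_servingDensity (t : Fin T) : Measurable (par.servingDensity t) := by
  unfold servingDensity
  fun_prop

/-- The joint density of the transform variable `z` and the squared serving distance `s` in the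
average rate. -/
def rateKernel (α : ℝ) (t : Fin T) (z s : ℝ) : ℝ≥0∞ :=
  ENNReal.ofReal (Real.exp (-(z * par.noise)) / z) *
    (ENNReal.ofReal (1 - par.servingMGF t (z * par.P t * s ^ (-(α / 2)))) *
      ENNReal.ofReal (Real.pi * par.lam t) *
      ∏ q, ENNReal.ofReal (voidWeight (par.lam q) (par.attenuation z q)
        (par.biasedRatio t q ^ (2 / α) * s)))

lemma measurable_servingMGF (t : Fin T) : Measurable (par.servingMGF t) :=
  (par.isFadingLaw_serving t).measurable_integral_exp

lemma measurable_rateKernel (α : ℝ) (t : Fin T) :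
    Measurable fun p : ℝ × ℝ => par.rateKernel α t p.1 p.2 := by
  unfold rateKernel
  have h1 := par.measurable_servingMGF t
  have h2 (q : Fin T) : Measurable (Function.uncurry fun z s => par.attenuation z q s) :=
    (par.isFadingLaw_interferer q).measurable_integral_exp.comp
      (by fun_prop : Measurable fun p : ℝ × ℝ => p.1 * par.P q * p.2 ^ (-(par.alpha q / 2)))
  have h3 (q : Fin T) : Measurable fun p : ℝ × ℝ => voidWeight (par.lam q)
      (par.attenuation p.1 q) (par.biasedRatio t q ^ (2 / α) * p.2) := by
    have := (measurable_effectiveSq_uncurry (h2 q)).comp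
      (by fun_prop : Measurable fun p : ℝ × ℝ => (p.1, par.biasedRatio t q ^ (2 / α) * p.2))
    unfold voidWeight
    exact Real.measurable_exp.comp (this.const_mul _).neg
  refine Measurable.mul (by fun_prop) (Measurable.mul (by fun_prop) ?_)
  exact Finset.measurable_fun_prod _ fun q _ => (h3 q).ennreal_ofReal

/-- With `z = s^(α/2) / noise * y`, whose Jacobian is the first factor, the serving transform loses
its dependence on `s`, so the kernel separates into a function of `y` times the integrand of `𝒢`. -/
lemma rateKernel_rescaled {α : ℝ} (hα : ∀ q, par.alpha q = α) (t : Fin T) {y s : ℝ} (hy : 0 < y)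
    (hs : 0 < s) :
    ENNReal.ofReal (s ^ (α / 2) / par.noise) *
        par.rateKernel α t (s ^ (α / 2) / par.noise * y) s =
      ENNReal.ofReal ((1 - par.servingMGF t (par.snr t * y)) / y) *
        ENNReal.ofReal (Real.pi * par.lam t *
          (Real.exp (-(Real.pi * par.lam t * par.zTotal α t y * s)) *
            Real.exp (-(y * s ^ (α / 2))))) := by
  have hn := par.noise_pos
  have hl := par.lam_pos t
  have hsa : 0 < s ^ (α / 2) := Real.rpow_pos_of_pos hs _
  have hz : s ^ (α / 2) / par.noise * y = y * s ^ (α / 2) / par.noise := by ring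
  have h1 : s ^ (α / 2) / par.noise * y * par.P t * s ^ (-(α / 2)) = par.snr t * y := by
    rw [Real.rpow_neg hs.le, snr]
    field_simp
  have hM : 0 ≤ 1 - par.servingMGF t (par.snr t * y) :=
    sub_nonneg.2 ((par.isFadingLaw_serving t).integral_exp_le_one
      (mul_pos (par.snr_pos t) hy).le)
  rw [rateKernel, h1, hz, par.prod_voidWeight hα t hy hs, ← ENNReal.ofReal_mul hM,
    ← ENNReal.ofReal_mul (by positivity), ← ENNReal.ofReal_mul (by positivity),
    ← ENNReal.ofReal_mul (by positivity), ← ENNReal.ofReal_mul (by positivity)]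
  congr 1
  have h2 : y * s ^ (α / 2) / par.noise * par.noise = y * s ^ (α / 2) := by field_simp
  rw [h2]
  field_simp

/-- The average rate as an iterated integral. -/
lemma lintegral_rateKernel_eq {α : ℝ} (hα : ∀ q, par.alpha q = α) (t : Fin T) :
    ∫⁻ z in Ioi (0 : ℝ), ∫⁻ s in Ioi (0 : ℝ), par.rateKernel α t z s =
      ∫⁻ y in Ioi (0 : ℝ), ENNReal.ofReal
        ((1 - par.servingMGF t (par.snr t * y)) * (par.gFun α t y / y)) ∧
    AEMeasurable (fun y => ENNReal.ofReal
      ((1 - par.servingMGF t (par.snr t * y)) * (par.gFun α t y / y)))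
      (volume.restrict (Ioi 0)) := by
  have hα2 : 2 < α := hα t ▸ par.two_lt_alpha t
  have hm := par.measurable_rateKernel α t
  set H : ℝ → ℝ → ℝ≥0∞ := fun s y => ENNReal.ofReal (s ^ (α / 2) / par.noise) *
    par.rateKernel α t (s ^ (α / 2) / par.noise * y) s with hH
  have hHm : Measurable (Function.uncurry H) := by
    refine Measurable.mul (by fun_prop) ?_
    exact hm.comp (by fun_prop : Measurable fun p : ℝ × ℝ =>
      (p.1 ^ (α / 2) / par.noise * p.2, p.1))
  have h1 : ∀ s ∈ Ioi (0 : ℝ), ∫⁻ z in Ioi (0 : ℝ), par.rateKernel α t z s =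
      ∫⁻ y in Ioi (0 : ℝ), H s y := fun s hs =>
    lintegral_Ioi_const_mul (div_pos (Real.rpow_pos_of_pos hs _) par.noise_pos) _
  have h2 : ∀ y ∈ Ioi (0 : ℝ), ∫⁻ s in Ioi (0 : ℝ), H s y = ENNReal.ofReal
        ((1 - par.servingMGF t (par.snr t * y)) * (par.gFun α t y / y)) := by
    intro y hy
    have hM : 0 ≤ 1 - par.servingMGF t (par.snr t * y) :=
      sub_nonneg.2 ((par.isFadingLaw_serving t).integral_exp_le_one
        (mul_pos (par.snr_pos t) hy).le)
    rw [setLIntegral_congr_fun measurableSet_Ioi fun s hs => par.rateKernel_rescaled hα t hy hs,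
      lintegral_const_mul' _ _ ENNReal.ofReal_ne_top, ← par.ofReal_gFun hα2 t hy,
      ← ENNReal.ofReal_mul (div_nonneg hM (le_of_lt hy))]
    congr 1
    ring
  constructor
  -- The scale of `y` depends on `s`, so `s` is made the outer variable first and the order is
  -- restored after the substitution.
  · rw [lintegral_lintegral_swap hm.aemeasurable, setLIntegral_congr_fun measurableSet_Ioi h1,
      lintegral_lintegral_swap hHm.aemeasurable, setLIntegral_congr_fun measurableSet_Ioi h2]
  -- Measurability in `y` is inherited from Tonelli for `H`, with no separate study of the series in
  -- `𝒵`.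
  · refine (hHm.lintegral_prod_left' (μ := volume.restrict (Ioi (0 : ℝ)))).aemeasurable.congr ?_
    exact (ae_restrict_iff' measurableSet_Ioi).2 (ae_of_all _ h2)

lemma integrableOn_rate {α : ℝ} (hα : ∀ q, par.alpha q = α) (t : Fin T) :
    IntegrableOn (fun y => (1 - par.servingMGF t (par.snr t * y)) * (par.gFun α t y / y))
      (Ioi 0) ∧
    ∫ y in Ioi (0 : ℝ), (1 - par.servingMGF t (par.snr t * y)) * (par.gFun α t y / y) =
      (∫⁻ z in Ioi (0 : ℝ), ∫⁻ s in Ioi (0 : ℝ), par.rateKernel α t z s).toReal := by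
  have hα2 : 2 < α := hα t ▸ par.two_lt_alpha t
  obtain ⟨h1, h2⟩ := par.lintegral_rateKernel_eq hα t
  have hnn : ∀ y ∈ Ioi (0 : ℝ),
      0 ≤ (1 - par.servingMGF t (par.snr t * y)) * (par.gFun α t y / y) := fun y hy =>
    mul_nonneg (sub_nonneg.2 ((par.isFadingLaw_serving t).integral_exp_le_one
        (mul_pos (par.snr_pos t) hy).le))
      (div_nonneg (par.gFun_nonneg hα2 t hy) (le_of_lt hy))
  have hnn' := (ae_restrict_iff' measurableSet_Ioi).2 (ae_of_all volume hnn)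
  have hm : AEMeasurable (fun y => (1 - par.servingMGF t (par.snr t * y)) * (par.gFun α t y / y))
      (volume.restrict (Ioi 0)) := by
    refine h2.ennreal_toReal.congr ?_
    filter_upwards [hnn'] with y hy
    exact ENNReal.toReal_ofReal hy
  refine ⟨⟨hm.aestronglyMeasurable, ?_⟩, ?_⟩
  · rw [hasFiniteIntegral_iff_ofReal hnn']
    exact par.lintegral_rate_lt_top hα2 t
  · rw [h1, integral_eq_lintegral_of_nonneg_ae hnn' hm.aestronglyMeasurable]

end NetworkParams

/-! ### Association, serving distance and disintegration -/

namespace CellularNetwork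

variable {T : ℕ} {par : NetworkParams T} {Ω : Type*} [MeasurableSpace Ω] {μ : Measure Ω}

lemma measurable_dist (N : CellularNetwork par μ) (q : Fin T) : Measurable (N.dist q) :=
  measurable_nearest (N.measurable_pos q)

lemma measurableSet_associated (N : CellularNetwork par μ) (t : Fin T) :
    MeasurableSet (N.associated t) := by
  have h := N.measurable_dist
  unfold associated
  rw [ofPred_forall]
  exact MeasurableSet.iInter fun q => measurableSet_le (by fun_prop) (by fun_prop)

lemma measurable_interference (N : CellularNetwork par μ) (t : Fin T) :
    Measurable (N.interference t) := by
  unfold interference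
  refine Measurable.tsum fun q => Measurable.tsum fun b => Measurable.ite ?_ measurable_const ?_
  · by_cases hq : q = t
    · simp only [hq, true_and]
      exact measurableSet_eq_fun (N.measurable_pos t b).norm (N.measurable_dist t)
    · simp [hq]
  · have h1 := N.measurable_pos q b
    have h2 := N.measurable_gain q b
    fun_prop

/-- Raising the comparison of biased powers to the power `2 / α` makes it linear in squared
distances. Almost sure positivity of the distances is needed since `0 ^ (-α)` is `0` in Lean, not
infinite. -/
lemma ae_mem_associated_iff (N : CellularNetwork par μ) {α : ℝ} (hα : ∀ q, par.alpha q = α)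
    (t : Fin T) : ∀ᵐ ω ∂μ, ω ∈ N.associated t ↔ ∀ q, par.biasedRatio t q ^ (2 / α) *
      nearest (N.pos t) ω ^ 2 ≤ nearest (N.pos q) ω ^ 2 := by
  have hα2 : 2 < α := hα t ▸ par.two_lt_alpha t
  have hα0 : 0 < α := by linarith
  have hpos : ∀ᵐ ω ∂μ, ∀ q, 0 < nearest (N.pos q) ω := by
    rw [ae_all_iff]
    intro q
    filter_upwards [(N.isPoisson q).ae_exists_nearest (par.lam_pos q).le] with ω hω using hω.1
  filter_upwards [hpos] with ω hω
  refine forall_congr' fun q => ?_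
  rw [N.dist_eq_nearest, N.dist_eq_nearest, hα, hα]
  have hP := par.P_pos t
  have hB := par.B_pos t
  have hρ := par.biasedRatio_pos t q
  have hx := hω t
  have hy := hω q
  set x := nearest (N.pos t) ω
  set y := nearest (N.pos q) ω
  have e1 : par.biasedRatio t q ^ (2 / α) * x ^ 2 = (par.biasedRatio t q * x ^ α) ^ (2 / α) := by
    rw [Real.mul_rpow hρ.le (Real.rpow_nonneg hx.le _), ← Real.rpow_mul hx.le,
      mul_div_cancel₀ _ hα0.ne', ← Real.rpow_natCast]
    norm_num
  have e2 : y ^ 2 = (y ^ α) ^ (2 / α) := by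
    rw [← Real.rpow_mul hy.le, mul_div_cancel₀ _ hα0.ne', ← Real.rpow_natCast]
    norm_num
  have hxa := Real.rpow_pos_of_pos hx α
  have hya := Real.rpow_pos_of_pos hy α
  rw [e1, e2, Real.rpow_le_rpow_iff (by positivity) hya.le (by positivity), Real.rpow_neg hx.le,
    Real.rpow_neg hy.le, NetworkParams.biasedRatio]
  have e3 : par.P q * (y ^ α)⁻¹ * par.B q = par.P q * par.B q / y ^ α := by ring
  have e4 : par.P t * (x ^ α)⁻¹ * par.B t = par.P t * par.B t / x ^ α := by ring
  have e5 : par.P q / par.P t * (par.B q / par.B t) * x ^ α =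
    par.P q * par.B q * x ^ α / (par.P t * par.B t) := by field_simp
  rw [e3, e4, e5, div_le_div_iff₀ hya hxa, div_le_iff₀ (by positivity), mul_comm (y ^ α)]

lemma setLIntegral_associated (N : CellularNetwork par μ) {α : ℝ} (hα : ∀ q, par.alpha q = α)
    (t : Fin T) (F : Ω → ℝ≥0∞) : ∫⁻ ω in N.associated t, F ω ∂μ =
      ∫⁻ ω, {ω | ∀ q, par.biasedRatio t q ^ (2 / α) * nearest (N.pos t) ω ^ 2 ≤
        nearest (N.pos q) ω ^ 2}.indicator F ω ∂μ := by
  rw [← lintegral_indicator (N.measurableSet_associated t)]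
  refine lintegral_congr_ae ?_
  filter_upwards [N.ae_mem_associated_iff hα t] with ω hω
  by_cases h : ω ∈ N.associated t
  · rw [indicator_of_mem h, indicator_of_mem (by exact hω.1 h)]
  · rw [indicator_of_notMem h, indicator_of_notMem (by exact fun h' => h (hω.2 h'))]

/-- The weighted formula with `z = 0`, where every factor is one, followed by `s = ξ ^ 2`. It
identifies the weight in `rateIntegrand`, up to its constant, as the density of the serving distance
on the association event. -/
lemma lintegral_dist (N : CellularNetwork par μ) {α : ℝ} (hα : ∀ q, par.alpha q = α) (t : Fin T)
    {ψ : ℝ → ℝ≥0∞} (hψ : Measurable ψ) :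
    ∫⁻ ω in N.associated t, ψ (N.dist t ω) ∂μ =
      ∫⁻ ξ in Ioi (0 : ℝ), ENNReal.ofReal (par.servingDensity t ξ) * ψ ξ := by
  have hκ (q : Fin T) : 0 ≤ par.biasedRatio t q ^ (2 / α) :=
    Real.rpow_nonneg (par.biasedRatio_pos t q).le _
  have hκt : par.biasedRatio t t ^ (2 / α) = 1 := by
    rw [par.biasedRatio_self, Real.one_rpow]
  have h := lintegral_expNeg_nonservingSum N.isPoisson par.lam_pos N.indep_tiers
    (fun q => par.isAttenuation le_rfl q) t hκ hκt (φ := fun s => ψ (Real.sqrt s)) (by fun_prop)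
  rw [N.setLIntegral_associated hα]
  refine Eq.trans (lintegral_congr fun ω => ?_) (h.trans ?_)
  · have h0 : nonservingSum N.pos t
        (fun q s => ENNReal.ofReal (-Real.log (par.attenuation 0 q s))) ω = 0 := by
      have (q : Fin T) (s : ℝ) : par.attenuation 0 q s = 1 := by
        have hp := (par.isFadingLaw_interferer q).isProbabilityMeasure
        simp [NetworkParams.attenuation, NetworkParams.interfererMGF]
      simp [nonservingSum, this]
    simp only [indicator_apply]
    split_ifs
    · rw [h0, expNeg_zero, mul_one, Real.sqrt_sq (nearest_nonneg _ _)]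
      rfl
    · rfl
  · rw [lintegral_Ioi_sq]
    refine setLIntegral_congr_fun measurableSet_Ioi fun ξ hξ => ?_
    have hξ0 : 0 < ξ := hξ
    have hl := par.lam_pos t
    have hα0 : α ≠ 0 := by
      have := hα t ▸ par.two_lt_alpha t
      linarith
    rw [par.prod_voidWeight_zero, Real.sqrt_sq hξ0.le, mul_comm (ψ ξ), mul_right_comm _ (ψ ξ),
      ← mul_assoc, ← ENNReal.ofReal_mul (by positivity), ← ENNReal.ofReal_mul (by positivity)]
    congr 2
    have he (q : Fin T) : ξ ^ (2 * par.alpha t / par.alpha q) = ξ ^ 2 := by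
      rw [hα, hα, mul_div_cancel_right₀ _ hα0, ← Real.rpow_natCast]
      norm_num
    simp_rw [NetworkParams.servingDensity, he, NetworkParams.biasedRatio, hα]
    ring

lemma measure_associated_pos (N : CellularNetwork par μ) {α : ℝ} (hα : ∀ q, par.alpha q = α)
    (t : Fin T) : 0 < μ (N.associated t) := by
  have h := N.lintegral_dist hα t (ψ := fun _ => 1) measurable_const
  rw [setLIntegral_const, one_mul] at h
  simp only [mul_one] at h
  rw [h, setLIntegral_pos_iff (par.measurable_servingDensity t).ennreal_ofReal]
  have : Ioi (0 : ℝ) ⊆ (Function.support fun ξ => ENNReal.ofReal (par.servingDensity t ξ)) ∩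
      Ioi 0 := fun ξ hξ => ⟨by simpa using par.servingDensity_pos t hξ, hξ⟩
  refine lt_of_lt_of_le ?_ (measure_mono this)
  simp

/-- Disintegration with respect to the serving distance. -/
lemma lintegral_conditionalLaw [IsProbabilityMeasure μ] (N : CellularNetwork par μ) {α : ℝ}
    (hα : ∀ q, par.alpha q = α) (t : Fin T) {F : ℝ → ℝ × ℝ → ℝ≥0∞}
    (hF : Measurable (Function.uncurry F)) :
    ∫⁻ ω in N.associated t, F (N.dist t ω)
        (N.servingGain t ω, (N.interference t ω).toReal) ∂μ =
      ∫⁻ ξ in Ioi (0 : ℝ), ENNReal.ofReal (par.servingDensity t ξ) *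
        ∫⁻ p, F ξ p ∂(N.conditionalLaw t ξ) := by
  set Y : Ω → ℝ × ℝ := fun ω => (N.servingGain t ω, (N.interference t ω).toReal) with hY
  have hYm : Measurable Y :=
    (N.measurable_servingGain t).prodMk (N.measurable_interference t).ennreal_toReal
  have hd := N.measurable_dist t
  have hA := N.measure_associated_pos hα t
  have hFm : Measurable fun ξ => ∫⁻ p, F ξ p ∂(condDistrib Y (N.dist t)
      (cond μ (N.associated t)) ξ) := hF.lintegral_kernel_prod_right
  have h1 : ∫⁻ ω, F (N.dist t ω) (Y ω) ∂(cond μ (N.associated t)) =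
      ∫⁻ ω, (∫⁻ p, F (N.dist t ω) p ∂(N.conditionalLaw t (N.dist t ω)))
        ∂(cond μ (N.associated t)) := by
    have h2 : ∫⁻ ω, F (N.dist t ω) (Y ω) ∂(cond μ (N.associated t)) =
        ∫⁻ x, Function.uncurry F x ∂((cond μ (N.associated t)).map fun ω => (N.dist t ω, Y ω)) := by
      rw [lintegral_map hF (hd.prodMk hYm)]
      rfl
    rw [h2, ← compProd_map_condDistrib hYm.aemeasurable, Measure.lintegral_compProd hF]
    exact lintegral_map hFm hd
  -- Both sides carry the normalisation by the probability of association, which cancels because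
  -- that probability is positive.
  rw [ProbabilityTheory.cond, lintegral_smul_measure, lintegral_smul_measure, smul_eq_mul, smul_eq_mul,
    ENNReal.mul_right_inj (ENNReal.inv_ne_zero.2 (measure_ne_top _ _))
      (ENNReal.inv_ne_top.2 hA.ne')] at h1
  rw [h1]
  exact N.lintegral_dist hα t hFm

/-- The expectation of the integrand of the transform of the rate. -/
lemma lintegral_rateKernel (N : CellularNetwork par μ) {α : ℝ} (hα : ∀ q, par.alpha q = α)
    (t : Fin T) {z : ℝ} (hz : 0 < z) :
    ∫⁻ ω in N.associated t, ENNReal.ofReal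
        ((1 - Real.exp (-(z * (par.P t * N.servingGain t ω * N.dist t ω ^ (-par.alpha t))))) *
          Real.exp (-(z * (par.noise + (N.interference t ω).toReal))) / z) ∂μ =
      ∫⁻ s in Ioi (0 : ℝ), par.rateKernel α t z s := by
  have hκ (q : Fin T) : 0 ≤ par.biasedRatio t q ^ (2 / α) :=
    Real.rpow_nonneg (par.biasedRatio_pos t q).le _
  have hκt : par.biasedRatio t t ^ (2 / α) = 1 := by
    rw [par.biasedRatio_self, Real.one_rpow]
  have hν := par.isFadingLaw_serving t
  have hP := par.P_pos t
  set near : Fin T → (Fin T × ℕ → Plane) → ℝ := fun q p =>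
    nearest (fun b (p : Fin T × ℕ → Plane) => p (q, b)) p with hnear
  have hnm (q : Fin T) : Measurable (near q) := measurable_nearest fun b => by fun_prop
  set A : Set (Fin T × ℕ → Plane) :=
    {p | ∀ q, par.biasedRatio t q ^ (2 / α) * near t p ^ 2 ≤ near q p ^ 2} with hA
  have hAm : MeasurableSet A := by
    rw [hA, ofPred_forall]
    exact MeasurableSet.iInter fun q => measurableSet_le (by fun_prop) (by fun_prop)
  -- The association indicator depends on positions only, so it can travel inside `k` while the
  -- gains are averaged.
  set k : (Fin T × ℕ → Plane) → ℝ → ℝ≥0∞ := fun p x =>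
    A.indicator 1 p * (1 - expNeg (ENNReal.ofReal
      (z * par.P t * (near t p ^ 2) ^ (-(α / 2)) * x))) with hk
  have hkm : Measurable (Function.uncurry k) := by
    refine Measurable.mul ?_ ?_
    · exact (measurable_one.indicator hAm).comp measurable_fst
    · have := (hnm t).comp (measurable_fst : Measurable (Prod.fst : (Fin T × ℕ → Plane) × ℝ → _))
      refine measurable_const.sub (measurable_expNeg.comp (Measurable.ennreal_ofReal ?_))
      exact (((this.pow_const 2).pow_const _).const_mul _).mul measurable_snd
  have hk1 (p) (x) : k p x ≤ 1 := by
    refine mul_le_one' ?_ tsub_le_self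
    exact indicator_le_self' (fun _ _ => zero_le) _ |>.trans_eq rfl
  have hkint (p) : ∫⁻ x, k p x ∂(par.servingLaw t) = A.indicator 1 p *
      ENNReal.ofReal (1 - par.servingMGF t (z * par.P t * (near t p ^ 2) ^ (-(α / 2)))) := by
    have hc : 0 ≤ z * par.P t * (near t p ^ 2) ^ (-(α / 2)) := by positivity
    have hp := hν.isProbabilityMeasure
    simp only [hk]
    rw [lintegral_const_mul _ (by fun_prop)]
    congr 1
    refine Eq.trans ?_ (hν.ofReal_one_sub_integral_exp hc).symm
    refine lintegral_congr_ae ?_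
    filter_upwards [hν.nonneg] with x hx
    rw [expNeg_ofReal (mul_nonneg hc hx), ENNReal.ofReal_sub _ (Real.exp_pos _).le,
      ENNReal.ofReal_one]
  have hMm := par.measurable_servingMGF t
  have h1 := N.lintegral_expNeg_interference t hz.le hkm hk1
  have h2 := lintegral_expNeg_nonservingSum N.isPoisson par.lam_pos N.indep_tiers
    (fun q => par.isAttenuation hz.le q) t hκ hκt
    (φ := fun s => ENNReal.ofReal (1 - par.servingMGF t (z * par.P t * s ^ (-(α / 2)))))
    (by fun_prop)
  have h3 : ∫⁻ ω, (∫⁻ x, k (N.positions ω) x ∂(par.servingLaw t)) * expNeg (nonservingSum N.pos t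
        (fun q s => ENNReal.ofReal (-Real.log (par.attenuation z q s))) ω) ∂μ =
      ∫⁻ s in Ioi (0 : ℝ), ENNReal.ofReal (1 - par.servingMGF t (z * par.P t * s ^ (-(α / 2)))) *
        ENNReal.ofReal (Real.pi * par.lam t) * ∏ q, ENNReal.ofReal (voidWeight (par.lam q)
          (par.attenuation z q) (par.biasedRatio t q ^ (2 / α) * s)) := by
    rw [← h2]
    refine lintegral_congr fun ω => ?_
    rw [hkint]
    by_cases hω : N.positions ω ∈ A
    · rw [indicator_of_mem hω, indicator_of_mem (by exact hω), Pi.one_apply, one_mul]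
      rfl
    · rw [indicator_of_notMem hω, indicator_of_notMem (by exact hω), zero_mul, zero_mul]
  have h4 : ∫⁻ s in Ioi (0 : ℝ), par.rateKernel α t z s =
      ENNReal.ofReal (Real.exp (-(z * par.noise)) / z) *
        ∫⁻ ω, k (N.positions ω) (N.servingGain t ω) *
          expNeg (ENNReal.ofReal z * N.interference t ω) ∂μ := by
    rw [h1, h3, ← lintegral_const_mul' _ _ ENNReal.ofReal_ne_top]
    rfl
  rw [h4, ← lintegral_const_mul' _ _ ENNReal.ofReal_ne_top, N.setLIntegral_associated hα]
  refine lintegral_congr_ae ?_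
  filter_upwards [N.ae_servingGain_nonneg, N.ae_interference_lt_top t] with ω hg hI
  by_cases hω : N.positions ω ∈ A
  · have hc : 0 ≤ z * par.P t * (near t (N.positions ω) ^ 2) ^ (-(α / 2)) * N.servingGain t ω := by
      have := hg t
      positivity
    have hd : N.dist t ω ^ (-α) = (N.dist t ω ^ 2) ^ (-(α / 2)) :=
      rpow_neg_alpha _ (nearest_nonneg (N.pos t) ω) _
    simp only [hk]
    rw [indicator_of_mem hω, indicator_of_mem (by exact hω), Pi.one_apply, one_mul,
      expNeg_ofReal hc, ← ENNReal.ofReal_toReal hI.ne, ← ENNReal.ofReal_mul hz.le,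
      expNeg_ofReal (by positivity), ← ENNReal.ofReal_one,
      ← ENNReal.ofReal_sub _ (Real.exp_pos _).le, ← ENNReal.ofReal_mul' (Real.exp_pos _).le,
      ← ENNReal.ofReal_mul (by positivity), ENNReal.toReal_ofReal ENNReal.toReal_nonneg, hα,
      hd, mul_add, neg_add, Real.exp_add]
    congr 1
    have e : z * (par.P t * N.servingGain t ω * (N.dist t ω ^ 2) ^ (-(α / 2))) =
        z * par.P t * (near t (N.positions ω) ^ 2) ^ (-(α / 2)) * N.servingGain t ω := by
      have : N.dist t ω = near t (N.positions ω) := rfl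
      rw [this]
      ring
    rw [e]
    ring
  · simp only [hk]
    rw [indicator_of_notMem hω, indicator_of_notMem (by exact hω), zero_mul, zero_mul, mul_zero]

/-- The expected rate on the event of association. -/
lemma lintegral_shannonRate (N : CellularNetwork par μ) {α : ℝ} (hα : ∀ q, par.alpha q = α)
    (t : Fin T) :
    ∫⁻ ω in N.associated t, ENNReal.ofReal (shannonRate par t (N.dist t ω) (N.servingGain t ω)
        (N.interference t ω).toReal) ∂μ =
      ∫⁻ z in Ioi (0 : ℝ), ∫⁻ s in Ioi (0 : ℝ), par.rateKernel α t z s := by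
  have hprob := N.isProbabilityMeasure
  have h1 : ∫⁻ ω in N.associated t, ENNReal.ofReal (shannonRate par t (N.dist t ω)
        (N.servingGain t ω) (N.interference t ω).toReal) ∂μ =
      ∫⁻ ω in N.associated t, (∫⁻ z in Ioi (0 : ℝ), ENNReal.ofReal
        ((1 - Real.exp (-(z * (par.P t * N.servingGain t ω * N.dist t ω ^ (-par.alpha t))))) *
          Real.exp (-(z * (par.noise + (N.interference t ω).toReal))) / z)) ∂μ := by
    refine lintegral_congr_ae (ae_restrict_of_ae ?_)
    filter_upwards [N.ae_servingGain_nonneg] with ω hg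
    have hX : 0 ≤ par.P t * N.servingGain t ω * N.dist t ω ^ (-par.alpha t) :=
      mul_nonneg (mul_nonneg (par.P_pos t).le (hg t))
        (Real.rpow_nonneg (nearest_nonneg (N.pos t) ω) _)
    rw [lintegral_exp_eq_log hX (add_pos_of_pos_of_nonneg par.noise_pos ENNReal.toReal_nonneg)]
    rfl
  rw [h1, lintegral_lintegral_swap]
  · exact setLIntegral_congr_fun measurableSet_Ioi fun z hz => N.lintegral_rateKernel hα t hz
  · have m1 := N.measurable_servingGain t
    have m2 := N.measurable_dist t
    have m3 := N.measurable_interference t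
    refine Measurable.aemeasurable ?_
    unfold Function.uncurry
    fun_prop

lemma measurable_shannonRate (par : NetworkParams T) (t : Fin T) :
    Measurable fun x : ℝ × ℝ × ℝ => shannonRate par t x.1 x.2.1 x.2.2 := by
  unfold shannonRate
  fun_prop

lemma shannonRate_nonneg (par : NetworkParams T) (t : Fin T) {ξ g i : ℝ} (hξ : 0 ≤ ξ) (hg : 0 ≤ g)
    (hi : 0 ≤ i) : 0 ≤ shannonRate par t ξ g i := by
  have h1 := par.P_pos t
  have h2 := par.noise_pos
  refine Real.log_nonneg (le_add_of_nonneg_right ?_)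
  positivity

/-- Almost surely the conditional law is carried by nonnegative gains and interferences. -/
lemma ae_conditionalLaw_nonneg [IsProbabilityMeasure μ] (N : CellularNetwork par μ) {α : ℝ}
    (hα : ∀ q, par.alpha q = α) (t : Fin T) :
    ∀ᵐ ξ ∂(volume.restrict (Ioi (0 : ℝ))), ∀ᵐ p ∂(N.conditionalLaw t ξ), 0 ≤ p.1 ∧ 0 ≤ p.2 := by
  set S : Set (ℝ × ℝ) := {p | 0 ≤ p.1 ∧ 0 ≤ p.2} with hS
  have hSm : MeasurableSet S :=
    (measurableSet_le measurable_const measurable_fst).inter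
      (measurableSet_le measurable_const measurable_snd)
  have hm : Measurable (Function.uncurry fun (_ : ℝ) (p : ℝ × ℝ) =>
      Sᶜ.indicator (1 : ℝ × ℝ → ℝ≥0∞) p) :=
    (measurable_one.indicator hSm.compl).comp measurable_snd
  have h := N.lintegral_conditionalLaw hα t hm
  have h0 : ∫⁻ ω in N.associated t, Sᶜ.indicator (1 : ℝ × ℝ → ℝ≥0∞)
      (N.servingGain t ω, (N.interference t ω).toReal) ∂μ = 0 := by
    rw [lintegral_eq_zero_iff (f := fun ω => Sᶜ.indicator (1 : ℝ × ℝ → ℝ≥0∞)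
      (N.servingGain t ω, (N.interference t ω).toReal)) ((measurable_one.indicator hSm.compl).comp
      ((N.measurable_servingGain t).prodMk (N.measurable_interference t).ennreal_toReal))]
    refine ae_restrict_of_ae ?_
    filter_upwards [N.ae_servingGain_nonneg] with ω hg
    refine indicator_of_notMem ?_ _
    rw [mem_compl_iff, not_not]
    exact ⟨hg t, ENNReal.toReal_nonneg⟩
  have hker : Measurable fun ξ => N.conditionalLaw t ξ Sᶜ :=
    Kernel.measurable_coe _ hSm.compl
  simp_rw [lintegral_indicator_one hSm.compl] at h
  -- The mass given to the bad set integrates to zero against a density that is positive on `(0,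
  -- ∞)`, so it vanishes for almost every distance.
  rw [h0, eq_comm, lintegral_eq_zero_iff
    (f := fun ξ => ENNReal.ofReal (par.servingDensity t ξ) * N.conditionalLaw t ξ Sᶜ)
    ((par.measurable_servingDensity t).ennreal_ofReal.mul hker)] at h
  filter_upwards [h, ae_restrict_mem measurableSet_Ioi] with ξ hξ hξ0
  have hD : ENNReal.ofReal (par.servingDensity t ξ) ≠ 0 := by
    simpa using par.servingDensity_pos t hξ0
  exact (mul_eq_zero.1 hξ).resolve_left hD

end CellularNetwork

end

/-! ### The rate of a tier, and the theorem -/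

noncomputable section

namespace CellularNetwork

variable {T : ℕ} {par : NetworkParams T} {Ω : Type*} [MeasurableSpace Ω] {μ : Measure Ω}

/-- The rate of a tier in terms of the rate kernel. -/
theorem rateIntegrand_spec [IsProbabilityMeasure μ] (N : CellularNetwork par μ) {α : ℝ}
    (hα : ∀ q, par.alpha q = α) (t : Fin T) :
    (∀ᵐ ξ ∂(volume.restrict (Ioi (0 : ℝ))),
      Integrable (fun p : ℝ × ℝ => shannonRate par t ξ p.1 p.2) (N.conditionalLaw t ξ)) ∧
    IntegrableOn (N.rateIntegrand t) (Ioi 0) ∧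
    N.tierRate t =
      (∫⁻ z in Ioi (0 : ℝ), ∫⁻ s in Ioi (0 : ℝ), par.rateKernel α t z s).toReal := by
  have hα2 : 2 < α := hα t ▸ par.two_lt_alpha t
  have hl := par.lam_pos t
  have hm := (measurable_shannonRate par t).ennreal_ofReal
  set F : ℝ → ℝ × ℝ → ℝ≥0∞ := fun ξ p => ENNReal.ofReal (shannonRate par t ξ p.1 p.2) with hF
  set K : ℝ → ℝ≥0∞ := fun ξ => ∫⁻ p, F ξ p ∂(N.conditionalLaw t ξ) with hK
  have hKm : Measurable K := Measurable.lintegral_kernel_prod_right (κ := condDistrib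
    (fun ω => (N.servingGain t ω, (N.interference t ω).toReal)) (N.dist t)
    (ProbabilityTheory.cond μ (N.associated t))) hm
  have hDm := par.measurable_servingDensity t
  -- Both sides are the expected rate on the association event: one by disintegration over the
  -- serving distance, the other by the integral representation of the logarithm.
  have hI : ∫⁻ ξ in Ioi (0 : ℝ), ENNReal.ofReal (par.servingDensity t ξ) * K ξ =
      ∫⁻ z in Ioi (0 : ℝ), ∫⁻ s in Ioi (0 : ℝ), par.rateKernel α t z s :=
    (N.lintegral_conditionalLaw hα t (F := F) hm).symm.trans (N.lintegral_shannonRate hα t)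
  have hfin : ∫⁻ ξ in Ioi (0 : ℝ), ENNReal.ofReal (par.servingDensity t ξ) * K ξ < ∞ := by
    rw [hI, (par.lintegral_rateKernel_eq hα t).1]
    exact par.lintegral_rate_lt_top hα2 t
  have hDKm : Measurable fun ξ => ENNReal.ofReal (par.servingDensity t ξ) * K ξ :=
    hDm.ennreal_ofReal.mul hKm
  have hnn := N.ae_conditionalLaw_nonneg hα t
  have hpos := ae_restrict_mem (μ := volume) (measurableSet_Ioi (a := (0 : ℝ)))
  have hsm (ξ : ℝ) : Measurable fun p : ℝ × ℝ => shannonRate par t ξ p.1 p.2 :=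
    (measurable_shannonRate par t).comp measurable_prodMk_left
  have hnn' : ∀ᵐ ξ ∂(volume.restrict (Ioi (0 : ℝ))),
      0 ≤ᵐ[N.conditionalLaw t ξ] fun p => shannonRate par t ξ p.1 p.2 := by
    filter_upwards [hnn, hpos] with ξ h hξ
    filter_upwards [h] with p hp
    exact shannonRate_nonneg par t (le_of_lt hξ) hp.1 hp.2
  -- Bochner and `[0, ∞]`-valued conditional rates agree here even if the latter is infinite, as
  -- both conversions then give zero; integrability is deduced afterwards from `hfin`.
  have hrate : ∀ᵐ ξ ∂(volume.restrict (Ioi (0 : ℝ))), N.rateIntegrand t ξ =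
      (2 * Real.pi * par.lam t)⁻¹ *
        (ENNReal.ofReal (par.servingDensity t ξ) * K ξ).toReal := by
    filter_upwards [hnn', hpos] with ξ h hξ
    rw [rateIntegrand, conditionalRate, integral_eq_lintegral_of_nonneg_ae h
      (hsm ξ).aestronglyMeasurable, ENNReal.toReal_mul,
      ENNReal.toReal_ofReal (par.servingDensity_pos t hξ).le, NetworkParams.servingDensity]
    have : 2 * Real.pi * par.lam t ≠ 0 := by positivity
    rw [mul_assoc (2 * Real.pi * par.lam t), inv_mul_cancel_left₀ this]
  have hint : IntegrableOn
      (fun ξ => (ENNReal.ofReal (par.servingDensity t ξ) * K ξ).toReal) (Ioi 0) :=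
    integrable_toReal_of_lintegral_ne_top hDKm.aemeasurable hfin.ne
  have hlt := ae_lt_top hDKm hfin.ne
  refine ⟨?_, ?_, ?_⟩
  · filter_upwards [hnn', hlt, hpos] with ξ h hξ hξ0
    refine ⟨(hsm ξ).aestronglyMeasurable, ?_⟩
    rw [hasFiniteIntegral_iff_ofReal h]
    have hD : ENNReal.ofReal (par.servingDensity t ξ) ≠ 0 := by
      simpa using par.servingDensity_pos t hξ0
    exact ENNReal.lt_top_of_mul_ne_top_right hξ.ne hD
  · exact (hint.const_mul _).congr (hrate.mono fun _ h => h.symm)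
  · rw [tierRate, integral_congr_ae hrate, integral_const_mul,
      integral_toReal hDKm.aemeasurable hlt, hI]
    have : 2 * Real.pi * par.lam t ≠ 0 := by positivity
    rw [mul_inv_cancel_left₀ this]

end CellularNetwork

end

/-- The average rate of a tier in a network whose tiers share the path-loss exponent `α`. The
conjuncts before the last one say that all the quantities in it are well defined. -/
theorem corollary6 {T : ℕ} (par : NetworkParams T) {Ω : Type*} [MeasurableSpace Ω]
    (μ : Measure Ω) [IsProbabilityMeasure μ] (N : CellularNetwork par μ)
    (α : ℝ) (hα : ∀ q, par.alpha q = α) (t : Fin T) :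
    (MeasurableSet (N.associated t) ∧ 0 < μ (N.associated t)) ∧
    (∀ᵐ ω ∂μ, N.interference t ω < ∞) ∧
    (∀ᵐ ξ ∂(volume.restrict (Ioi (0 : ℝ))),
      Integrable (fun p : ℝ × ℝ => shannonRate par t ξ p.1 p.2) (N.conditionalLaw t ξ)) ∧
    IntegrableOn (N.rateIntegrand t) (Ioi 0) ∧
    (∀ q, ∀ s : ℝ, 0 < s → Summable (par.tailTerm α q s)) ∧
    (∀ y : ℝ, 0 < y →
      0 < par.zTotal α t y ∧ IntegrableOn (par.gIntegrand α t y) (Ioi 0)) ∧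
    IntegrableOn (fun y => (1 - par.servingMGF t (par.snr t * y)) * (par.gFun α t y / y))
      (Ioi 0) ∧
    N.tierRate t =
      ∫ y in Ioi (0 : ℝ), (1 - par.servingMGF t (par.snr t * y)) * (par.gFun α t y / y) := by
  have hα2 : 2 < α := hα t ▸ par.two_lt_alpha t
  obtain ⟨h1, h2, h3⟩ := N.rateIntegrand_spec hα t
  obtain ⟨h4, h5⟩ := par.integrableOn_rate hα t
  exact ⟨⟨N.measurableSet_associated t, N.measure_associated_pos hα t⟩,
    N.ae_interference_lt_top t, h1, h2, fun q s hs => par.summable_tailTerm hα2 q hs,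
    fun y hy => ⟨zero_lt_one.trans_le (par.one_le_zTotal hα2 t hy),
      par.integrableOn_gIntegrand hα2 t hy⟩, h4, h3.trans h5.symm⟩
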